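/- Let $\mathfrak u$ be a compact semisimple Lie algebra with complexification $\mathfrak g$, simple roots $(\alpha_r)_{r\in I}$, weight lattice $P$ with fundamental weights $\varpi_r$, Cartan matrix $a_{rs}=(\alpha_r^\vee,\alpha_s)$, and invariant form normalised so that the short roots of each simple summand have square length $2$; put $d_r=\tfrac12(\alpha_r,\alpha_r)$. Let $0<q<1$ and $q_r=q^{d_r}$, and use the $q$-integers $[n]_x=\frac{x^{-n}-x^n}{x^{-1}-x}$ and the corresponding factorials and binomials. Let $U_q(\mathfrak g)$ be the unital complex algebra with generators $E_r,F_r$ $(r\in I)$ and $K_\omega$ $(\omega\in P)$ and relations $K_0=1$, $K_{\omega+\chi}=K_\omega K_\chi$, $K_\omega E_r=q^{(\omega,\alpha_r)}E_rK_\omega$, $K_\omega F_r=q^{-(\omega,\alpha_r)}F_rK_\omega$, $[E_r,F_s]=\delta_{rs}\frac{K_r-K_r^{-1}}{q_r-q_r^{-1}}$ (where $K_r=K_{\alpha_r}$), and, for $r\neq s$, $\sum_{n=0}^{1-a_{rs}}(-1)^n\binom{1-a_{rs}}{n}_{q_r}E_r^{1-a_{rs}-n}E_sE_r^n=0$ together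 with the same relation for the $F$'s. Let $U_q(\mathfrak u)$ be this algebra with the $*$-structure $E_r^*=F_rK_r$, $F_r^*=K_r^{-1}E_r$, $K_\omega^*=K_\omega$. Let $(X,\tau)$ be an admissible pair: $\tau$ is an automorphism of the Dynkin diagram with $\tau^2=\mathrm{id}$, $X\subsetneq I$ is $\tau$-invariant, $w_X\alpha_r=-\alpha_{\tau(r)}$ for $r\in X$, where $w_X$ is the longest element of the Weyl group $W_X$ generated by the simple reflections $\sigma_r$, $r\in X$, and $(\alpha_r,\rho_X^\vee)\in\mathbb Z$ whenever $\tau(r)=r$, where $\rho_X^\vee$ is half the sum of the positive coroots of the root system generated by $X$. Put $\Theta=-w_X\circ\tau$. Let $(z_r)_{r\in I}$ be complex numbers of modulus $1$ with $z_r\overline{z_{\tau(r)}}=(-1)^{2(\alpha_r,\rho_X^\vee)}$ for all $r$, and $z_r=1$ if $r\in X$ or $\tau(r)=r$. Let $\theta_q=(\mathrm{Ad}\,z)\circ T_{w_X}\circ\psi\circ\tau\circ\omega$, a composition of the following algebra automorphisms of $U_q(\mathfrak g)$: * $\omega(E_r)=-F_r$, $\omega(F_r)=-E_r$, $\omega(K_\chi)=K_{-\chi}$;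 * $\tau(E_r)=E_{\tau(r)}$, $\tau(F_r)=F_{\tau(r)}$, $\tau(K_{\varpi_r})=K_{\varpi_{\tau(r)}}$; * $\psi(E_r)=E_rK_r$, $\psi(F_r)=K_r^{-1}F_r$, $\psi(K_\chi)=K_\chi$; * $T_{w_X}=T_{r_1}\cdots T_{r_M}$ for a reduced expression $w_X=\sigma_{r_1}\cdots \sigma_{r_M}$, where $T_r$ is Lusztig's automorphism $T_r(E_r)=-F_rK_r$, $T_r(F_r)=-K_r^{-1}E_r$, $T_r(K_\chi)=K_{\sigma_r\chi}$ and, for $s\neq r$, $T_r(E_s)=\sum_{m+n=-a_{rs}}\frac{(-q_r)^{-m}}{[m]_{q_r}![n]_{q_r}!}E_r^nE_sE_r^m$, $T_r(F_s)=\sum_{m+n=-a_{rs}}\frac{(-q_r)^{m}}{[m]_{q_r}![n]_{q_r}!}F_r^mF_sF_r^n$; * $\mathrm{Ad}\,z$: $E_r\mapsto z_rE_r$, $F_r\mapsto z_r^{-1}F_r$, $K_\chi\mapsto K_\chi$. Let $I_{\mathcal C}=\{r\in I\setminus X:\tau(r)\ne r,\ (\alpha_r,\Theta(\alpha_r))=0\}$,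 $I_{\mathrm{ns}}=\{r\in I\setminus X:\tau(r)=r,\ (\alpha_r,\alpha_s)=0\ \forall s\in X\}$ and $I_{\mathcal S}=\{r\in I_{\mathrm{ns}}: a_{sr}\in2\mathbb Z\ \forall s\in I_{\mathrm{ns}}\}$. Let $\mathbf t=(\mathbf c,\mathbf s)$ consist of nonzero complex numbers $c_r$ and complex numbers $s_r$, $r\in I\setminus X$, with $c_r=c_{\tau(r)}$ for $r\in I_{\mathcal C}$ and $s_r=0$ for $r\notin I_{\mathcal S}$. Let $U_q^{\mathbf t}(\mathfrak k^{\mathbb C})\subset U_q(\mathfrak u)$ be the Letzter–Kolb (right coideal) subalgebra generated by $E_r,F_r,K_r^{\pm1}$ for $r\in X$, by $K_\omega$ for $\omega\in P$ with $\Theta(\omega)=\omega$, and by $B_r=F_r+c_r\theta_q(F_rK_r)K_r^{-1}+s_rK_r^{-1}$ for $r\in I\setminus X$. Let $I^*$ be a set of representatives of the $\tau$-orbits in $I\setminus X$, and assume that $c_r>0$ for every $r\in I\setminus X$ such that $\tau(r)=r$, or $r\in I_{\mathcal C}$, or $r\notin I^*$. Theorem. If for all $r\in I\setminus X$ one has $s_r\in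 i\mathbb R$ and $$c_{\tau(r)}c_r=q^{(\Theta(\alpha_r)-\alpha_r,\ \alpha_{\tau(r)})},$$ then $U_q^{\mathbf t}(\mathfrak k^{\mathbb C})$ is $*$-invariant: $x^*\in U_q^{\mathbf t}(\mathfrak k^{\mathbb C})$ for every $x\in U_q^{\mathbf t}(\mathfrak k^{\mathbb C})$. -/

import Mathlib

open scoped BigOperators

noncomputable section

namespace QSymPair

/-! ### Cartan data of finite type -/

/-- A Cartan matrix of finite type `a i j = ⟨αᵢ^∨, αⱼ⟩` (equivalently: a complex semisimple Lie
algebra with chosen simple roots `αᵢ`, `i ∈ I`), together with the numbers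
`d i = (αᵢ, αᵢ) / 2` for the invariant form in which the short roots of every simple summand have
square length `2`. The numbers `d i` are determined by the matrix. -/
structure CartanDatum (I : Type*) [Fintype I] [DecidableEq I] where
  a : Matrix I I ℤ
  diag : ∀ i, a i i = 2
  offdiag : ∀ i j, i ≠ j → a i j ≤ 0
  d : I → ℕ
  d_pos : ∀ i, 0 < d i
  symm : ∀ i j, (d i : ℤ) * a i j = (d j : ℤ) * a j i
  posDef : (Matrix.of fun i j => ((d i : ℝ) * (a i j : ℝ))).PosDef
  short : ∀ i, ∃ j, Relation.ReflTransGen (fun k l => a k l ≠ 0) i j ∧ d j = 1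

variable {I : Type*} [Fintype I] [DecidableEq I]

namespace CartanDatum

variable (C : CartanDatum I)

/-- The simple root `αⱼ`, as an element of the weight lattice `P`. Weights are written in
coordinates with respect to the fundamental weights: `ω = ∑ᵢ ω i • ϖᵢ`, `ω i = ⟨ω, αᵢ^∨⟩`. -/
def root (j : I) : I → ℤ := fun i => C.a i j

/-- The invariant form `(ω, αᵣ) = (αᵣ, αᵣ) / 2 * ⟨ω, αᵣ^∨⟩` for a weight `ω`. -/
def form (ω : I → ℤ) (r : I) : ℤ := (C.d r : ℤ) * ω r

/-- The simple reflection `sᵢ` on the weight lattice. -/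
def refl (i : I) (ω : I → ℤ) : I → ℤ := ω - ω i • C.root i

/-- The Weyl group element `s_{r₁} ⋯ s_{r_M}` of the word `[r₁, …, r_M]`, acting on weights. -/
def wordAct (l : List I) (ω : I → ℤ) : I → ℤ := l.foldr C.refl ω

/-- The word is a reduced expression. -/
def IsReducedWord (l : List I) : Prop :=
  ∀ l' : List I, C.wordAct l' = C.wordAct l → l.length ≤ l'.length

/-- The word is a reduced expression of the longest element `w_X` of the parabolic subgroup
`W_X` generated by the `sᵣ`, `r ∈ X`. -/
def IsLongestWord (X : Finset I) (l : List I) : Prop :=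
  (∀ r ∈ l, r ∈ X) ∧ C.IsReducedWord l ∧
    ∀ l' : List I, (∀ r ∈ l', r ∈ X) → C.IsReducedWord l' → l'.length ≤ l.length

/-- The coroots of the root system generated by `X`, in coordinates with respect to the simple
coroots: the orbits of the simple coroots `αₛ^∨`, `s ∈ X`, under the reflections `sᵣ`, `r ∈ X`. -/
inductive IsCoroot (X : Finset I) : (I → ℤ) → Prop
  | simple (s : I) (hs : s ∈ X) : IsCoroot X (Pi.single s 1)
  | refl (r : I) (hr : r ∈ X) (h : I → ℤ) (hh : IsCoroot X h) :
      IsCoroot X (h - (∑ j, h j * C.a j r) • (Pi.single r 1 : I → ℤ))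

/-- `2ρ_X^∨`, the sum of the positive coroots of the root system generated by `X`. -/
def twoRhoCheck (X : Finset I) : I → ℤ :=
  ∑ᶠ h ∈ {h : I → ℤ | C.IsCoroot X h ∧ 0 ≤ h}, h

/-- The integer `2 (αᵣ, ρ_X^∨)`. -/
def twoRhoPairing (X : Finset I) (r : I) : ℤ := ∑ i, C.root r i * C.twoRhoCheck X i

end CartanDatum

/-! ### Admissible pairs (Satake diagrams) -/

/-- An admissible pair `(X, τ)`. -/
structure AdmissiblePair (C : CartanDatum I) where
  X : Finset I
  τ : Equiv.Perm I
  τ_invol : ∀ r, τ (τ r) = r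
  τ_cartan : ∀ r s, C.a (τ r) (τ s) = C.a r s
  X_ne : X ≠ Finset.univ
  τ_X : ∀ r ∈ X, τ r ∈ X
  τ_longest : ∀ l, C.IsLongestWord X l → ∀ r ∈ X, C.wordAct l (C.root r) = -C.root (τ r)
  rho_int : ∀ r, τ r = r → Even (C.twoRhoPairing X r)

namespace AdmissiblePair

variable {C : CartanDatum I} (S : AdmissiblePair C)

/-- `Θ = -w_X ∘ τ` on weights, the dual of the involution `θ(X, τ)` restricted to the Cartan
subalgebra; `w` is a reduced expression of `w_X`. -/
def Theta (w : List I) (ω : I → ℤ) : I → ℤ := -C.wordAct w (fun i => ω (S.τ.symm i))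

/-- The values `zᵣ = s(X, τ)(αᵣ)` of a torus element `s(X, τ)`. -/
structure IsTorusChoice (z : I → ℂ) : Prop where
  norm_eq_one : ∀ r, ‖z r‖ = 1
  eq_one_of_mem : ∀ r ∈ S.X, z r = 1
  mul_conj : ∀ r, z r * (starRingEnd ℂ) (z (S.τ r)) = (-1 : ℂ) ^ C.twoRhoPairing S.X r
  eq_one_of_fixed : ∀ r, S.τ r = r → z r = 1

/-- `I_𝒞`. -/
def IC (w : List I) : Set I :=
  {r | r ∉ S.X ∧ S.τ r ≠ r ∧ C.form (S.Theta w (C.root r)) r = 0}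

/-- `I_ns`. -/
def Ins : Set I :=
  {r | r ∉ S.X ∧ S.τ r = r ∧ ∀ s ∈ S.X, C.form (C.root r) s = 0}

/-- `I_𝒮`. -/
def IS : Set I := {r | r ∈ S.Ins ∧ ∀ s ∈ S.Ins, Even (C.a s r)}

/-- The parameter set `𝒞_q`; only the values `c r` with `r ∉ X` matter. -/
def IsCParam (w : List I) (c : I → ℂ) : Prop :=
  (∀ r, r ∉ S.X → c r ≠ 0) ∧ ∀ r ∈ S.IC w, c r = c (S.τ r)

/-- The parameter set `𝒮_q`; only the values `s r` with `r ∉ X` matter. -/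
def IsSParam (s : I → ℂ) : Prop := ∀ r, r ∉ S.X → r ∉ S.IS → s r = 0

/-- `J` is a set of representatives of the `τ`-orbits in `I ∖ X`. -/
def IsOrbitReps (J : Set I) : Prop :=
  (∀ r ∈ J, r ∉ S.X) ∧ ∀ r, r ∉ S.X → ∃! s, s ∈ J ∧ (s = r ∨ s = S.τ r)

end AdmissiblePair

/-! ### The quantized enveloping algebra -/

/-- `[n]_x`. -/
def qInt (x : ℂ) (n : ℕ) : ℂ := (x⁻¹ ^ n - x ^ n) / (x⁻¹ - x)

/-- `[n]_x!`. -/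
def qFact (x : ℂ) (n : ℕ) : ℂ := ∏ k ∈ Finset.range n, qInt x (k + 1)

/-- The `q`-binomial coefficient, for `n ≤ m`. -/
def qBinom (x : ℂ) (m n : ℕ) : ℂ := qFact x m / (qFact x n * qFact x (m - n))

/-- Generators of `U_q(𝔤)`: `Eᵣ`, `Fᵣ` (`r ∈ I`) and `K_ω` (`ω ∈ P`). -/
inductive Gen (I : Type*)
  | E (r : I)
  | F (r : I)
  | K (ω : I → ℤ)

/-- The free algebra on the generators. -/
abbrev Free (I : Type*) := FreeAlgebra ℂ (Gen I)

namespace Free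

def E (r : I) : Free I := FreeAlgebra.ι ℂ (Gen.E r)
def F (r : I) : Free I := FreeAlgebra.ι ℂ (Gen.F r)
def K (ω : I → ℤ) : Free I := FreeAlgebra.ι ℂ (Gen.K ω)

end Free

namespace CartanDatum

variable (C : CartanDatum I) (q : Set.Ioo (0 : ℝ) 1)

/-- `q` as a complex number. -/
def qc (q : Set.Ioo (0 : ℝ) 1) : ℂ := ((q : ℝ) : ℂ)

/-- `qᵣ = q ^ ((αᵣ, αᵣ) / 2)`. -/
def qr (r : I) : ℂ := qc q ^ C.d r

/-- The exponent `1 - a_{rs}` in the Serre relation for `r ≠ s`. -/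
def serreN (r s : I) : ℕ := (1 - C.a r s).toNat

/-- The left-hand side of the quantum Serre relation in an algebra, evaluated at `x`, `y`. -/
def serre {A : Type*} [Ring A] [Algebra ℂ A] (r s : I) (x y : A) : A :=
  ∑ n ∈ Finset.range (C.serreN r s + 1),
    ((-1) ^ n * qBinom (C.qr q r) (C.serreN r s) n) • (x ^ (C.serreN r s - n) * y * x ^ n)

/-- The defining relations of `U_q(𝔤)`. -/
inductive Rel : Free I → Free I → Prop
  | K_zero : Rel (Free.K 0) 1
  | K_add (ω χ : I → ℤ) : Rel (Free.K (ω + χ)) (Free.K ω * Free.K χ)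
  | K_E (ω : I → ℤ) (r : I) :
      Rel (Free.K ω * Free.E r) (qc q ^ C.form ω r • (Free.E r * Free.K ω))
  | K_F (ω : I → ℤ) (r : I) :
      Rel (Free.K ω * Free.F r) (qc q ^ (-C.form ω r) • (Free.F r * Free.K ω))
  | E_F_same (r : I) :
      Rel (Free.E r * Free.F r - Free.F r * Free.E r)
        ((C.qr q r - (C.qr q r)⁻¹)⁻¹ • (Free.K (C.root r) - Free.K (-C.root r)))
  | E_F (r s : I) (h : r ≠ s) : Rel (Free.E r * Free.F s - Free.F s * Free.E r) 0
  | serre_E (r s : I) (h : r ≠ s) : Rel (C.serre q r s (Free.E r) (Free.E s)) 0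
  | serre_F (r s : I) (h : r ≠ s) : Rel (C.serre q r s (Free.F r) (Free.F s)) 0

/-- The quantized enveloping algebra `U_q(𝔤)`, with Cartan part labelled by the weight lattice. -/
def U : Type _ := RingQuot (C.Rel q)

instance : Ring (C.U q) := inferInstanceAs (Ring (RingQuot (C.Rel q)))
instance : Algebra ℂ (C.U q) := inferInstanceAs (Algebra ℂ (RingQuot (C.Rel q)))

/-- The quotient map from the free algebra. -/
def proj : Free I →ₐ[ℂ] C.U q := RingQuot.mkAlgHom ℂ (C.Rel q)

def E (r : I) : C.U q := C.proj q (Free.E r)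
def F (r : I) : C.U q := C.proj q (Free.F r)
def K (ω : I → ℤ) : C.U q := C.proj q (Free.K ω)

variable {q}

theorem proj_rel {x y : Free I} (h : C.Rel q x y) : C.proj q x = C.proj q y :=
  RingQuot.mkAlgHom_rel ℂ h

theorem K_zero : C.K q 0 = 1 := by
  simpa [K] using C.proj_rel (Rel.K_zero (q := q))

theorem K_add (ω χ : I → ℤ) : C.K q (ω + χ) = C.K q ω * C.K q χ := by
  simpa [K] using C.proj_rel (Rel.K_add (q := q) ω χ)

theorem K_E (ω : I → ℤ) (r : I) :
    C.K q ω * C.E q r = qc q ^ C.form ω r • (C.E q r * C.K q ω) := by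
  simpa [K, E] using C.proj_rel (Rel.K_E (q := q) ω r)

theorem K_F (ω : I → ℤ) (r : I) :
    C.K q ω * C.F q r = qc q ^ (-C.form ω r) • (C.F q r * C.K q ω) := by
  simpa only [K, F, map_mul, map_smul] using C.proj_rel (Rel.K_F (q := q) ω r)

theorem E_F_same (r : I) : C.E q r * C.F q r - C.F q r * C.E q r =
    (C.qr q r - (C.qr q r)⁻¹)⁻¹ • (C.K q (C.root r) - C.K q (-C.root r)) := by
  simpa only [K, F, E, map_mul, map_smul, map_sub] using C.proj_rel (Rel.E_F_same (q := q) r)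

theorem E_F (r s : I) (h : r ≠ s) : C.E q r * C.F q s - C.F q s * C.E q r = 0 := by
  simpa only [F, E, map_mul, map_sub, map_zero] using C.proj_rel (Rel.E_F (q := q) r s h)

theorem serre_E (r s : I) (h : r ≠ s) : C.serre q r s (C.E q r) (C.E q s) = 0 := by
  simpa only [serre, E, map_mul, map_sum, map_smul, map_pow, map_zero] using
    C.proj_rel (Rel.serre_E (q := q) r s h)

theorem serre_F (r s : I) (h : r ≠ s) : C.serre q r s (C.F q r) (C.F q s) = 0 := by
  simpa only [serre, F, map_mul, map_sum, map_smul, map_pow, map_zero] using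
    C.proj_rel (Rel.serre_F (q := q) r s h)

theorem qc_ne : qc q ≠ 0 := by
  have h := q.2.1
  simpa [qc] using h.ne'

theorem E_K (ω : I → ℤ) (r : I) :
    C.E q r * C.K q ω = qc q ^ (-C.form ω r) • (C.K q ω * C.E q r) := by
  rw [K_E, smul_smul, ← zpow_add₀ qc_ne]; simp

theorem F_K (ω : I → ℤ) (r : I) :
    C.F q r * C.K q ω = qc q ^ (C.form ω r) • (C.K q ω * C.F q r) := by
  rw [K_F, smul_smul, ← zpow_add₀ qc_ne]; simp

theorem form_root (r s : I) : C.form (C.root r) s = C.form (C.root s) r := C.symm s r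

theorem form_add (ω χ : I → ℤ) (r : I) : C.form (ω + χ) r = C.form ω r + C.form χ r := by
  simp [form, mul_add]

theorem form_neg (ω : I → ℤ) (r : I) : C.form (-ω) r = -C.form ω r := by
  simp [form]

theorem form_smul (n : ℕ) (ω : I → ℤ) (r : I) : C.form (n • ω) r = n * C.form ω r := by
  simp [form]; ring

/-! ### The `*`-structure of `U_q(𝔲)` -/

/-- The exponents of the scalars that occur when the `K`'s are collected in the image of a
Serre monomial. -/
def gExp (r s : I) : ℕ → ℤ
  | 0 => 0
  | n + 1 => gExp r s n - (n * C.form (C.root r) r + C.form (C.root s) r)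

theorem gExp_succ (r s : I) (n : ℕ) : C.gExp r s (n + 1) =
    C.gExp r s n - (n * C.form (C.root r) r + C.form (C.root s) r) := rfl

theorem K_F_pow (ω : I → ℤ) (r : I) (n : ℕ) :
    C.K q ω * C.F q r ^ n = qc q ^ (-(n * C.form ω r)) • (C.F q r ^ n * C.K q ω) := by
  induction n with
  | zero => simp
  | succ n ih =>
    rw [pow_succ, ← mul_assoc, ih, smul_mul_assoc, mul_assoc, K_F, mul_smul_comm, smul_smul,
      ← zpow_add₀ qc_ne, ← mul_assoc]
    congr 2; push_cast; ring

theorem E_pow_K (ω : I → ℤ) (r : I) (n : ℕ) :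
    C.E q r ^ n * C.K q ω = qc q ^ (-(n * C.form ω r)) • (C.K q ω * C.E q r ^ n) := by
  induction n with
  | zero => simp
  | succ n ih =>
    rw [pow_succ', mul_assoc, ih, mul_smul_comm, ← mul_assoc, E_K, smul_mul_assoc, smul_smul,
      ← zpow_add₀ qc_ne, mul_assoc]
    congr 2; push_cast; ring

theorem form_comb (n : ℕ) (r s t : I) : C.form (n • C.root r + C.root s) t =
    n * C.form (C.root r) t + C.form (C.root s) t := by
  rw [form_add, form_smul]

theorem monomial_F (r s : I) (a b : ℕ) :
    (C.F q r * C.K q (C.root r)) ^ a * (C.F q s * C.K q (C.root s)) *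
        (C.F q r * C.K q (C.root r)) ^ b =
      qc q ^ C.gExp r s (a + b) • (C.F q r ^ a * C.F q s * C.F q r ^ b *
        C.K q ((a + b) • C.root r + C.root s)) := by
  induction a with
  | zero =>
    induction b with
    | zero => simp [gExp]
    | succ b ih =>
      rw [pow_succ, ← mul_assoc, ih, smul_mul_assoc]
      have h : C.F q r ^ 0 * C.F q s * C.F q r ^ b * C.K q ((0 + b) • C.root r + C.root s) *
          (C.F q r * C.K q (C.root r)) = qc q ^ (-(b * C.form (C.root r) r + C.form (C.root s) r)) •
          (C.F q r ^ 0 * C.F q s * C.F q r ^ (b + 1) *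
            C.K q ((0 + (b + 1)) • C.root r + C.root s)) := by
        have h2 : (0 + (b + 1)) • C.root r + C.root s =
            ((0 + b) • C.root r + C.root s) + C.root r := by
          rw [← add_assoc, add_smul (0 + b) 1, one_smul]; abel
        rw [h2, K_add C ((0 + b) • C.root r + C.root s) (C.root r), ← mul_assoc,
          mul_assoc _ _ (C.F q r), K_F, form_comb, mul_smul_comm,
          smul_mul_assoc, pow_succ]
        simp only [mul_assoc, zero_add]
      rw [h, smul_smul, ← zpow_add₀ qc_ne]
      congr 2
      rw [show 0 + (b + 1) = (0 + b) + 1 from rfl, gExp_succ, Nat.zero_add]; ring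
  | succ a ih =>
    rw [pow_succ', mul_assoc, mul_assoc, ← mul_assoc (_ ^ a), ih, mul_smul_comm]
    have h : C.F q r * C.K q (C.root r) * (C.F q r ^ a * C.F q s * C.F q r ^ b *
          C.K q ((a + b) • C.root r + C.root s)) =
        qc q ^ (-(((a + b : ℕ) : ℤ) * C.form (C.root r) r + C.form (C.root s) r)) •
          (C.F q r ^ (a + 1) * C.F q s * C.F q r ^ b *
            C.K q ((a + 1 + b) • C.root r + C.root s)) := by
      have h2 : (a + 1 + b) • C.root r + C.root s =
          C.root r + ((a + b) • C.root r + C.root s) := by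
        rw [show a + 1 + b = (a + b) + 1 by ring, add_smul (a + b) 1, one_smul]; abel
      have h3 : C.K q (C.root r) * (C.F q r ^ a * C.F q s * C.F q r ^ b) =
          qc q ^ (-(((a + b : ℕ) : ℤ) * C.form (C.root r) r + C.form (C.root s) r)) •
            (C.F q r ^ a * C.F q s * C.F q r ^ b * C.K q (C.root r)) := by
        rw [← mul_assoc, ← mul_assoc, K_F_pow, smul_mul_assoc, mul_assoc (_ ^ a) _ (C.F q s), K_F,
          mul_smul_comm, smul_smul, smul_mul_assoc, ← mul_assoc, mul_assoc _ _ (C.F q r ^ b),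
          K_F_pow, mul_smul_comm, smul_smul, ← zpow_add₀ qc_ne, ← zpow_add₀ qc_ne, ← mul_assoc,
          form_root C r s]
        congr 2
        push_cast; ring
      rw [h2, K_add C (C.root r), mul_assoc (C.F q r), ← mul_assoc (C.K q (C.root r)), h3, smul_mul_assoc,
        mul_smul_comm, pow_succ']
      simp only [mul_assoc]
    rw [h, smul_smul, ← zpow_add₀ qc_ne]
    congr 2
    rw [show a + 1 + b = (a + b) + 1 by ring, gExp]; ring

theorem monomial_E (r s : I) (a b : ℕ) :
    (C.K q (-C.root r) * C.E q r) ^ a * (C.K q (-C.root s) * C.E q s) *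
        (C.K q (-C.root r) * C.E q r) ^ b =
      qc q ^ (-C.gExp r s (a + b)) • (C.K q (-((a + b) • C.root r + C.root s)) *
        (C.E q r ^ a * C.E q s * C.E q r ^ b)) := by
  induction b with
  | zero =>
    induction a with
    | zero => simp [gExp]
    | succ a ih =>
      rw [pow_zero, mul_one, pow_succ', mul_assoc]
      rw [pow_zero, mul_one] at ih
      rw [ih, mul_smul_comm]
      have h : C.K q (-C.root r) * C.E q r * (C.K q (-((a + 0) • C.root r + C.root s)) *
          (C.E q r ^ a * C.E q s * C.E q r ^ 0)) =
          qc q ^ (a * C.form (C.root r) r + C.form (C.root s) r) •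
          (C.K q (-((a + 1 + 0) • C.root r + C.root s)) *
            (C.E q r ^ (a + 1) * C.E q s * C.E q r ^ 0)) := by
        have h2 : -((a + 1 + 0) • C.root r + C.root s) =
            -C.root r + -((a + 0) • C.root r + C.root s) := by
          rw [add_zero, add_zero, add_smul a 1, one_smul]; abel
        rw [h2, K_add, mul_assoc (C.K q (-C.root r)), ← mul_assoc (C.E q r), E_K, form_neg,
          form_comb, smul_mul_assoc, mul_smul_comm, pow_succ', neg_neg]
        simp only [mul_assoc, add_zero]
      rw [h, smul_smul, ← zpow_add₀ qc_ne]
      congr 2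
      simp only [add_zero, gExp]; ring
  | succ b ih =>
    rw [pow_succ, ← mul_assoc, ih, smul_mul_assoc]
    have h : C.K q (-((a + b) • C.root r + C.root s)) *
          (C.E q r ^ a * C.E q s * C.E q r ^ b) * (C.K q (-C.root r) * C.E q r) =
        qc q ^ (((a + b : ℕ) : ℤ) * C.form (C.root r) r + C.form (C.root s) r) •
          (C.K q (-((a + (b + 1)) • C.root r + C.root s)) *
            (C.E q r ^ a * C.E q s * C.E q r ^ (b + 1))) := by
      have h2 : -((a + (b + 1)) • C.root r + C.root s) =
          -((a + b) • C.root r + C.root s) + -C.root r := by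
        rw [← add_assoc, add_smul (a + b) 1, one_smul]; abel
      have h3 : C.E q r ^ a * C.E q s * C.E q r ^ b * C.K q (-C.root r) =
          qc q ^ (((a + b : ℕ) : ℤ) * C.form (C.root r) r + C.form (C.root s) r) •
            (C.K q (-C.root r) * (C.E q r ^ a * C.E q s * C.E q r ^ b)) := by
        rw [mul_assoc, E_pow_K, mul_smul_comm, ← mul_assoc, mul_assoc (_ ^ a) _ (C.K q _), E_K,
          mul_smul_comm, smul_mul_assoc, smul_smul, ← mul_assoc, E_pow_K, smul_mul_assoc,
          smul_mul_assoc, smul_smul, ← zpow_add₀ qc_ne, ← zpow_add₀ qc_ne, form_neg, form_neg,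
          form_root C r s]
        simp only [mul_assoc]
        congr 2
        push_cast; ring
      rw [h2, K_add, ← mul_assoc, mul_assoc (C.K q _) _ (C.K q (-C.root r)), h3, mul_smul_comm,
        smul_mul_assoc, pow_succ]
      simp only [mul_assoc]
    rw [h, smul_smul, ← zpow_add₀ qc_ne]
    congr 2
    rw [show a + (b + 1) = (a + b) + 1 from rfl, gExp_succ]; ring

theorem conj_qc : (starRingEnd ℂ) (qc q) = qc q := Complex.conj_ofReal _

theorem conj_qr (r : I) : (starRingEnd ℂ) (C.qr q r) = C.qr q r := by
  rw [qr, map_pow, conj_qc]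

theorem conj_qInt {x : ℂ} (hx : (starRingEnd ℂ) x = x) (n : ℕ) :
    (starRingEnd ℂ) (qInt x n) = qInt x n := by
  simp [qInt, hx]

theorem conj_qFact {x : ℂ} (hx : (starRingEnd ℂ) x = x) (n : ℕ) :
    (starRingEnd ℂ) (qFact x n) = qFact x n := by
  simp [qFact, conj_qInt hx]

theorem conj_qBinom {x : ℂ} (hx : (starRingEnd ℂ) x = x) (m n : ℕ) :
    (starRingEnd ℂ) (qBinom x m n) = qBinom x m n := by
  simp [qBinom, conj_qFact hx]

theorem qBinom_symm (x : ℂ) {m n : ℕ} (h : n ≤ m) : qBinom x m (m - n) = qBinom x m n := by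
  rw [qBinom, qBinom, Nat.sub_sub_self h, mul_comm]

/-- Reading a Serre expression backwards changes it by a sign. -/
theorem serre_reverse {A : Type*} [Ring A] [Algebra ℂ A] (r s : I) (x y : A) :
    ∑ n ∈ Finset.range (C.serreN r s + 1),
      ((-1 : ℂ) ^ n * qBinom (C.qr q r) (C.serreN r s) n) •
        (x ^ n * y * x ^ (C.serreN r s - n)) =
      (-1 : ℂ) ^ C.serreN r s • C.serre q r s x y := by
  rw [serre, Finset.smul_sum, ← Finset.sum_range_reflect]
  refine Finset.sum_congr rfl fun n hn => ?_
  have hn' : n ≤ C.serreN r s := by simpa [Nat.lt_succ_iff] using hn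
  rw [show C.serreN r s + 1 - 1 - n = C.serreN r s - n by omega, Nat.sub_sub_self hn',
    qBinom_symm _ hn', smul_smul, ← mul_assoc, ← pow_add]
  congr 2
  obtain ⟨k, hk⟩ := Nat.exists_eq_add_of_le hn'
  rw [hk, Nat.add_sub_cancel_left, show n + k + n = k + 2 * n by ring, pow_add, pow_mul]
  simp

/-- The opposite algebra with the conjugate complex structure: conjugate-linear
anti-homomorphisms into `U` are homomorphisms into `ConjOp`. -/
def ConjOp (C : CartanDatum I) (q : Set.Ioo (0 : ℝ) 1) : Type _ := (C.U q)ᵐᵒᵖ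

instance : Ring (C.ConjOp q) := inferInstanceAs (Ring (C.U q)ᵐᵒᵖ)

instance : Algebra ℂ (C.ConjOp q) :=
  RingHom.toAlgebra' ((algebraMap ℂ (C.U q)ᵐᵒᵖ).comp (starRingEnd ℂ))
    fun c x => Algebra.commutes (A := (C.U q)ᵐᵒᵖ) ((starRingEnd ℂ) c) x

/-- The identity map, as an additive equivalence. -/
def unop : C.ConjOp q ≃+ C.U q := (MulOpposite.opAddEquiv (α := C.U q)).symm

def op : C.U q ≃+ C.ConjOp q := MulOpposite.opAddEquiv (α := C.U q)

theorem unop_op (x : C.U q) : C.unop (C.op x) = x := rfl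
theorem unop_mul (x y : C.ConjOp q) : C.unop (x * y) = C.unop y * C.unop x := rfl
theorem unop_one : C.unop (1 : C.ConjOp q) = 1 := rfl
theorem unop_smul (c : ℂ) (x : C.ConjOp q) :
    C.unop (c • x) = (starRingEnd ℂ) c • C.unop x := by
  rw [Algebra.smul_def, unop_mul, Algebra.smul_def, Algebra.commutes]
  rfl
theorem unop_pow (x : C.ConjOp q) (n : ℕ) : C.unop (x ^ n) = C.unop x ^ n := rfl

/-- The values of the `*`-operation on generators:
`Eᵣ^* = Fᵣ Kᵣ`, `Fᵣ^* = Kᵣ⁻¹ Eᵣ`, `K_ω^* = K_ω`. -/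
def starGen : Gen I → C.U q
  | Gen.E r => C.F q r * C.K q (C.root r)
  | Gen.F r => C.K q (-C.root r) * C.E q r
  | Gen.K ω => C.K q ω

def starFree : Free I →ₐ[ℂ] C.ConjOp q := FreeAlgebra.lift ℂ fun g => C.op (C.starGen g)

theorem starFree_E (r : I) : C.unop (C.starFree (q := q) (Free.E r)) =
    C.F q r * C.K q (C.root r) := by
  simp [starFree, Free.E, unop_op, starGen]
theorem starFree_F (r : I) : C.unop (C.starFree (q := q) (Free.F r)) =
    C.K q (-C.root r) * C.E q r := by
  simp [starFree, Free.F, unop_op, starGen]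
theorem starFree_K (ω : I → ℤ) : C.unop (C.starFree (q := q) (Free.K ω)) = C.K q ω := by
  simp [starFree, Free.K, unop_op, starGen]

theorem unop_serre (r s : I) (x y : C.ConjOp q) :
    C.unop (C.serre q r s x y) =
      (-1 : ℂ) ^ C.serreN r s • C.serre q r s (C.unop x) (C.unop y) := by
  rw [← serre_reverse, serre, map_sum]
  refine Finset.sum_congr rfl fun n _ => ?_
  rw [unop_smul, unop_mul, unop_mul, unop_pow, unop_pow, map_mul, conj_qBinom (C.conj_qr r),
    mul_assoc]
  simp

theorem serre_FK (r s : I) (h : r ≠ s) :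
    C.serre q r s (C.F q r * C.K q (C.root r)) (C.F q s * C.K q (C.root s)) = 0 := by
  have key : C.serre q r s (C.F q r * C.K q (C.root r)) (C.F q s * C.K q (C.root s)) =
      qc q ^ C.gExp r s (C.serreN r s) • (C.serre q r s (C.F q r) (C.F q s) *
        C.K q (C.serreN r s • C.root r + C.root s)) := by
    simp only [serre, Finset.sum_mul, Finset.smul_sum]
    refine Finset.sum_congr rfl fun n hn => ?_
    have hn' : n ≤ C.serreN r s := by simpa [Nat.lt_succ_iff] using hn
    rw [monomial_F, Nat.sub_add_cancel hn', smul_mul_assoc, smul_comm]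
  rw [key, serre_F C r s h]; simp

theorem serre_KE (r s : I) (h : r ≠ s) :
    C.serre q r s (C.K q (-C.root r) * C.E q r) (C.K q (-C.root s) * C.E q s) = 0 := by
  have key : C.serre q r s (C.K q (-C.root r) * C.E q r) (C.K q (-C.root s) * C.E q s) =
      qc q ^ (-C.gExp r s (C.serreN r s)) • (C.K q (-(C.serreN r s • C.root r + C.root s)) *
        C.serre q r s (C.E q r) (C.E q s)) := by
    simp only [serre, Finset.mul_sum, Finset.smul_sum]
    refine Finset.sum_congr rfl fun n hn => ?_
    have hn' : n ≤ C.serreN r s := by simpa [Nat.lt_succ_iff] using hn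
    rw [monomial_E, Nat.sub_add_cancel hn', mul_smul_comm, smul_comm]
  rw [key, serre_E C r s h]; simp

theorem serre_map {A B : Type*} [Ring A] [Algebra ℂ A] [Ring B] [Algebra ℂ B] (f : A →ₐ[ℂ] B)
    (r s : I) (x y : A) : f (C.serre q r s x y) = C.serre q r s (f x) (f y) := by
  simp [serre]

theorem KE_FK (r s : I) : C.K q (-C.root s) * C.E q s * (C.F q r * C.K q (C.root r)) -
    C.F q r * C.K q (C.root r) * (C.K q (-C.root s) * C.E q s) =
    qc q ^ (C.form (C.root r) s - C.form (C.root s) s) •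
      ((C.E q s * C.F q r - C.F q r * C.E q s) * C.K q (C.root r - C.root s)) := by
  have h1 : C.K q (-C.root s) * C.E q s * (C.F q r * C.K q (C.root r)) =
      qc q ^ (C.form (C.root r) s - C.form (C.root s) s) •
      (C.E q s * C.F q r * C.K q (C.root r - C.root s)) := by
    rw [K_E, smul_mul_assoc, mul_assoc, ← mul_assoc (C.K q _), K_F, smul_mul_assoc,
      mul_smul_comm, smul_smul, ← zpow_add₀ qc_ne, form_neg, form_neg, mul_assoc (C.F q r),
      ← K_add, neg_neg, form_root C s r, ← mul_assoc]
    congr 2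
    · ring
    · congr 1; abel
  have h2 : C.F q r * C.K q (C.root r) * (C.K q (-C.root s) * C.E q s) =
      qc q ^ (C.form (C.root r) s - C.form (C.root s) s) •
      (C.F q r * C.E q s * C.K q (C.root r - C.root s)) := by
    rw [mul_assoc, ← mul_assoc (C.K q (C.root r)), ← K_add, K_E, mul_smul_comm, ← mul_assoc,
      form_add, form_neg, sub_eq_add_neg, sub_eq_add_neg]
  rw [h1, h2, ← smul_sub, sub_mul]

theorem starFree_rel {x y : Free I} (h : C.Rel q x y) :
    C.starFree (q := q) x = C.starFree y := by
  apply C.unop.injective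
  cases h with
  | K_zero => rw [starFree_K, map_one, unop_one, K_zero]
  | K_add ω χ =>
    rw [starFree_K, map_mul, unop_mul, starFree_K, starFree_K, add_comm, K_add]
  | K_E ω r =>
    rw [map_mul, unop_mul, map_smul, map_mul, unop_smul, unop_mul, starFree_K, starFree_E,
      map_zpow₀, conj_qc, ← mul_assoc, K_F, smul_mul_assoc, smul_smul, ← zpow_add₀ qc_ne,
      mul_assoc, mul_assoc, ← K_add, ← K_add, add_comm]
    simp
  | K_F ω r =>
    rw [map_mul, unop_mul, map_smul, map_mul, unop_smul, unop_mul, starFree_K, starFree_F,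
      map_zpow₀, conj_qc, mul_assoc, E_K, mul_smul_comm, ← mul_assoc, ← mul_assoc, ← K_add,
      ← K_add, add_comm]
  | E_F_same r =>
    rw [map_sub, map_mul, map_mul, map_sub, unop_mul, unop_mul, starFree_E, starFree_F, KE_FK,
      map_smul, unop_smul, map_sub, map_sub, starFree_K, starFree_K, E_F_same, map_inv₀, map_sub,
      map_inv₀, conj_qr]
    simp [K_zero]
  | E_F r s h =>
    rw [map_sub, map_mul, map_mul, map_sub, unop_mul, unop_mul, starFree_E, starFree_F, KE_FK,
      map_zero, map_zero]
    rw [E_F C s r h.symm]; simp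
  | serre_E r s h =>
    rw [serre_map, unop_serre, starFree_E, starFree_E, serre_FK C r s h]; simp
  | serre_F r s h =>
    rw [serre_map, unop_serre, starFree_F, starFree_F, serre_KE C r s h]; simp

/-- The `*`-operation, as a homomorphism into the opposite conjugate algebra. -/
def starHom : C.U q →ₐ[ℂ] C.ConjOp q :=
  RingQuot.liftAlgHom ℂ ⟨C.starFree, fun _ _ h => C.starFree_rel h⟩

instance : Star (C.U q) := ⟨fun x => C.unop (C.starHom x)⟩

theorem star_proj (x : Free I) : star (C.proj q x) = C.unop (C.starFree x) := by
  change C.unop (RingQuot.liftAlgHom ℂ _ (RingQuot.mkAlgHom ℂ (C.Rel q) x)) = _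
  rw [RingQuot.liftAlgHom_mkAlgHom_apply]

theorem star_mul' (x y : C.U q) : star (x * y) = star y * star x := by
  change C.unop (C.starHom (x * y)) = _
  rw [map_mul, unop_mul]; rfl

theorem star_add' (x y : C.U q) : star (x + y) = star x + star y := by
  change C.unop (C.starHom (x + y)) = _
  rw [map_add, map_add]; rfl

theorem star_smul' (c : ℂ) (x : C.U q) : star (c • x) = (starRingEnd ℂ) c • star x := by
  change C.unop (C.starHom (c • x)) = _
  rw [map_smul, unop_smul]; rfl

theorem star_one' : star (1 : C.U q) = 1 := by
  change C.unop (C.starHom 1) = _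
  rw [map_one, unop_one]

theorem star_E (r : I) : star (C.E q r) = C.F q r * C.K q (C.root r) := by
  rw [E, star_proj, starFree_E]

theorem star_F (r : I) : star (C.F q r) = C.K q (-C.root r) * C.E q r := by
  rw [F, star_proj, starFree_F]

theorem star_K (ω : I → ℤ) : star (C.K q ω) = C.K q ω := by
  conv_lhs => rw [K, star_proj, starFree_K]

/-- `x ↦ x^{**}` as an algebra homomorphism. -/
def starStar : C.U q →ₐ[ℂ] C.U q where
  toFun x := star (star x)
  map_one' := by rw [star_one', star_one']
  map_mul' x y := by rw [star_mul', star_mul']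
  map_zero' := by
    have h : star (0 : C.U q) = 0 := by
      change C.unop (C.starHom 0) = _
      rw [map_zero, map_zero]
    rw [h, h]
  map_add' x y := by rw [star_add', star_add']
  commutes' c := by
    rw [Algebra.algebraMap_eq_smul_one, star_smul', star_smul', star_one', star_one']
    simp

theorem starStar_eq : C.starStar (q := q) = AlgHom.id ℂ (C.U q) := by
  apply RingQuot.ringQuot_ext'
  apply FreeAlgebra.hom_ext
  funext g
  cases g with
  | E r =>
    change star (star (C.E q r)) = C.E q r
    rw [star_E, star_mul', star_F, star_K, ← mul_assoc, ← K_add]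
    simp [K_zero]
  | F r =>
    change star (star (C.F q r)) = C.F q r
    rw [star_F, star_mul', star_E, star_K, mul_assoc, ← K_add]
    simp [K_zero]
  | K ω =>
    change star (star (C.K q ω)) = C.K q ω
    rw [star_K, star_K]

/-- The `*`-algebra `U_q(𝔲)`: the algebra `U_q(𝔤)` with the `*`-structure determined by
`Eᵣ^* = Fᵣ Kᵣ`, `Fᵣ^* = Kᵣ⁻¹ Eᵣ`, `K_ω^* = K_ω`. -/
instance : StarRing (C.U q) where
  star_involutive x := DFunLike.congr_fun C.starStar_eq x
  star_mul := C.star_mul'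
  star_add := C.star_add'

instance : StarModule ℂ (C.U q) := ⟨C.star_smul'⟩

/-! ### The automorphism `θ_q`

The maps below are the lifts to the free algebra, given by the usual formulas on generators, of
the corresponding algebra automorphisms of `U_q(𝔤)`. As those formulas determine algebra
automorphisms of `U_q(𝔤)` (for `Tᵣ` this is Lusztig's theorem), the image in `U_q(𝔤)` of a
composition of lifts applied to `x` is the composition of the automorphisms applied to the image
of `x`. -/

variable (q)

/-- The quantum Chevalley automorphism `ω`. -/
def chevalley : Free I →ₐ[ℂ] Free I := FreeAlgebra.lift ℂ fun
  | Gen.E r => -Free.F r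
  | Gen.F r => -Free.E r
  | Gen.K ω => Free.K (-ω)

/-- The automorphism induced by a diagram automorphism `τ`; `K_{ϖᵣ} ↦ K_{ϖ_{τ(r)}}`. -/
def diagramAut (τ : Equiv.Perm I) : Free I →ₐ[ℂ] Free I := FreeAlgebra.lift ℂ fun
  | Gen.E r => Free.E (τ r)
  | Gen.F r => Free.F (τ r)
  | Gen.K ω => Free.K fun i => ω (τ.symm i)

/-- The automorphism `ψ`: `Eᵣ ↦ Eᵣ Kᵣ`, `Fᵣ ↦ Kᵣ⁻¹ Fᵣ`, `K_ω ↦ K_ω`. -/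
def psi : Free I →ₐ[ℂ] Free I := FreeAlgebra.lift ℂ fun
  | Gen.E r => Free.E r * Free.K (C.root r)
  | Gen.F r => Free.K (-C.root r) * Free.F r
  | Gen.K ω => Free.K ω

/-- The automorphism `Ad z`. -/
def adTorus (z : I → ℂ) : Free I →ₐ[ℂ] Free I := FreeAlgebra.lift ℂ fun
  | Gen.E r => z r • Free.E r
  | Gen.F r => (z r)⁻¹ • Free.F r
  | Gen.K ω => Free.K ω

/-- The Lusztig braid operator `Tᵣ`. In the sums, `m` is the summation index and
`n = -a_{rs} - m`. -/
def braid (r : I) : Free I →ₐ[ℂ] Free I := FreeAlgebra.lift ℂ fun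
  | Gen.E s =>
      if s = r then -(Free.F r * Free.K (C.root r))
      else ∑ m ∈ Finset.range ((-C.a r s).toNat + 1),
        ((-C.qr q r)⁻¹ ^ m /
            (qFact (C.qr q r) m * qFact (C.qr q r) ((-C.a r s).toNat - m))) •
          (Free.E r ^ ((-C.a r s).toNat - m) * Free.E s * Free.E r ^ m)
  | Gen.F s =>
      if s = r then -(Free.K (-C.root r) * Free.E r)
      else ∑ m ∈ Finset.range ((-C.a r s).toNat + 1),
        ((-C.qr q r) ^ m /
            (qFact (C.qr q r) m * qFact (C.qr q r) ((-C.a r s).toNat - m))) •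
          (Free.F r ^ m * Free.F s * Free.F r ^ ((-C.a r s).toNat - m))
  | Gen.K ω => Free.K (C.refl r ω)

/-- `T_{r₁} ∘ ⋯ ∘ T_{r_M}` for the word `[r₁, …, r_M]`. -/
def braidWord (w : List I) : Free I →ₐ[ℂ] Free I :=
  w.foldr (fun r f => (C.braid q r).comp f) (AlgHom.id ℂ (Free I))

end CartanDatum

namespace AdmissiblePair

variable {C : CartanDatum I} (S : AdmissiblePair C) (q : Set.Ioo (0 : ℝ) 1)

/-- `θ_q = (Ad z) ∘ T_{w_X} ∘ ψ ∘ τ ∘ ω`. -/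
def thetaQ (w : List I) (z : I → ℂ) : Free I →ₐ[ℂ] Free I :=
  (CartanDatum.adTorus z).comp ((C.braidWord q w).comp
    (C.psi.comp ((CartanDatum.diagramAut S.τ).comp CartanDatum.chevalley)))

/-- The element `Bᵣ = Fᵣ + cᵣ θ_q(Fᵣ Kᵣ) Kᵣ⁻¹ + sᵣ Kᵣ⁻¹` of `U_q(𝔤)`. -/
def B (w : List I) (z c s : I → ℂ) (r : I) : C.U q :=
  C.F q r +
    c r • (C.proj q (S.thetaQ q w z (Free.F r * Free.K (C.root r))) * C.K q (-C.root r)) +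
    s r • C.K q (-C.root r)

/-- The Letzter–Kolb coideal subalgebra `U_q^𝐭(𝔨^ℂ)`, `𝐭 = (c, s)`: it is generated by
`U_q(𝔤_X)`, by `U_q(𝔥^θ)` and by the elements `Bᵣ`, `r ∈ I ∖ X`. -/
def coideal (w : List I) (z c s : I → ℂ) : Subalgebra ℂ (C.U q) :=
  Algebra.adjoin ℂ
    ({x | ∃ r ∈ S.X, x = C.E q r ∨ x = C.F q r ∨ x = C.K q (C.root r) ∨
          x = C.K q (-C.root r)} ∪
      {x | ∃ ω : I → ℤ, S.Theta w ω = ω ∧ x = C.K q ω} ∪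
      {x | ∃ r, r ∉ S.X ∧ x = S.B q w z c s r})

end AdmissiblePair

end QSymPair

end

/-!
The generators of the coideal subalgebra attached to `X` and to the fixed points of `Θ` have
adjoints of the same kind, so that everything depends on the adjoints of the elements `Bᵣ`. Put
`t = τ(r)` and `Yₜ = T_{w_X}(Eₜ)`. Then `θ_q(FᵣKᵣ) = -zₜ Yₜ`, hence

* `Bᵣ = (FᵣKᵣ - cᵣ zₜ Yₜ + sᵣ) Kᵣ⁻¹` and `Bₜ = (FₜKₜ - cₜ zᵣ Yᵣ + sₜ) Kₜ⁻¹` (`B_eq`);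
* `Bᵣ^* = Kᵣ⁻¹ (Eᵣ - conj(cᵣ zₜ) Yₜ^* + conj(sᵣ))`.

There is a product `lower` of divided powers of the adjoint actions of the `Fₖ`, `k ∈ X`, that maps
`FₜKₜ` to `± Yₜ^*` (`lower_F_mul_K`), maps `Yᵣ` to `Eᵣ` (`lower_TWord`), and fixes `1` where
`sₜ ≠ 0`. The elements `x` for which `x Kₜ⁻¹` lies in the coideal subalgebra are stable under these
actions, so one may apply `lower` to the bracket in `Bₜ`. After multiplication by `K` at `αₜ - αᵣ`,
which is fixed by `Θ`, the result is a multiple of `Bᵣ^*`; that the three coefficients match is what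
the conditions on `c`, `z` and `s` say (`star_B_mem`).

The operator `lower` is found as follows. Along a reduced expression `w_X = σ_{r₁} ⋯ σ_{r_M}` one
has `Yₜ = (ad E_{r₁})^{(m₁)} ⋯ (ad E_{r_M})^{(m_M)} Eₜ`, with exponents that are nonnegative by the
exchange property (`IsReducedWord.wordAct_root_nonpos`) and whose sum is `-2 (αₜ, ρ_X^∨)`
(`lowering_root`). The adjoint turns `ad Eₖ` into `-ad Fₖ`, so that the same product with `F` in
place of `E` maps `Eₜ^* = FₜKₜ` to `± Yₜ^*`. As `w_X αᵣ + αₜ` is orthogonal to `X`, the same divided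
powers lead from `Yᵣ` down entire strings and end at `Eᵣ`.

The formula for `Yₜ` requires that the braid operator `Tᵢ` is defined on `U_q(𝔤)` and maps an
extremal vector at the lower end of an `Eᵢ`-string to the upper end (`Reach.T_eq`). Both follow from
a statement about one quantum `sl₂`-triple. Let `InG` be the set of sums of pairs of the `k`-th
raised vector of a string for `ad E` and the `k`-th raised vector of its upper end for `ad (-F K)`.
The first component of such a pair determines the second (`InG.eq_zero`), and the pairs coming from
strings of length at most `4` map this set to itself by multiplication (`InG.dE_good_mul`). The
second fact comes down to an identity between the ends of the strings in a product of two strings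
(`Good.combine`, `top_identity`). As Cartan integers are at least `-3`, it applies to the generators
`Eₛ`, `s ≠ i`, and the Serre relations carry over to the images of the generators; the relations
between the `Eₛ` and the `Fₛ` are checked by computing the commutators of two strings
(`comm_dE_dE`).
-/

open scoped BigOperators

noncomputable section

namespace QSymPair
set_option linter.unusedSimpArgs false
set_option linter.unnecessarySeqFocus false

/-! ### Quantum integers and quantum `sl₂`-triples -/

/-- The quantum integer `[n]_v` for an integer `n`, an odd function of `n`. -/
def br (v : ℂ) (n : ℤ) : ℂ := (v ^ n - v ^ (-n)) / (v - v⁻¹)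

/-- A quantum `sl₂`-triple in a complex algebra at a parameter `v` that is not a root of unity;
`L` is the inverse of `K`. -/
structure QTriple (A : Type*) [Ring A] [Algebra ℂ A] (v : ℂ) where
  E : A
  F : A
  K : A
  L : A
  v_ne : v ≠ 0
  v_pow : ∀ n : ℕ, 0 < n → v ^ n ≠ 1
  KL : K * L = 1
  LK : L * K = 1
  KE : K * E = v ^ (2 : ℤ) • (E * K)
  KF : K * F = v ^ (-2 : ℤ) • (F * K)
  EF : E * F - F * E = (v - v⁻¹)⁻¹ • (K - L)

theorem qInt_eq_br (v : ℂ) (n : ℕ) : qInt v n = br v n := by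
  rw [qInt, br, ← neg_div_neg_eq]
  simp

theorem br_zero (v : ℂ) : br v 0 = 0 := by simp [br]

theorem br_neg (v : ℂ) (n : ℤ) : br v (-n) = -br v n := by
  rw [br, br, neg_neg, ← neg_div, neg_sub]

theorem qFact_zero (v : ℂ) : qFact v 0 = 1 := by simp [qFact]

theorem qFact_succ (v : ℂ) (n : ℕ) : qFact v (n + 1) = qFact v n * br v (n + 1 : ℕ) := by
  rw [qFact, Finset.prod_range_succ, qInt_eq_br]; rfl

namespace QTriple

variable {A : Type*} [Ring A] [Algebra ℂ A] {v : ℂ} (t : QTriple A v)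

include t in
theorem zpow_ne_one {n : ℤ} (h : n ≠ 0) : v ^ n ≠ 1 := by
  rcases Int.natAbs_eq n with h1 | h1 <;> rw [h1]
  · rw [zpow_natCast]; exact t.v_pow _ (by omega)
  · rw [zpow_neg, zpow_natCast]
    intro h2
    exact t.v_pow n.natAbs (by omega) (by simpa using h2)

include t in
theorem den_ne : v - v⁻¹ ≠ 0 := by
  have h := t.v_pow 2 (by norm_num)
  have h0 := t.v_ne
  intro h1
  apply h
  field_simp at h1
  linear_combination h1

include t in
theorem br_ne_zero {n : ℤ} (h : n ≠ 0) : br v n ≠ 0 := by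
  rw [br]
  refine div_ne_zero ?_ t.den_ne
  intro h1
  have h2 : v ^ (2 * n) = 1 := by
    have : v ^ (2 * n) = v ^ n * v ^ n := by rw [← zpow_add₀ t.v_ne]; congr 1; ring
    rw [this]
    nth_rewrite 1 [sub_eq_zero.mp h1]
    rw [← zpow_add₀ t.v_ne]; simp
  exact t.zpow_ne_one (by omega) h2

include t in
theorem br_one : br v 1 = 1 := by
  rw [br, zpow_one, zpow_neg, zpow_one, div_self t.den_ne]

include t in
theorem qFact_ne_zero (n : ℕ) : qFact v n ≠ 0 := by
  induction n with
  | zero => simp [qFact_zero]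
  | succ n ih => rw [qFact_succ]; exact mul_ne_zero ih (t.br_ne_zero (by omega))

/-- The triple `(F, E, K⁻¹, K)`. -/
def swap : QTriple A v where
  E := t.F
  F := t.E
  K := t.L
  L := t.K
  v_ne := t.v_ne
  v_pow := t.v_pow
  KL := t.LK
  LK := t.KL
  KE := by
    have h : t.L * (t.K * t.F) * t.L = t.L * (v ^ (-2 : ℤ) • (t.F * t.K)) * t.L := by rw [t.KF]
    rw [← mul_assoc, t.LK, one_mul, mul_smul_comm, smul_mul_assoc, ← mul_assoc, mul_assoc _ t.K,
      t.KL, mul_one] at h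
    rw [h, smul_smul, ← zpow_add₀ t.v_ne]; simp
  KF := by
    have h : t.L * (t.K * t.E) * t.L = t.L * (v ^ (2 : ℤ) • (t.E * t.K)) * t.L := by rw [t.KE]
    rw [← mul_assoc, t.LK, one_mul, mul_smul_comm, smul_mul_assoc, ← mul_assoc, mul_assoc _ t.K,
      t.KL, mul_one] at h
    rw [h, smul_smul, ← zpow_add₀ t.v_ne]; simp
  EF := by rw [← neg_sub, t.EF, ← smul_neg, neg_sub]

/-- `x` has weight `n`: `K x K⁻¹ = v ^ n x`. -/
def Wt (n : ℤ) (x : A) : Prop := t.K * x = v ^ n • (x * t.K)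

/-- The adjoint action of `E` for the coproduct `E ↦ E ⊗ 1 + K ⊗ E`. -/
def adE : A →ₗ[ℂ] A :=
  LinearMap.mulLeft ℂ t.E -
    (LinearMap.mulRight ℂ t.E).comp ((LinearMap.mulLeft ℂ t.K).comp (LinearMap.mulRight ℂ t.L))

/-- The adjoint action of `F` for the coproduct `F ↦ F ⊗ K⁻¹ + 1 ⊗ F`. -/
def adF : A →ₗ[ℂ] A :=
  (LinearMap.mulRight ℂ t.K).comp (LinearMap.mulLeft ℂ t.F - LinearMap.mulRight ℂ t.F)

theorem adE_def (x : A) : t.adE x = t.E * x - t.K * (x * t.L) * t.E := by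
  simp [adE]

theorem adF_def (x : A) : t.adF x = (t.F * x - x * t.F) * t.K := by
  simp [adF]

namespace Wt

variable {t} {n m : ℤ} {x y : A}

theorem add (hx : t.Wt n x) (hy : t.Wt n y) : t.Wt n (x + y) := by
  rw [Wt] at *
  rw [mul_add, hx, hy, add_mul, smul_add]

theorem zero : t.Wt n 0 := by simp [Wt]

theorem smul (c : ℂ) (hx : t.Wt n x) : t.Wt n (c • x) := by
  rw [Wt] at *
  rw [mul_smul_comm, hx, smul_mul_assoc, smul_comm]

theorem mul (hx : t.Wt n x) (hy : t.Wt m y) : t.Wt (n + m) (x * y) := by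
  rw [Wt] at *
  rw [← mul_assoc, hx, smul_mul_assoc, mul_assoc, hy, mul_smul_comm, smul_smul,
    ← zpow_add₀ t.v_ne, mul_assoc]

theorem one : t.Wt 0 1 := by simp [Wt]

theorem K_mul_L (hx : t.Wt n x) : t.K * (x * t.L) = v ^ n • x := by
  rw [Wt] at hx
  rw [← mul_assoc, hx, smul_mul_assoc, mul_assoc, t.KL, mul_one]

theorem L_mul (hx : t.Wt n x) : t.L * x = v ^ (-n) • (x * t.L) := by
  have h := congrArg (fun z => t.L * z) hx.K_mul_L
  simp only [← mul_assoc, t.LK, one_mul, mul_smul_comm] at h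
  rw [h, smul_smul, ← zpow_add₀ t.v_ne]; simp

theorem mul_K (hx : t.Wt n x) : x * t.K = v ^ (-n) • (t.K * x) := by
  rw [Wt] at hx
  rw [hx, smul_smul, ← zpow_add₀ t.v_ne]; simp

theorem L_mul_K (hx : t.Wt n x) : t.L * x * t.K = v ^ (-n) • x := by
  rw [hx.L_mul, smul_mul_assoc, mul_assoc, t.LK, mul_one]

theorem adE_eq (hx : t.Wt n x) : t.adE x = t.E * x - v ^ n • (x * t.E) := by
  rw [adE_def, hx.K_mul_L, smul_mul_assoc]

theorem E : t.Wt 2 t.E := t.KE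
theorem F : t.Wt (-2) t.F := t.KF
theorem K : t.Wt 0 t.K := by simp [Wt]

theorem sub (hx : t.Wt n x) (hy : t.Wt n y) : t.Wt n (x - y) := by
  rw [Wt] at *
  rw [mul_sub, hx, hy, sub_mul, smul_sub]

theorem cast (hx : t.Wt n x) (h : n = m) : t.Wt m x := h ▸ hx

theorem adE (hx : t.Wt n x) : t.Wt (n + 2) (t.adE x) := by
  rw [hx.adE_eq]
  exact ((Wt.E.mul hx).cast (by ring)).sub ((hx.mul Wt.E).smul _)

theorem adF (hx : t.Wt n x) : t.Wt (n - 2) (t.adF x) := by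
  rw [adF_def]
  exact ((((Wt.F.mul hx).cast (by ring)).sub ((hx.mul Wt.F).cast (by ring))).mul Wt.K).cast
    (by ring : n - 2 + 0 = n - 2)

theorem adE_pow (hx : t.Wt n x) (k : ℕ) : t.Wt (n + 2 * k) ((t.adE ^ k) x) := by
  induction k with
  | zero => simpa using hx
  | succ k ih => rw [pow_succ', Module.End.mul_apply]; exact ih.adE.cast (by push_cast; ring)

theorem adF_pow (hx : t.Wt n x) (k : ℕ) : t.Wt (n - 2 * k) ((t.adF ^ k) x) := by
  induction k with
  | zero => simpa using hx
  | succ k ih => rw [pow_succ', Module.End.mul_apply]; exact ih.adF.cast (by push_cast; ring)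

end Wt

/-- The adjoint action of `E` on a product. -/
theorem adE_mul {n : ℤ} {x : A} (hx : t.Wt n x) (y : A) :
    t.adE (x * y) = t.adE x * y + v ^ n • (x * t.adE y) := by
  rw [hx.adE_eq, adE_def, adE_def, ← mul_assoc t.K, ← mul_assoc t.K, ← mul_assoc t.K, hx,
    mul_sub, smul_sub, sub_mul]
  simp only [smul_mul_assoc, mul_assoc]
  abel

/-- The adjoint action of `F` on a product. -/
theorem adF_mul {n : ℤ} (x : A) {y : A} (hy : t.Wt n y) :
    t.adF (x * y) = v ^ (-n) • (t.adF x * y) + x * t.adF y := by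
  have h : t.K * y = v ^ n • (y * t.K) := hy
  rw [adF_def, adF_def, adF_def, mul_assoc _ t.K, h, mul_smul_comm, smul_smul,
    ← zpow_add₀ t.v_ne]
  simp only [neg_add_cancel, zpow_zero, one_smul]
  noncomm_ring

theorem adF_one : t.adF 1 = 0 := by simp [adF_def]
theorem adE_one : t.adE 1 = 0 := by simp [adE_def, t.KL]

/-- The commutation relation of `ad E` and `ad F`. -/
theorem adF_adE {n : ℤ} {x : A} (hx : t.Wt n x) :
    t.adF (t.adE x) = t.adE (t.adF x) - br v n • x := by
  have hK : x * t.K = v ^ (-n) • (t.K * x) := hx.mul_K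
  have e1 : t.adF (t.adE x) = t.F * (t.E * x) * t.K - v ^ n • (t.F * (x * t.E) * t.K)
      - (t.E * (x * t.F) * t.K - v ^ n • (x * (t.E * t.F) * t.K)) := by
    rw [hx.adE_eq, adF_def]
    simp only [mul_sub, sub_mul, mul_smul_comm, smul_mul_assoc, mul_assoc]
  have e2 : t.adE (t.adF x) = t.E * (t.F * x) * t.K - t.E * (x * t.F) * t.K
      - v ^ n • (t.F * (x * t.E) * t.K - x * (t.F * t.E) * t.K) := by
    have hKE : t.K * t.E = v ^ (2 : ℤ) • (t.E * t.K) := t.KE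
    rw [hx.adF.adE_eq, adF_def]
    simp only [mul_sub, sub_mul, mul_assoc, hKE, mul_smul_comm, smul_sub, smul_smul,
      ← zpow_add₀ t.v_ne]
    simp
  have hEF : t.E * t.F = t.F * t.E + (v - v⁻¹)⁻¹ • (t.K - t.L) := by rw [← t.EF]; abel
  have e3 : t.E * (t.F * x) = t.F * (t.E * x) + (v - v⁻¹)⁻¹ • (t.K * x - t.L * x) := by
    rw [← mul_assoc, hEF, add_mul, smul_mul_assoc, sub_mul, mul_assoc]
  rw [e1, e2, e3, hEF, mul_add, mul_smul_comm, add_mul, add_mul, smul_mul_assoc, smul_mul_assoc,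
    sub_mul, mul_sub, sub_mul, mul_assoc x t.L, t.LK, mul_one, hx.L_mul_K]
  have h4 : t.K * x * t.K = v ^ n • (x * t.K * t.K) := by rw [hx, smul_mul_assoc]
  rw [h4, br]
  have := t.den_ne
  match_scalars <;> field_simp <;> ring

theorem adE_adF {n : ℤ} {x : A} (hx : t.Wt n x) :
    t.adE (t.adF x) = t.adF (t.adE x) + br v n • x := by
  rw [t.adF_adE hx]; abel

end QTriple

/-! ### Divided powers -/

namespace QTriple

variable {A : Type*} [Ring A] [Algebra ℂ A] {v : ℂ} (t : QTriple A v)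

include t in
/-- The identity behind the commutation relations of `ad F` with the powers of `ad E`. -/
theorem br_step (m : ℕ) (n : ℤ) :
    br v (m + 1 : ℕ) * br v (n + m) = br v m * br v (n + m - 1) + br v (n + 2 * m) := by
  have h := t.den_ne
  have h0 := t.v_ne
  simp only [br, two_mul, Nat.cast_add, Nat.cast_one, zpow_add₀ h0, zpow_sub₀ h0, zpow_neg,
    zpow_one]
  have h1 := zpow_ne_zero n h0
  have h2 := zpow_ne_zero (m : ℤ) h0
  generalize v ^ n = a at *
  generalize v ^ (m : ℤ) = b at *
  field_simp
  ring

theorem adF_adE_pow {n : ℤ} {x : A} (hx : t.Wt n x) (m : ℕ) :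
    t.adF ((t.adE ^ (m + 1)) x) = (t.adE ^ (m + 1)) (t.adF x) -
      (br v (m + 1 : ℕ) * br v (n + m)) • (t.adE ^ m) x := by
  induction m with
  | zero => simp [t.adF_adE hx, t.br_one]
  | succ m ih =>
    rw [pow_succ', Module.End.mul_apply, t.adF_adE (hx.adE_pow _), ih, map_sub, map_smul,
      ← Module.End.mul_apply, ← pow_succ', ← Module.End.mul_apply t.adE (t.adE ^ m),
      ← pow_succ', sub_sub, ← add_smul]
    congr 2
    rw [t.br_step (m + 1)]
    congr 2
    push_cast; ring_nf

theorem adE_adF_pow {n : ℤ} {x : A} (hx : t.Wt n x) (m : ℕ) :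
    t.adE ((t.adF ^ (m + 1)) x) = (t.adF ^ (m + 1)) (t.adE x) +
      (br v (m + 1 : ℕ) * br v (n - m)) • (t.adF ^ m) x := by
  induction m with
  | zero => simp [t.adE_adF hx, t.br_one]
  | succ m ih =>
    rw [pow_succ', Module.End.mul_apply, t.adE_adF (hx.adF_pow _), ih, map_add, map_smul,
      ← Module.End.mul_apply, ← pow_succ', ← Module.End.mul_apply t.adF (t.adF ^ m),
      ← pow_succ', add_assoc, ← add_smul]
    congr 2
    have h := t.br_step (m + 1) (-n)
    have e : ∀ k l : ℤ, l = -k → br v k = - br v l := fun k l h => by rw [h, br_neg, neg_neg]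
    rw [e (-n + (m + 1 : ℕ)) (n - (m + 1 : ℕ)) (by ring),
      e (-n + (m + 1 : ℕ) - 1) (n - m) (by push_cast; ring),
      e (-n + 2 * (m + 1 : ℕ)) (n - 2 * (m + 1 : ℕ)) (by ring)] at h
    linear_combination h

/-- The divided power `(ad E)⁽ᵐ⁾`. -/
def dE (m : ℕ) : A →ₗ[ℂ] A := (qFact v m)⁻¹ • t.adE ^ m

/-- The divided power `(ad F)⁽ᵐ⁾`. -/
def dF (m : ℕ) : A →ₗ[ℂ] A := (qFact v m)⁻¹ • t.adF ^ m

theorem dE_def (m : ℕ) (x : A) : t.dE m x = (qFact v m)⁻¹ • (t.adE ^ m) x := rfl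
theorem dF_def (m : ℕ) (x : A) : t.dF m x = (qFact v m)⁻¹ • (t.adF ^ m) x := rfl

theorem adE_pow_eq (m : ℕ) (x : A) : (t.adE ^ m) x = qFact v m • t.dE m x := by
  rw [dE_def, smul_smul, mul_inv_cancel₀ (t.qFact_ne_zero m), one_smul]

theorem dE_zero (x : A) : t.dE 0 x = x := by simp [dE_def, qFact_zero]
theorem dF_zero (x : A) : t.dF 0 x = x := by simp [dF_def, qFact_zero]

theorem dE_one (x : A) : t.dE 1 x = t.adE x := by
  simp [dE_def, qFact_succ, qFact_zero, t.br_one]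

theorem adE_dE (m : ℕ) (x : A) : t.adE (t.dE m x) = br v (m + 1 : ℕ) • t.dE (m + 1) x := by
  rw [dE_def, dE_def, map_smul, ← Module.End.mul_apply, ← pow_succ', qFact_succ, smul_smul]
  congr 1
  have := t.br_ne_zero (n := (m + 1 : ℕ)) (by omega)
  have := t.qFact_ne_zero m
  field_simp

theorem adF_dF (m : ℕ) (x : A) : t.adF (t.dF m x) = br v (m + 1 : ℕ) • t.dF (m + 1) x := by
  rw [dF_def, dF_def, map_smul, ← Module.End.mul_apply, ← pow_succ', qFact_succ, smul_smul]
  congr 1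
  have := t.br_ne_zero (n := (m + 1 : ℕ)) (by omega)
  have := t.qFact_ne_zero m
  field_simp

theorem dE_succ (m : ℕ) (x : A) :
    t.dE (m + 1) x = (br v (m + 1 : ℕ))⁻¹ • t.adE (t.dE m x) := by
  rw [adE_dE, smul_smul, inv_mul_cancel₀ (t.br_ne_zero (by omega)), one_smul]

theorem dF_succ (m : ℕ) (x : A) :
    t.dF (m + 1) x = (br v (m + 1 : ℕ))⁻¹ • t.adF (t.dF m x) := by
  rw [adF_dF, smul_smul, inv_mul_cancel₀ (t.br_ne_zero (by omega)), one_smul]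

theorem Wt.dE {t : QTriple A v} {n : ℤ} {x : A} (hx : t.Wt n x) (k : ℕ) :
    t.Wt (n + 2 * k) (t.dE k x) := (hx.adE_pow k).smul _

theorem Wt.dF {t : QTriple A v} {n : ℤ} {x : A} (hx : t.Wt n x) (k : ℕ) :
    t.Wt (n - 2 * k) (t.dF k x) := (hx.adF_pow k).smul _

/-- Lowering in the string of a lowest weight vector of weight `-b`. -/
theorem adF_dE {b : ℤ} {x : A} (hx : t.Wt (-b) x) (h : t.adF x = 0) (m : ℕ) :
    t.adF (t.dE (m + 1) x) = br v (b - m) • t.dE m x := by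
  rw [dE_def, dE_def, map_smul, t.adF_adE_pow hx, h, map_zero, zero_sub, ← neg_smul, smul_smul,
    qFact_succ, smul_smul, show -b + (m : ℤ) = -(b - m) by ring, br_neg]
  congr 1
  have := t.br_ne_zero (n := (m + 1 : ℕ)) (by omega)
  have := t.qFact_ne_zero m
  field_simp

/-- The string of a lowest weight vector, read from the top. -/
theorem dF_dE_top {b : ℕ} {x : A} (hx : t.Wt (-b) x) (h : t.adF x = 0) {i : ℕ} (hi : i ≤ b) :
    t.dF i (t.dE b x) = t.dE (b - i) x := by
  induction i with
  | zero => simp [dF_zero]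
  | succ i ih =>
    rw [dF_succ, ih (by omega), show b - i = (b - (i + 1)) + 1 by omega, t.adF_dE hx h, smul_smul,
      show (b : ℤ) - (b - (i + 1) : ℕ) = (i + 1 : ℕ) by omega,
      inv_mul_cancel₀ (t.br_ne_zero (by omega)), one_smul]

theorem dF_dE_self {b : ℕ} {x : A} (hx : t.Wt (-b) x) (h : t.adF x = 0) :
    t.dF b (t.dE b x) = x := by
  rw [t.dF_dE_top hx h le_rfl, Nat.sub_self, dE_zero]

/-- On vectors of weight `p ≥ 0` on which `ad E` is nilpotent, `(ad F) ^ p` is injective. -/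
theorem eq_zero_of_adF_pow {N : ℕ} : ∀ {p : ℕ} {x : A}, t.Wt p x → (t.adE ^ N) x = 0 →
    (t.adF ^ p) x = 0 → x = 0 := by
  induction N with
  | zero => intro p x _ h _; simpa using h
  | succ N ih =>
    intro p x hx hE hF
    have h1 : t.adE x = 0 := by
      refine ih (p := p + 2) (hx.adE.cast (by push_cast; ring)) ?_ ?_
      · rw [pow_succ, Module.End.mul_apply] at hE; exact hE
      · have h := t.adE_adF_pow hx p
        rw [sub_self, br_zero, mul_zero, zero_smul, add_zero, pow_succ', Module.End.mul_apply, hF,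
          map_zero, map_zero] at h
        rw [pow_succ', Module.End.mul_apply, pow_succ', ← h, map_zero]
    have h2 : ∀ k ≤ p, (t.adF ^ (p - k)) x = 0 := by
      intro k
      induction k with
      | zero => intro _; simpa using hF
      | succ k ihk =>
        intro hk
        have h3 := ihk (by omega)
        have h4 := t.adE_adF_pow hx (p - (k + 1))
        rw [show p - (k + 1) + 1 = p - k by omega, h3, h1, map_zero, map_zero, zero_add] at h4
        exact ((smul_eq_zero.mp h4.symm).resolve_left
          (mul_ne_zero (t.br_ne_zero (by omega)) (t.br_ne_zero (by omega))))
    simpa using h2 p le_rfl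

include t in
theorem br_add (i j : ℕ) :
    br v (i + j : ℕ) = v ^ (-(j : ℤ)) * br v i + v ^ (i : ℤ) * br v j := by
  have h := t.den_ne
  have h0 := t.v_ne
  simp only [br, Nat.cast_add, zpow_add₀ h0, zpow_neg]
  have h1 := zpow_ne_zero (i : ℤ) h0
  have h2 := zpow_ne_zero (j : ℤ) h0
  generalize v ^ (i : ℤ) = a at *
  generalize v ^ (j : ℤ) = b at *
  field_simp
  ring

open Finset.Nat in
/-- The Leibniz rule for the divided powers of `ad E`. -/
theorem dE_mul {n : ℤ} {x : A} (hx : t.Wt n x) (y : A) (N : ℕ) :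
    t.dE N (x * y) = ∑ p ∈ Finset.HasAntidiagonal.antidiagonal N,
      v ^ ((p.2 : ℤ) * (n + p.1)) • (t.dE p.1 x * t.dE p.2 y) := by
  induction N with
  | zero => simp [dE_zero]
  | succ N ih =>
    let g1 : ℕ × ℕ → A := fun p =>
      (v ^ ((p.2 : ℤ) * (n + p.1 - 1)) * br v p.1) • (t.dE p.1 x * t.dE p.2 y)
    let g2 : ℕ × ℕ → A := fun p =>
      (v ^ (((p.2 : ℤ) - 1) * (n + p.1) + (n + 2 * p.1)) * br v p.2) • (t.dE p.1 x * t.dE p.2 y)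
    have h : br v (N + 1 : ℕ) • t.dE (N + 1) (x * y) =
        ∑ p ∈ Finset.HasAntidiagonal.antidiagonal (N + 1), (g1 p + g2 p) := by
      rw [Finset.sum_add_distrib, sum_antidiagonal_succ, sum_antidiagonal_succ' (f := g2),
        ← adE_dE, ih, map_sum]
      have e1 : g1 (0, N + 1) = 0 := by simp [g1, br_zero]
      have e2 : g2 (N + 1, 0) = 0 := by simp [g2, br_zero]
      rw [e1, e2, zero_add, zero_add, ← Finset.sum_add_distrib]
      refine Finset.sum_congr rfl fun p _ => ?_
      rw [map_smul, t.adE_mul (hx.dE _), adE_dE, adE_dE, smul_add, smul_mul_assoc, mul_smul_comm,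
        smul_smul, smul_smul, smul_smul, ← zpow_add₀ t.v_ne]
      congr 2
      · congr 2; push_cast; ring
      · congr 2; push_cast; ring
    have h2 : ∀ p ∈ Finset.HasAntidiagonal.antidiagonal (N + 1), g1 p + g2 p =
        br v (N + 1 : ℕ) • (v ^ ((p.2 : ℤ) * (n + p.1)) • (t.dE p.1 x * t.dE p.2 y)) := by
      intro p hp
      rw [Finset.HasAntidiagonal.mem_antidiagonal] at hp
      have h1 : (p.2 : ℤ) * (n + p.1 - 1) = -p.2 + p.2 * (n + p.1) := by ring
      have h2 : ((p.2 : ℤ) - 1) * (n + p.1) + (n + 2 * p.1) = p.1 + p.2 * (n + p.1) := by ring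
      rw [← hp, t.br_add, ← add_smul, smul_smul, h1, h2, zpow_add₀ t.v_ne (-p.2 : ℤ),
        zpow_add₀ t.v_ne (p.1 : ℤ)]
      congr 1
      ring
    rw [Finset.sum_congr rfl h2, ← Finset.smul_sum] at h
    exact smul_right_injective A (t.br_ne_zero (n := (N + 1 : ℕ)) (by omega)) h

open Finset.Nat in
/-- The divided powers of `ad E` in terms of left and right multiplications. -/
theorem dE_eq_sum {n : ℤ} {x : A} (hx : t.Wt n x) (N : ℕ) :
    t.dE N x = ∑ p ∈ Finset.HasAntidiagonal.antidiagonal N,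
      ((-1) ^ p.2 * v ^ ((p.2 : ℤ) * (n + N - 1)) / (qFact v p.1 * qFact v p.2)) •
        (t.E ^ p.1 * x * t.E ^ p.2) := by
  induction N with
  | zero => simp [dE_zero, qFact_zero]
  | succ N ih =>
    let g1 : ℕ × ℕ → A := fun p =>
      ((-1) ^ p.2 * v ^ ((p.2 : ℤ) * (n + N - 1)) * br v p.1 / (qFact v p.1 * qFact v p.2)) •
        (t.E ^ p.1 * x * t.E ^ p.2)
    let g2 : ℕ × ℕ → A := fun p =>
      ((-1) ^ p.2 * v ^ ((p.2 : ℤ) * (n + N - 1) + (N + 1)) * br v p.2 /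
        (qFact v p.1 * qFact v p.2)) • (t.E ^ p.1 * x * t.E ^ p.2)
    have h : br v (N + 1 : ℕ) • t.dE (N + 1) x =
        ∑ p ∈ Finset.HasAntidiagonal.antidiagonal (N + 1), (g1 p + g2 p) := by
      rw [Finset.sum_add_distrib, sum_antidiagonal_succ, sum_antidiagonal_succ' (f := g2),
        ← adE_dE, (hx.dE N).adE_eq, ih, Finset.mul_sum, Finset.sum_mul, Finset.smul_sum]
      have e1 : g1 (0, N + 1) = 0 := by simp [g1, br_zero]
      have e2 : g2 (N + 1, 0) = 0 := by simp [g2, br_zero]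
      rw [e1, e2, zero_add, zero_add, sub_eq_add_neg, ← Finset.sum_neg_distrib]
      congr 1
      · refine Finset.sum_congr rfl fun p _ => ?_
        rw [mul_smul_comm, ← mul_assoc, ← mul_assoc, ← pow_succ']
        congr 1
        have := t.br_ne_zero (n := (p.1 + 1 : ℕ)) (by omega)
        have := t.qFact_ne_zero p.1
        have := t.qFact_ne_zero p.2
        simp only [qFact_succ]
        field_simp
      · refine Finset.sum_congr rfl fun p _ => ?_
        rw [smul_mul_assoc, mul_assoc, ← pow_succ, smul_smul, ← neg_smul]
        congr 1
        have := t.br_ne_zero (n := (p.2 + 1 : ℕ)) (by omega)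
        have := t.qFact_ne_zero p.1
        have := t.qFact_ne_zero p.2
        simp only [qFact_succ]
        have e : v ^ (((p.2 + 1 : ℕ) : ℤ) * (n + N - 1) + (N + 1)) =
            v ^ (n + 2 * (N : ℤ)) * v ^ ((p.2 : ℤ) * (n + N - 1)) := by
          rw [← zpow_add₀ t.v_ne]; congr 1; push_cast; ring
        rw [e, pow_succ]
        field_simp
    have h2 : ∀ p ∈ Finset.HasAntidiagonal.antidiagonal (N + 1), g1 p + g2 p = br v (N + 1 : ℕ) •
        (((-1) ^ p.2 * v ^ ((p.2 : ℤ) * (n + (N + 1 : ℕ) - 1)) / (qFact v p.1 * qFact v p.2)) •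
        (t.E ^ p.1 * x * t.E ^ p.2)) := by
      intro p hp
      rw [Finset.HasAntidiagonal.mem_antidiagonal] at hp
      have hN : (N : ℤ) + 1 = p.1 + p.2 := by exact_mod_cast hp.symm
      rw [← add_smul, smul_smul]
      congr 1
      rw [← hp, t.br_add]
      push_cast
      rw [show (p.2 : ℤ) * (n + (p.1 + p.2) - 1) = p.2 * (n + N - 1) + p.2 by rw [← hN]; ring, hN,
        zpow_add₀ t.v_ne, zpow_add₀ t.v_ne, zpow_add₀ t.v_ne, zpow_neg]
      have := zpow_ne_zero (p.2 : ℤ) t.v_ne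
      field_simp
    rw [Finset.sum_congr rfl h2, ← Finset.smul_sum] at h
    exact smul_right_injective A (t.br_ne_zero (n := (N + 1 : ℕ)) (by omega)) h

end QTriple

/-! ### Normal forms of strings -/

theorem br_ofNat_two {v : ℂ} (h0 : v ≠ 0) (hd : v ^ 2 - 1 ≠ 0) : br v 2 = v + v⁻¹ := by
  have h : v - v⁻¹ ≠ 0 := by
    intro h; apply hd; field_simp at h; linear_combination h
  simp only [br]; rw [show (2 : ℤ) = (2 : ℕ) by norm_num, zpow_neg, zpow_natCast]
  field_simp; ring

theorem br_ofNat_three {v : ℂ} (h0 : v ≠ 0) (hd : v ^ 2 - 1 ≠ 0) :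
    br v 3 = v ^ 2 + 1 + v⁻¹ ^ 2 := by
  have h : v - v⁻¹ ≠ 0 := by
    intro h; apply hd; field_simp at h; linear_combination h
  simp only [br]; rw [show (3 : ℤ) = (3 : ℕ) by norm_num, zpow_neg, zpow_natCast]
  field_simp; ring

/-- `[n - k]` in terms of `v` and `a = v ^ n`. -/
theorem br_sub_nat {v : ℂ} (h0 : v ≠ 0) (n : ℤ) (k : ℕ) :
    br v (n - k) = (v ^ n * (v ^ k)⁻¹ - (v ^ n)⁻¹ * v ^ k) / (v - v⁻¹) := by
  rw [br, neg_sub, zpow_sub₀ h0, zpow_sub₀ h0, zpow_natCast]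
  field_simp

/-- A string `X₀, X₁, …` on which left multiplication by `f = F K` acts as in the string of
lowered vectors of a highest weight vector `X₀` with `a = v ^ wt(X₀)`. -/
structure IsString {A : Type*} [Ring A] [Algebra ℂ A] (v a : ℂ) (f : A) (X : ℕ → A) : Prop where
  ne : a ≠ 0
  h0 : f * X 0 = a • (X 1 + X 0 * f)
  h1 : f * X 1 = (a * v⁻¹ ^ 2) • ((v + v⁻¹) • X 2 + X 1 * f)
  h2 : f * X 2 = (a * v⁻¹ ^ 4) • ((v ^ 2 + 1 + v⁻¹ ^ 2) • X 3 + X 2 * f)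

section Strings

variable {A : Type*} [Ring A] [Algebra ℂ A] {v a b : ℂ} {f : A} {X L : ℕ → A}

theorem IsString.h0' (h : IsString v a f X) (w : A) :
    f * (X 0 * w) = a • (X 1 * w + X 0 * (f * w)) := by
  rw [← mul_assoc, h.h0, smul_mul_assoc, add_mul, mul_assoc]

theorem IsString.h1' (h : IsString v a f X) (w : A) :
    f * (X 1 * w) = (a * v⁻¹ ^ 2) • ((v + v⁻¹) • (X 2 * w) + X 1 * (f * w)) := by
  rw [← mul_assoc, h.h1, smul_mul_assoc, add_mul, mul_assoc, smul_mul_assoc]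

/-- The divided powers of `ad (-f)` applied to `X 0`, written with all factors `f` on the right. The
formulas are meant for exponents at most `3`. -/
def tau {A : Type*} [Ring A] [Algebra ℂ A] (v a : ℂ) (f : A) (X : ℕ → A) : ℕ → A
  | 0 => X 0
  | 1 => -a • X 1 - (a - a⁻¹) • (X 0 * f)
  | 2 => (a ^ 2 * v⁻¹ ^ 2) • X 2 + (a ^ 2 * v⁻¹ - v) • (X 1 * f) +
      ((a - a⁻¹) * (a - a⁻¹ * v ^ 2) * (v + v⁻¹)⁻¹) • (X 0 * (f * f))
  | _ => (-(a ^ 3 * v⁻¹ ^ 6)) • X 3 - (a ^ 3 * v⁻¹ ^ 4 - a) • (X 2 * f) -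
      (v * (a * v⁻¹ - a⁻¹ * v) * (a ^ 2 * v⁻¹ ^ 2 - v ^ 2) * (v + v⁻¹)⁻¹) • (X 1 * (f * f)) -
      ((a - a⁻¹) * (a - a⁻¹ * v ^ 2) * (a - a⁻¹ * v ^ 4) * (v + v⁻¹)⁻¹ *
        (v ^ 2 + 1 + v⁻¹ ^ 2)⁻¹) • (X 0 * (f * (f * f)))

/-- The quantum integer `[n - k]`, as a function of `a = v ^ n`. -/
def mbr (v a : ℂ) (k : ℕ) : ℂ := (a * (v ^ k)⁻¹ - a⁻¹ * v ^ k) / (v - v⁻¹)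

/-- The quantum binomial coefficient of `n - i` over `k`, as a function of `a = v ^ n`. -/
def mbn (v a : ℂ) (i k : ℕ) : ℂ := (∏ t ∈ Finset.range k, mbr v a (i + t)) / qFact v k

/-- The coefficients `ηⱼ` for which `∑ⱼ ηⱼ (ad E)⁽ʲ⁾x · (ad E)⁽ᵖ⁻ʲ⁾l` is a lowest weight vector,
where `x` and `l` are lowest weight vectors of weights `-m` and `-n`, and `a = v ^ m`, `b = v ^ n`.
-/
def eta (v a b : ℂ) (p j : ℕ) : ℂ :=
  (-1) ^ j * (∏ t ∈ Finset.range j, (v ^ (2 * (p - t - 1)) * b⁻¹ * mbr v b (p - t - 1))) *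
    ∏ t ∈ Finset.range (p - j), mbr v a (j + t)

/-- The coefficients of the top divided power of `ad E`, which leads from depth `p` to height `p`,
applied to the products `(ad E)⁽ʲ⁾x · (ad E)⁽ᵖ⁻ʲ⁾l`, with `x`, `l`, `a`, `b` as for `eta`; the index
`i` counts the steps down from the top of the string of `x`. -/
def zeta (v a b : ℂ) (p i j : ℕ) : ℂ :=
  (b * v ^ (i + j) * (v ^ (2 * p))⁻¹) ^ j * ((b * v ^ (i + j) * (v ^ (2 * p))⁻¹) ^ i)⁻¹ *
    mbn v a i j * mbn v b (p - i) (p - j)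

set_option maxHeartbeats 4000000 in
/-- The identity between the two ends of the strings in a product of two strings. The left-hand side
is a lowest weight vector for the flipped triple, in the product of the strings of `X 0` and `L 0`
for `ad (-f)`; the right-hand side is the highest vector, for the original triple, of the string
with the same coefficients `ηⱼ` at its lower end. -/
theorem top_identity {p : ℕ} (hp : p ≤ 3) (hX : IsString v a f X) (hL : IsString v b f L)
    (h0 : v ≠ 0) (hd : v ^ 2 - 1 ≠ 0) (h2 : v ^ 2 + 1 ≠ 0) (h3 : v ^ 4 + v ^ 2 + 1 ≠ 0) :
    ∑ j ∈ Finset.range (p + 1), eta v a b p j • (tau v a f X j * tau v b f L (p - j)) =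
      ∑ i ∈ Finset.range (p + 1),
        (∑ j ∈ Finset.range (p + 1), eta v a b p j * zeta v a b p i j) • (X i * L (p - i)) := by
  have hd' : v - v⁻¹ ≠ 0 := by
    intro h; apply hd; field_simp at h; linear_combination h
  have ha := hX.ne
  have hb := hL.ne
  have h3' : v ^ 2 * (v ^ 2 + 1) + 1 ≠ 0 := by
    intro h; apply h3; linear_combination h
  have hf1 : qFact v 1 = 1 := by simp [qFact, qInt_eq_br, br, hd']
  have hf2 : qFact v 2 = v + v⁻¹ := by
    rw [qFact_succ, hf1, one_mul]; exact br_ofNat_two h0 hd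
  have hf3 : qFact v 3 = (v + v⁻¹) * (v ^ 2 + 1 + v⁻¹ ^ 2) := by
    rw [qFact_succ, hf2]; congr 1; exact br_ofNat_three h0 hd
  interval_cases p
  · simp [eta, tau, zeta, mbn, qFact_zero]
  -- move all factors `f` to the right and compare coefficients
  all_goals
    simp [Finset.sum_range_succ, eta, zeta, mbn, tau, Finset.prod_range_succ, qFact_zero, hf1, hf2,
      hf3, mbr, -inv_pow, -zpow_neg, -smul_add]
    simp only [mul_neg, neg_mul, smul_neg, neg_smul, mul_add, mul_sub, add_mul, sub_mul,
      mul_smul_comm, smul_mul_assoc, mul_assoc, hL.h0, hL.h1, hL.h2, hL.h0', hL.h1', smul_add,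
      smul_sub, smul_smul]
    match_scalars <;> field_simp <;> ring

end Strings

/-! ### The flipped triple -/

namespace QTriple

variable {A : Type*} [Ring A] [Algebra ℂ A] {v : ℂ} (t : QTriple A v)

include t in
theorem sq_sub_ne : v ^ 2 - 1 ≠ 0 := sub_ne_zero.mpr (t.v_pow 2 (by norm_num))

include t in
theorem sq_add_ne : v ^ 2 + 1 ≠ 0 := fun h =>
  t.v_pow 4 (by norm_num) (by linear_combination (v ^ 2 - 1) * h)

include t in
theorem quartic_ne : v ^ 4 + v ^ 2 + 1 ≠ 0 := fun h =>
  t.v_pow 6 (by norm_num) (by linear_combination (v ^ 2 - 1) * h)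

/-- The image `(-F K, -K⁻¹ E, K⁻¹, K)` of a triple under the braid operator. -/
def flip : QTriple A v where
  E := -(t.F * t.K)
  F := -(t.L * t.E)
  K := t.L
  L := t.K
  v_ne := t.v_ne
  v_pow := t.v_pow
  KL := t.LK
  LK := t.KL
  KE := by
    have h := (Wt.F (t := t)).L_mul
    rw [mul_neg, ← mul_assoc, h, neg_mul, smul_mul_assoc, mul_assoc, mul_assoc, t.LK, t.KL,
      smul_neg]
    norm_num
  KF := by
    have h : t.L * t.E = v ^ (-2 : ℤ) • (t.E * t.L) := (Wt.E (t := t)).L_mul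
    rw [mul_neg, neg_mul, smul_neg, mul_assoc t.L t.E, ← mul_smul_comm, ← h]
  EF := by
    have h1 : t.F * t.K * (t.L * t.E) = t.F * t.E := by
      rw [mul_assoc, ← mul_assoc t.K, t.KL, one_mul]
    have h2 : t.L * t.E * (t.F * t.K) = t.E * t.F := by
      have := (Wt.E.mul Wt.F (t := t)).L_mul_K
      rw [show (-(2 + -2) : ℤ) = 0 by norm_num, zpow_zero, one_smul] at this
      rw [← this]; simp only [mul_assoc]
    rw [neg_mul_neg, neg_mul_neg, h1, h2, ← neg_sub, t.EF, ← smul_neg, neg_sub]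

theorem Wt.flip {t : QTriple A v} {n : ℤ} {x : A} (h : t.Wt n x) : t.flip.Wt (-n) x := h.L_mul

/-- Left multiplication by `F K` in terms of the adjoint action. -/
theorem FK_mul {n : ℤ} {z : A} (hz : t.Wt n z) :
    t.F * t.K * z = v ^ n • (t.adF z + z * (t.F * t.K)) := by
  have h : t.K * z = v ^ n • (z * t.K) := hz
  rw [mul_assoc, h, mul_smul_comm, adF_def, sub_mul, mul_assoc, mul_assoc, sub_add_cancel]

theorem flip_adE {n : ℤ} {z : A} (hz : t.Wt n z) :
    t.flip.adE z = -(t.F * t.K * z - v ^ (-n) • (z * (t.F * t.K))) := by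
  rw [hz.flip.adE_eq]
  change -(t.F * t.K) * z - v ^ (-n) • (z * -(t.F * t.K)) = _
  rw [neg_mul, mul_neg, smul_neg]; abel

theorem Wt.flip_adE {t : QTriple A v} {n : ℤ} {x : A} (h : t.Wt n x) :
    t.Wt (n - 2) (t.flip.adE x) := by
  rw [t.flip_adE h, ← zero_sub]
  refine ((Wt.zero).sub ?_)
  exact (((Wt.F.mul Wt.K).mul h).cast (by ring)).sub
    (((h.mul (Wt.F.mul Wt.K)).cast (by ring)).smul _)

theorem Wt.flip_dE {t : QTriple A v} {n : ℤ} {x : A} (h : t.Wt n x) (k : ℕ) :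
    t.Wt (n - 2 * k) (t.flip.dE k x) := by
  induction k with
  | zero => simpa [QTriple.dE_zero] using h
  | succ k ih => rw [t.flip.dE_succ]; exact (ih.flip_adE.smul _).cast (by push_cast; ring)

/-- The lowered vectors of a weight vector form a string in the sense of `IsString`. -/
theorem isString {a : ℤ} {X : A} (hX : t.Wt a X) :
    IsString v (v ^ a) (t.F * t.K) (fun i => t.dF i X) := by
  have h0 := t.v_ne
  refine ⟨zpow_ne_zero _ h0, ?_, ?_, ?_⟩
  · rw [t.FK_mul (hX.dF 0), adF_dF]
    simp [t.br_one]
  · rw [t.FK_mul (hX.dF 1), adF_dF, ← br_ofNat_two h0 t.sq_sub_ne]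
    congr 1
    rw [zpow_sub₀ h0, div_eq_mul_inv, ← inv_zpow]; norm_cast
  · rw [t.FK_mul (hX.dF 2), adF_dF, ← br_ofNat_three h0 t.sq_sub_ne]
    congr 1
    rw [zpow_sub₀ h0, div_eq_mul_inv, ← inv_zpow]; norm_cast

theorem flip_dE_succ {a : ℤ} {X : A} (hX : t.Wt a X) (k : ℕ) :
    t.flip.dE (k + 1) X = -((br v (k + 1 : ℕ))⁻¹ • (t.F * t.K * t.flip.dE k X -
      ((v ^ a)⁻¹ * v ^ (2 * k)) • (t.flip.dE k X * (t.F * t.K)))) := by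
  rw [t.flip.dE_succ, t.flip_adE (hX.flip_dE k), smul_neg]
  congr 4
  rw [neg_sub, zpow_sub₀ t.v_ne, div_eq_mul_inv, mul_comm]; norm_cast

/-- The vectors of the string of `ad(-F K)` in normal form. -/
theorem flip_dE_eq_tau {a : ℤ} {X : A} (hX : t.Wt a X) {k : ℕ} (hk : k ≤ 3) :
    t.flip.dE k X = tau v (v ^ a) (t.F * t.K) (fun i => t.dF i X) k := by
  have h := t.isString hX
  have hd := t.sq_sub_ne
  have h0 := t.v_ne
  have h2 := t.sq_add_ne
  have h3' : v ^ 2 * (v ^ 2 + 1) + 1 ≠ 0 := by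
    intro h; apply t.quartic_ne; linear_combination h
  have ha := h.ne
  have hz : t.flip.dE 0 X = t.dF 0 X := by rw [dE_zero, dF_zero]
  have t1 : t.flip.dE 1 X = tau v (v ^ a) (t.F * t.K) (fun i => t.dF i X) 1 := by
    rw [t.flip_dE_succ hX, hz]
    simp only [zero_add, Nat.cast_one, t.br_one]
    simp only [tau, mul_sub, mul_add, mul_smul_comm, ← mul_assoc, h.h0, h.h1, h.h2, smul_add,
      smul_sub, smul_smul, sub_mul, smul_mul_assoc, add_mul]
    generalize v ^ a = a' at *
    match_scalars <;> field_simp <;> ring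
  have t2 : t.flip.dE 2 X = tau v (v ^ a) (t.F * t.K) (fun i => t.dF i X) 2 := by
    rw [t.flip_dE_succ hX, t1, show ((1 + 1 : ℕ) : ℤ) = 2 by norm_num, br_ofNat_two h0 hd]
    have g0 := h.h0
    have g1 := h.h1
    have g2 := h.h2
    generalize t.F * t.K = f at *
    simp only [tau, mul_sub, mul_add, mul_smul_comm, ← mul_assoc, g0, g1, g2, smul_add,
      smul_sub, smul_smul, sub_mul, smul_mul_assoc, add_mul]
    generalize v ^ a = a' at *
    match_scalars <;> field_simp <;> ring
  have t3 : t.flip.dE 3 X = tau v (v ^ a) (t.F * t.K) (fun i => t.dF i X) 3 := by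
    rw [t.flip_dE_succ hX, t2, show ((2 + 1 : ℕ) : ℤ) = 3 by norm_num, br_ofNat_three h0 hd]
    have g0 := h.h0
    have g1 := h.h1
    have g2 := h.h2
    generalize t.F * t.K = f at *
    simp only [tau, mul_sub, mul_add, mul_smul_comm, ← mul_assoc, g0, g1, g2, smul_add,
      smul_sub, smul_smul, sub_mul, smul_mul_assoc, add_mul]
    generalize v ^ a = a' at *
    match_scalars <;> field_simp <;> ring
  interval_cases k
  exacts [hz, t1, t2, t3]

/-- The operator `z ↦ (F K) z - s z (F K)`. For varying `s` these operators commute. -/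
def twist (s : ℂ) : Module.End ℂ A :=
  LinearMap.mulLeft ℂ (t.F * t.K) - s • LinearMap.mulRight ℂ (t.F * t.K)

theorem twist_apply (s : ℂ) (z : A) :
    t.twist s z = t.F * t.K * z - s • (z * (t.F * t.K)) := by
  simp [twist, mul_assoc]

theorem twist_commute (r s : ℂ) : Commute (t.twist r) (t.twist s) := by
  have h : Commute (LinearMap.mulLeft ℂ (t.F * t.K)) (LinearMap.mulRight ℂ (t.F * t.K)) :=
    LinearMap.commute_mulLeft_right _ _
  refine ((Commute.refl _).sub_right (h.smul_right s)).sub_left ?_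
  exact ((h.symm.sub_right ((Commute.refl _).smul_right s))).smul_left r

theorem flip_adE_pow_eq {a : ℤ} {X : A} (hX : t.Wt a X) (k : ℕ) :
    t.Wt (a - 2 * k) ((t.flip.adE ^ k) X) ∧ (t.flip.adE ^ k) X =
      (-1 : ℂ) ^ k •
        ((List.range k).map fun i : ℕ => t.twist (v ^ (-a + 2 * i))).reverse.prod X := by
  induction k with
  | zero => simpa using hX
  | succ k ih =>
    rw [pow_succ', Module.End.mul_apply]
    refine ⟨ih.1.flip_adE.cast (by push_cast; ring), ?_⟩
    rw [t.flip_adE ih.1, ← twist_apply, ih.2, List.range_succ, List.map_append, List.reverse_append]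
    simp only [List.map_cons, List.map_nil, List.reverse_singleton, List.cons_append,
      List.nil_append, List.prod_cons, Module.End.mul_apply, map_smul, pow_succ']
    rw [← neg_smul, neg_one_mul, show -(a - 2 * (k : ℤ)) = -a + 2 * k by ring]

theorem adF_pow_eq {a : ℤ} {X : A} (hX : t.Wt a X) (k : ℕ) :
    ∃ c : ℂ, c ≠ 0 ∧ (t.adF ^ k) X =
      c • ((List.range k).map fun i : ℕ => t.twist (v ^ (a - 2 * i))).reverse.prod X := by
  induction k with
  | zero => exact ⟨1, one_ne_zero, by simp⟩
  | succ k ih =>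
    obtain ⟨c, hc, ih⟩ := ih
    have h := t.FK_mul (hX.adF_pow k)
    have hv := zpow_ne_zero (a - 2 * k) t.v_ne
    refine ⟨(v ^ (a - 2 * k : ℤ))⁻¹ * c, mul_ne_zero (inv_ne_zero hv) hc, ?_⟩
    have h2 : t.adF ((t.adF ^ k) X) =
        (v ^ (a - 2 * k : ℤ))⁻¹ • t.twist (v ^ (a - 2 * k : ℤ)) ((t.adF ^ k) X) := by
      rw [twist_apply, h, ← smul_sub, add_sub_cancel_right, smul_smul, inv_mul_cancel₀ hv, one_smul]
    rw [pow_succ', Module.End.mul_apply, h2, ih, List.range_succ, List.map_append,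
      List.reverse_append]
    simp only [List.map_cons, List.map_nil, List.reverse_singleton, List.cons_append,
      List.nil_append, List.prod_cons, Module.End.mul_apply, map_smul, smul_smul]

/-- If `(ad F) ^ (b + 1)` kills a vector of weight `b`, so does the same power of `ad (-F K)`: both
are, up to a factor, the product of the commuting operators `z ↦ (F K) z - v ^ (b - 2 i) z (F K)`,
`0 ≤ i ≤ b`, taken in opposite orders. -/
theorem flip_adE_pow_eq_zero {b : ℕ} {X : A} (hX : t.Wt b X) (h : (t.adF ^ (b + 1)) X = 0) :
    (t.flip.adE ^ (b + 1)) X = 0 := by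
  obtain ⟨c, hc, hF⟩ := t.adF_pow_eq hX (b + 1)
  rw [h] at hF
  rw [(t.flip_adE_pow_eq hX (b + 1)).2]
  have e : ((List.range (b + 1)).map fun i : ℕ => t.twist (v ^ (-(b : ℤ) + 2 * i))).reverse =
      (List.range (b + 1)).map fun i : ℕ => t.twist (v ^ ((b : ℤ) - 2 * i)) := by
    refine List.ext_getElem (by simp) fun n h1 h2 => ?_
    simp only [List.length_map, List.length_range] at h2
    simp only [List.getElem_reverse, List.getElem_map, List.getElem_range, List.length_map,
      List.length_range]
    congr 2
    omega
  have e2 := List.Perm.prod_eq' (List.reverse_perm ((List.range (b + 1)).map fun i : ℕ =>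
    t.twist (v ^ ((b : ℤ) - 2 * i)))) (List.pairwise_reverse.mpr (List.pairwise_map.mpr
      (List.pairwise_of_forall fun _ _ => t.twist_commute _ _)))
  rw [e, ← e2, (smul_eq_zero.mp hF.symm).resolve_left hc, smul_zero]

end QTriple

/-! ### Strings and their ends -/

theorem mbr_zpow {v : ℂ} (h0 : v ≠ 0) (n : ℤ) (k : ℕ) : mbr v (v ^ n) k = br v (n - k) :=
  (br_sub_nat h0 n k).symm

theorem qFact_add (v : ℂ) (m j : ℕ) :
    qFact v (m + j) = qFact v m * ∏ t ∈ Finset.range j, br v (m + j - t : ℤ) := by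
  induction j with
  | zero => simp
  | succ j ih =>
    rw [← add_assoc, qFact_succ, ih, Finset.prod_range_succ', mul_assoc]
    congr 2
    · refine Finset.prod_congr rfl fun t _ => ?_
      congr 1; push_cast; ring

namespace QTriple

variable {A : Type*} [Ring A] [Algebra ℂ A] {v : ℂ} (t : QTriple A v)

/-- `l` is a lowest weight vector of weight `-b` of a finite-dimensional string, and `L` is the
highest vector of this string. -/
structure Good (b : ℕ) (l L : A) : Prop where
  wt : t.Wt (-b) l
  low : t.adF l = 0
  nil : (t.adE ^ (b + 1)) l = 0
  top : L = t.dE b l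

/-- The sums of pairs obtained from the two ends `l`, `L` of a string by applying `k` times `ad E`
to `l`, and `k` times the `ad E` of the flipped triple to `L`, for the same `k`; `ν` is the weight
of the first component. For a braid operator `T` these are pairs of the form `(x, T x)`. -/
inductive InG : ℤ → A → A → Prop
  | good {b : ℕ} {l L : A} (h : t.Good b l L) (k : ℕ) {ν : ℤ} (hν : ν = 2 * k - b) :
      InG ν (t.dE k l) (t.flip.dE k L)
  | zero (ν : ℤ) : InG ν 0 0
  | add {ν : ℤ} {x X y Y : A} : InG ν x X → InG ν y Y → InG ν (x + y) (X + Y)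

variable {t}

namespace Good

variable {b : ℕ} {l L : A}

theorem dE_eq_zero (h : t.Good b l L) {k : ℕ} (hk : b < k) : t.dE k l = 0 := by
  obtain ⟨m, rfl⟩ := Nat.exists_eq_add_of_le (show b + 1 ≤ k from hk)
  rw [dE_def, add_comm, pow_add, Module.End.mul_apply, h.nil, map_zero, smul_zero]

theorem wt_top (h : t.Good b l L) : t.Wt b L := by
  rw [h.top]; exact (h.wt.dE b).cast (by ring)

theorem flip_wt (h : t.Good b l L) : t.flip.Wt (-b) L := h.wt_top.flip

theorem dF_top (h : t.Good b l L) {i : ℕ} (hi : i ≤ b) : t.dF i L = t.dE (b - i) l := by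
  rw [h.top, t.dF_dE_top h.wt h.low hi]

/-- The string of `L` for the flipped triple is not longer than that of `l`. -/
theorem flip_dE_eq_zero (h : t.Good b l L) {k : ℕ} (hk : b < k) : t.flip.dE k L = 0 := by
  obtain ⟨m, rfl⟩ := Nat.exists_eq_add_of_le (show b + 1 ≤ k from hk)
  have h1 : t.adF (t.dF b L) = 0 := by rw [h.dF_top le_rfl, Nat.sub_self, dE_zero, h.low]
  have h2 : (t.adF ^ (b + 1)) L = 0 := by
    rw [dF_def, map_smul, smul_eq_zero] at h1
    rw [pow_succ', Module.End.mul_apply]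
    exact h1.resolve_left (inv_ne_zero (t.qFact_ne_zero b))
  rw [dE_def, add_comm, pow_add, Module.End.mul_apply, t.flip_adE_pow_eq_zero h.wt_top h2,
    map_zero, smul_zero]

theorem smul (h : t.Good b l L) (c : ℂ) : t.Good b (c • l) (c • L) :=
  ⟨h.wt.smul c, by rw [map_smul, h.low, smul_zero], by rw [map_smul, h.nil, smul_zero],
    by rw [map_smul, h.top]⟩

theorem add {l' L' : A} (h : t.Good b l L) (h' : t.Good b l' L') :
    t.Good b (l + l') (L + L') :=
  ⟨h.wt.add h'.wt, by rw [map_add, h.low, h'.low, add_zero],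
    by rw [map_add, h.nil, h'.nil, add_zero], by rw [map_add, h.top, h'.top]⟩

end Good

theorem dE_dE (t : QTriple A v) (m j : ℕ) (x : A) :
    t.dE m (t.dE j x) = (qFact v (m + j) / (qFact v m * qFact v j)) • t.dE (m + j) x := by
  rw [dE_def, dE_def, dE_def, map_smul, ← Module.End.mul_apply, ← pow_add, smul_smul, smul_smul]
  congr 1
  have := t.qFact_ne_zero m
  have := t.qFact_ne_zero j
  have := t.qFact_ne_zero (m + j)
  field_simp

theorem mbn_eq (t : QTriple A v) {a i j : ℕ} (h : i + j ≤ a) :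
    mbn v (v ^ (a : ℤ)) i j = qFact v (a - i) / (qFact v (a - i - j) * qFact v j) := by
  obtain ⟨m, rfl⟩ := Nat.exists_eq_add_of_le h
  have h1 : i + j + m - i = m + j := by omega
  have h2 : m + j - j = m := by omega
  rw [mbn, h1, h2, qFact_add, mul_div_mul_left _ _ (t.qFact_ne_zero m)]
  congr 1
  refine Finset.prod_congr rfl fun s _ => ?_
  rw [mbr_zpow t.v_ne]
  congr 1; push_cast; ring

theorem mbn_eq_zero (t : QTriple A v) {a i j : ℕ} (hi : i ≤ a) (h : a < i + j) :
    mbn v (v ^ (a : ℤ)) i j = 0 := by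
  rw [mbn, Finset.prod_eq_zero (Finset.mem_range.mpr (show a - i < j by omega)), zero_div]
  rw [mbr_zpow t.v_ne, show (a : ℤ) - (i + (a - i) : ℕ) = 0 by omega, br_zero]

/-- Applying a divided power that leads from depth `p` to height `p` to a product of two strings. -/
theorem dE_mul_string {a b c p j k : ℕ} {x X l L : A} (hx : t.Good a x X) (hl : t.Good b l L)
    (hjk : j + k = p) (hpa : p ≤ a) (hpb : p ≤ b) (hc : c + 2 * p = a + b) :
    t.dE c (t.dE j x * t.dE k l) = ∑ i ∈ Finset.range (p + 1),
      zeta v (v ^ (a : ℤ)) (v ^ (b : ℤ)) p i j • (t.dE (a - i) x * t.dE (b - (p - i)) l) := by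
  rw [t.dE_mul (hx.wt.dE j)]
  have key : ∀ m n : ℕ, ∀ i : ℕ, i ≤ p → m + i + j = a → n + 2 * p = b + i + j →
      v ^ ((n : ℤ) * (-a + 2 * j + m)) • (t.dE m (t.dE j x) * t.dE n (t.dE k l)) =
      zeta v (v ^ (a : ℤ)) (v ^ (b : ℤ)) p i j • (t.dE (a - i) x * t.dE (b - (p - i)) l) := by
    intro m n i hi hm hn
    have e1 : a - i = m + j := by omega
    have e2 : b - (p - i) = n + k := by omega
    have e3 : p - j = k := by omega
    rw [dE_dE, dE_dE, smul_mul_smul_comm, smul_smul, zeta, t.mbn_eq (show i + j ≤ a by omega),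
      t.mbn_eq (show (p - i) + (p - j) ≤ b by omega), e1, e2, e3, Nat.add_sub_cancel,
      Nat.add_sub_cancel, mul_assoc]
    congr 1
    congr 1
    have h0 := t.v_ne
    have e4 : v ^ (b : ℤ) * v ^ (i + j) * (v ^ (2 * p))⁻¹ = v ^ (n : ℤ) := by
      rw [← zpow_natCast v (i + j), ← zpow_natCast v (2 * p), ← zpow_add₀ h0, ← zpow_neg,
        ← zpow_add₀ h0]
      congr 1; push_cast; omega
    rw [e4, ← zpow_natCast (v ^ (n : ℤ)) j, ← zpow_natCast (v ^ (n : ℤ)) i, ← zpow_mul, ← zpow_mul,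
      ← zpow_neg, ← zpow_add₀ h0]
    congr 1
    have : (m : ℤ) = a - i - j := by omega
    rw [this]; ring
  -- the term with first exponent `m` in the Leibniz rule ends `i = a - j - m` steps below the top
  refine Finset.sum_bij_ne_zero (fun q _ _ => a - j - q.1) ?_ ?_ ?_ ?_
  · rintro ⟨m, n⟩ hmn hne
    rw [Finset.HasAntidiagonal.mem_antidiagonal] at hmn
    simp only at hmn hne ⊢
    have h2 : n + k ≤ b := by
      by_contra h
      apply hne
      rw [dE_dE _ n, hl.dE_eq_zero (by omega)]; simp
    rw [Finset.mem_range]; omega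
  · rintro ⟨m, n⟩ hmn hne ⟨m', n'⟩ hmn' hne' h
    rw [Finset.HasAntidiagonal.mem_antidiagonal] at hmn hmn'
    simp only at hmn hmn' hne hne' h
    have h1 : m + j ≤ a := by
      by_contra h
      apply hne
      rw [dE_dE _ m, hx.dE_eq_zero (by omega)]; simp
    have h1' : m' + j ≤ a := by
      by_contra h
      apply hne'
      rw [dE_dE _ m', hx.dE_eq_zero (by omega)]; simp
    simp only [Prod.mk.injEq]; omega
  · intro i hi hne
    rw [Finset.mem_range] at hi
    have h1 : i + j ≤ a := by
      by_contra h
      apply hne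
      rw [zeta, t.mbn_eq_zero (by omega) (by omega)]; simp
    have h2 : 2 * p ≤ b + i + j := by
      by_contra h
      apply hne
      rw [zeta, t.mbn_eq_zero (a := b) (i := p - i) (by omega) (by omega)]; simp
    have hk := key (a - i - j) (b + i + j - 2 * p) i (by omega) (by omega) (by omega)
    refine ⟨(a - i - j, b + i + j - 2 * p), ?_, ?_, ?_⟩
    · rw [Finset.HasAntidiagonal.mem_antidiagonal]; simp only; omega
    · simp only; rw [hk]; exact hne
    · simp only; omega
  · rintro ⟨m, n⟩ hmn hne
    rw [Finset.HasAntidiagonal.mem_antidiagonal] at hmn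
    simp only at hmn hne ⊢
    have h1 : m + j ≤ a := by
      by_contra h
      apply hne
      rw [dE_dE _ m, hx.dE_eq_zero (by omega)]; simp
    have h2 : n + k ≤ b := by
      by_contra h
      apply hne
      rw [dE_dE _ n, hl.dE_eq_zero (by omega)]; simp
    exact key m n _ (by omega) (by omega) (by omega)

end QTriple

/-! ### Lowest weight vectors in a product of strings -/

namespace QTriple

variable {A : Type*} [Ring A] [Algebra ℂ A] {v : ℂ} {t : QTriple A v}

theorem dE_mul_eq_zero {n : ℤ} {x y : A} {r s N : ℕ} (hx : t.Wt n x)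
    (h1 : ∀ m, r ≤ m → t.dE m x = 0) (h2 : ∀ m, s ≤ m → t.dE m y = 0) (hN : r + s ≤ N) :
    t.dE N (x * y) = 0 := by
  rw [t.dE_mul hx]
  refine Finset.sum_eq_zero fun p hp => ?_
  rw [Finset.HasAntidiagonal.mem_antidiagonal] at hp
  rcases le_or_gt r p.1 with h | h
  · rw [h1 _ h]; simp
  · rw [h2 p.2 (by omega)]; simp

/-- The lowest weight vectors in the product of two strings are `∑ⱼ ηⱼ (ad E)⁽ʲ⁾x · (ad E)⁽ᵖ⁻ʲ⁾l`,
and the highest vectors of their strings are given by the same formula for the flipped triple. -/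
theorem Good.combine {a b p : ℕ} {x X l L : A} (hx : t.Good a x X) (hl : t.Good b l L)
    (ha3 : a ≤ 3) (hpa : p ≤ a) (hpb : p ≤ b) :
    t.Good (a + b - 2 * p)
      (∑ j ∈ Finset.range (p + 1), eta v (v ^ (a : ℤ)) (v ^ (b : ℤ)) p j •
        (t.dE j x * t.dE (p - j) l))
      (∑ j ∈ Finset.range (p + 1), eta v (v ^ (a : ℤ)) (v ^ (b : ℤ)) p j •
        (t.flip.dE j X * t.flip.dE (p - j) L)) := by
  have h0 := t.v_ne
  set c := a + b - 2 * p with hc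
  set y := ∑ j ∈ Finset.range (p + 1), eta v (v ^ (a : ℤ)) (v ^ (b : ℤ)) p j •
        (t.dE j x * t.dE (p - j) l) with hy
  have wt : t.Wt (-c) y := by
    rw [hy]
    refine Finset.sum_induction _ (fun z => t.Wt (-c) z) (fun _ _ h h' => h.add h') Wt.zero ?_
    intro j hj
    rw [Finset.mem_range] at hj
    exact (((hx.wt.dE j).mul (hl.wt.dE (p - j))).cast (by omega)).smul _
  have low : t.adF y = 0 := by
    rw [hy, map_sum]
    have e1 : ∀ j, j ≤ p → t.adF (t.dE j x * t.dE (p - j) l) =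
        (if j = 0 then 0 else (v ^ (b - 2 * (p - j : ℕ) : ℤ) * br v (a - (j - 1 : ℕ))) •
          (t.dE (j - 1) x * t.dE (p - j) l)) +
        (if j = p then 0 else br v (b - (p - j - 1 : ℕ)) •
          (t.dE j x * t.dE (p - j - 1) l)) := by
      intro j hj
      rw [t.adF_mul _ (hl.wt.dE (p - j))]
      congr 1
      · rcases j with _ | j
        · simp [dE_zero, hx.low]
        · rw [if_neg (by omega), t.adF_dE hx.wt hx.low, smul_mul_assoc, smul_smul,
            Nat.add_sub_cancel]
          congr 2
          congr 1; ring
      · rcases eq_or_ne j p with rfl | h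
        · simp [dE_zero, hl.low]
        · rw [if_neg h]
          obtain ⟨m, hm⟩ : ∃ m, p - j = m + 1 := ⟨p - j - 1, by omega⟩
          rw [hm, t.adF_dE hl.wt hl.low, mul_smul_comm, Nat.add_sub_cancel]
    rw [Finset.sum_congr rfl fun j hj => by
      rw [map_smul, e1 j (by rw [Finset.mem_range] at hj; omega), smul_add]]
    rw [Finset.sum_add_distrib, Finset.sum_range_succ', Finset.sum_range_succ _ p, if_pos rfl,
      if_pos rfl, smul_zero, smul_zero, add_zero, add_zero, ← Finset.sum_add_distrib]
    refine Finset.sum_eq_zero fun j hj => ?_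
    rw [Finset.mem_range] at hj
    rw [if_neg (by omega), if_neg (by omega), Nat.add_sub_cancel, smul_smul, smul_smul,
      show p - (j + 1) = p - j - 1 by omega, ← add_smul]
    convert zero_smul ℂ _
    rw [eta, eta, Finset.prod_range_succ, ← mbr_zpow h0, ← mbr_zpow h0,
      show p - j = (p - (j + 1)) + 1 by omega, Finset.prod_range_succ', Nat.add_sub_cancel,
      show p - (j + 1) = p - j - 1 by omega]
    have e2 : v ^ ((b : ℤ) - 2 * (p - j - 1 : ℕ)) = v ^ (b : ℤ) * (v ^ (2 * (p - j - 1)))⁻¹ := by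
      rw [← zpow_natCast v (2 * _), ← zpow_neg, ← zpow_add₀ h0]; congr 1
    rw [e2, add_zero, pow_succ]
    have e3 : ∀ s, mbr v (v ^ (a : ℤ)) (j + (s + 1)) = mbr v (v ^ (a : ℤ)) (j + 1 + s) := by
      intro s; congr 1; ring
    simp only [e3]
    have h1 := zpow_ne_zero (b : ℤ) h0
    have h2 := pow_ne_zero (2 * (p - j - 1)) h0
    field_simp
    ring
  -- `ad E` is nilpotent on `y`, and `(ad F) ^ (c + 2)` kills `(ad E) ^ (c + 1) y`, which has
  -- weight `c + 2` and therefore vanishes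
  have dEz : ∀ m, a + 1 + (b + 1) ≤ m → t.dE m y = 0 := by
    intro m hm
    rw [hy, map_sum]
    refine Finset.sum_eq_zero fun j hj => ?_
    rw [map_smul, dE_mul_eq_zero (r := a + 1) (s := b + 1) (hx.wt.dE j) ?_ ?_ hm, smul_zero]
    · intro m hm; rw [dE_dE, hx.dE_eq_zero (by omega), smul_zero]
    · intro m hm; rw [dE_dE, hl.dE_eq_zero (by omega), smul_zero]
  refine ⟨wt, low, ?_, ?_⟩
  · refine t.eq_zero_of_adF_pow (N := a + 1 + (b + 1)) (p := c + 2)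
      ((wt.adE_pow _).cast (by push_cast; ring)) ?_ ?_
    · rw [← Module.End.mul_apply, ← pow_add, adE_pow_eq, dEz _ (by omega), smul_zero]
    · rw [pow_succ, Module.End.mul_apply, t.adF_adE_pow wt, low]
      simp [br_zero]
  · rw [hy, map_sum]
    have e1 : ∀ j ∈ Finset.range (p + 1), t.dE c (eta v (v ^ (a : ℤ)) (v ^ (b : ℤ)) p j •
        (t.dE j x * t.dE (p - j) l)) = ∑ i ∈ Finset.range (p + 1),
        (eta v (v ^ (a : ℤ)) (v ^ (b : ℤ)) p j * zeta v (v ^ (a : ℤ)) (v ^ (b : ℤ)) p i j) •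
          (t.dF i X * t.dF (p - i) L) := by
      intro j hj
      rw [Finset.mem_range] at hj
      rw [map_smul, dE_mul_string hx hl (show j + (p - j) = p by omega) hpa hpb (by omega),
        Finset.smul_sum]
      refine Finset.sum_congr rfl fun i hi => ?_
      rw [Finset.mem_range] at hi
      rw [smul_smul, hx.dF_top (by omega), hl.dF_top (by omega)]
    rw [Finset.sum_congr rfl e1, Finset.sum_comm]
    have e2 := top_identity (show p ≤ 3 by omega) (t.isString hx.wt_top) (t.isString hl.wt_top) h0
      t.sq_sub_ne t.sq_add_ne t.quartic_ne
    simp only [← Finset.sum_smul]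
    rw [← e2]
    refine Finset.sum_congr rfl fun j hj => ?_
    rw [Finset.mem_range] at hj
    rw [t.flip_dE_eq_tau hx.wt_top (by omega), t.flip_dE_eq_tau hl.wt_top (by omega)]

end QTriple

/-! ### Products of strings -/

/-- The scalar that relates the lowest weight vectors `∑ⱼ ηⱼ (ad E)⁽ʲ⁾x · (ad E)⁽ᵖ⁻ʲ⁾l` to
`x · (ad E)⁽ᵖ⁾l` modulo products of lower depth. -/
theorem eta_kappa_sum {v a b : ℂ} {p : ℕ} (hp : p ≤ 3) (ha : a ≠ 0) (hb : b ≠ 0) (h0 : v ≠ 0)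
    (hd : v ^ 2 - 1 ≠ 0) (h2 : v ^ 2 + 1 ≠ 0) (h3 : v ^ 4 + v ^ 2 + 1 ≠ 0) :
    ∑ j ∈ Finset.range (p + 1), eta v a b p j * ((-1) ^ j * (a⁻¹ ^ j * v ^ (j * (j - 1))) *
      (qFact v p / (qFact v j * qFact v (p - j)))) =
    b⁻¹ ^ p * v ^ (p * (p - 1)) * ∏ s ∈ Finset.range p,
      ((a * b * v ^ (2 + s) * (v ^ (2 * p))⁻¹ - (a * b * v ^ (2 + s) * (v ^ (2 * p))⁻¹)⁻¹) /
        (v - v⁻¹)) := by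
  have hd' : v - v⁻¹ ≠ 0 := by
    intro h; apply hd; field_simp at h; linear_combination h
  have h3' : v ^ 2 * (v ^ 2 + 1) + 1 ≠ 0 := by
    intro h; apply h3; linear_combination h
  have hf1 : qFact v 1 = 1 := by simp [qFact, qInt_eq_br, br, hd']
  have hf2 : qFact v 2 = v + v⁻¹ := by
    rw [qFact_succ, hf1, one_mul]; exact br_ofNat_two h0 hd
  have hf3 : qFact v 3 = (v + v⁻¹) * (v ^ 2 + 1 + v⁻¹ ^ 2) := by
    rw [qFact_succ, hf2]; congr 1; exact br_ofNat_three h0 hd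
  interval_cases p
  · simp [eta, qFact_zero]
  · simp only [Finset.sum_range_succ, Finset.sum_range_zero, eta, Finset.prod_range_succ,
      Finset.prod_range_zero, qFact_zero, hf1, mbr]
    norm_num [qFact_zero]
    field_simp
    ring
  · simp only [Finset.sum_range_succ, Finset.sum_range_zero, eta, Finset.prod_range_succ,
      Finset.prod_range_zero, qFact_zero, hf1, hf2, mbr]
    norm_num [qFact_zero]
    field_simp
    ring
  · simp only [Finset.sum_range_succ, Finset.sum_range_zero, eta, Finset.prod_range_succ,
      Finset.prod_range_zero, qFact_zero, hf1, hf2, hf3, mbr]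
    norm_num [qFact_zero]
    field_simp
    ring

namespace QTriple

variable {A : Type*} [Ring A] [Algebra ℂ A] {v : ℂ} {t : QTriple A v}

theorem adE_dE_mul_dE (t : QTriple A v) {a : ℤ} {x : A} (hx : t.Wt (-a) x) (l : A) (i j : ℕ) :
    t.adE (t.dE i x * t.dE j l) = br v (i + 1 : ℕ) • (t.dE (i + 1) x * t.dE j l) +
      (v ^ (-a + 2 * i) * br v (j + 1 : ℕ)) • (t.dE i x * t.dE (j + 1) l) := by
  rw [t.adE_mul (hx.dE i), adE_dE, adE_dE, smul_mul_assoc, mul_smul_comm, smul_smul]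

namespace InG

variable {ν : ℤ} {x X y Y : A}

theorem cast {μ : ℤ} (h : t.InG ν x X) (e : ν = μ) : t.InG μ x X := e ▸ h

theorem wt (h : t.InG ν x X) : t.Wt ν x := by
  induction h with
  | good h k hν => exact (h.wt.dE k).cast (by omega)
  | zero => exact Wt.zero
  | add _ _ h1 h2 => exact h1.add h2

theorem flip_wt (h : t.InG ν x X) : t.flip.Wt ν X := by
  induction h with
  | good h k hν => exact (h.flip_wt.dE k).cast (by omega)
  | zero => exact Wt.zero
  | add _ _ h1 h2 => exact h1.add h2

theorem smul (h : t.InG ν x X) (c : ℂ) : t.InG ν (c • x) (c • X) := by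
  induction h with
  | good h k hν => rw [← map_smul, ← map_smul]; exact .good (h.smul c) k hν
  | zero => rw [smul_zero]; exact .zero _
  | add _ _ h1 h2 => rw [smul_add, smul_add]; exact h1.add h2

theorem sub (h : t.InG ν x X) (h' : t.InG ν y Y) : t.InG ν (x - y) (X - Y) := by
  rw [sub_eq_add_neg, sub_eq_add_neg, ← neg_one_smul ℂ, ← neg_one_smul ℂ Y]
  exact h.add (h'.smul _)

theorem sum {ι : Type*} (s : Finset ι) {f g : ι → A} (h : ∀ i ∈ s, t.InG ν (f i) (g i)) :
    t.InG ν (∑ i ∈ s, f i) (∑ i ∈ s, g i) := by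
  classical
  induction s using Finset.induction_on with
  | empty => simpa using InG.zero ν
  | insert i s hi ih =>
    rw [Finset.sum_insert hi, Finset.sum_insert hi]
    exact (h i (Finset.mem_insert_self _ _)).add
      (ih fun j hj => h j (Finset.mem_insert_of_mem hj))

theorem of_smul {c : ℂ} (hc : c ≠ 0) (h : t.InG ν (c • x) (c • X)) : t.InG ν x X := by
  have := h.smul c⁻¹
  rwa [smul_smul, smul_smul, inv_mul_cancel₀ hc, one_smul, one_smul] at this

theorem adE (h : t.InG ν x X) : t.InG (ν + 2) (t.adE x) (t.flip.adE X) := by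
  induction h with
  | good h k hν =>
    rw [adE_dE, adE_dE]
    exact (InG.good h (k + 1) (by push_cast; omega)).smul _
  | zero => rw [map_zero, map_zero]; exact .zero _
  | add _ _ h1 h2 => rw [map_add, map_add]; exact h1.add h2

end InG

/-- Moving divided powers from the first to the second factor of a product, modulo products of
lower depth. -/
theorem InG.dE_mul_dE_congr {a b : ℕ} {x X l L : A} (hx : t.Good a x X) {p : ℕ}
    (ih : ∀ m < p, t.InG (2 * m - b - a) (x * t.dE m l) (X * t.flip.dE m L)) (i : ℕ) :
    ∀ j, i + j ≤ p →
      t.InG (2 * (i + j : ℕ) - b - a)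
        (t.dE i x * t.dE j l - ((-1) ^ i * ((v ^ (a : ℤ))⁻¹ ^ i * v ^ (i * (i - 1))) *
          (qFact v (i + j) / (qFact v i * qFact v j))) • (x * t.dE (i + j) l))
        (t.flip.dE i X * t.flip.dE j L - ((-1) ^ i * ((v ^ (a : ℤ))⁻¹ ^ i * v ^ (i * (i - 1))) *
          (qFact v (i + j) / (qFact v i * qFact v j))) • (X * t.flip.dE (i + j) L)) := by
  induction i with
  | zero =>
    intro j hj
    simp only [zero_add, pow_zero, zero_mul, one_mul, qFact_zero, div_self (t.qFact_ne_zero j),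
      one_smul, QTriple.dE_zero, sub_self]
    exact .zero _
  | succ i ihi =>
    intro j hj
    have hb1 := t.br_ne_zero (n := (i + 1 : ℕ)) (by omega)
    have hb2 := t.br_ne_zero (n := (j + 1 : ℕ)) (by omega)
    have h0 := t.v_ne
    -- the product `(ad E)⁽ⁱ⁾x · (ad E)⁽ʲ⁾l` has depth `i + j < p`
    have h1 : t.InG (2 * (i + j : ℕ) - b - a) (t.dE i x * t.dE j l)
        (t.flip.dE i X * t.flip.dE j L) := by
      have := (ihi j (by omega)).add ((ih (i + j) (by omega)).smul
        ((-1) ^ i * ((v ^ (a : ℤ))⁻¹ ^ i * v ^ (i * (i - 1))) *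
          (qFact v (i + j) / (qFact v i * qFact v j))))
      rwa [sub_add_cancel, sub_add_cancel] at this
    have h2 := h1.adE
    rw [t.adE_dE_mul_dE hx.wt, t.flip.adE_dE_mul_dE hx.flip_wt] at h2
    have h3 := ihi (j + 1) (by omega)
    have h4 : (2 * (i + j : ℕ) - b - a : ℤ) + 2 = 2 * (i + 1 + j : ℕ) - b - a := by push_cast; ring
    have h5 : (2 * (i + (j + 1) : ℕ) - b - a : ℤ) = 2 * (i + 1 + j : ℕ) - b - a := by
      push_cast; ring
    rw [h4] at h2
    rw [h5] at h3
    have h6 := ((h2.sub (h3.smul (v ^ (-(a : ℤ) + 2 * i) * br v (j + 1 : ℕ)))).smul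
      (br v (i + 1 : ℕ))⁻¹)
    have e1 : i + (j + 1) = i + 1 + j := by ring
    have hc : (br v (i + 1 : ℕ))⁻¹ * ((v ^ (-(a : ℤ) + 2 * i) * br v (j + 1 : ℕ)) *
        ((-1) ^ i * ((v ^ (a : ℤ))⁻¹ ^ i * v ^ (i * (i - 1))) *
          (qFact v (i + (j + 1)) / (qFact v i * qFact v (j + 1))))) =
        -((-1) ^ (i + 1) * ((v ^ (a : ℤ))⁻¹ ^ (i + 1) * v ^ ((i + 1) * (i + 1 - 1))) *
          (qFact v (i + 1 + j) / (qFact v (i + 1) * qFact v j))) := by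
      have g1 := t.qFact_ne_zero i
      have g2 := t.qFact_ne_zero j
      have e2 : (i + 1) * (i + 1 - 1) = i * (i - 1) + 2 * i := by
        rcases i with _ | i
        · rfl
        · simp only [Nat.add_sub_cancel]; ring
      rw [e1, qFact_succ v i, qFact_succ v j, zpow_add₀ h0, zpow_neg, e2,
        show v ^ (2 * (i : ℤ)) = v ^ (2 * i) by norm_cast, pow_add v]
      push_cast
      push_cast at hb1 hb2
      have hva := zpow_ne_zero (a : ℤ) h0
      generalize v ^ (a : ℤ) = a' at hva ⊢
      rw [pow_succ a'⁻¹ i]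
      generalize a'⁻¹ ^ i = w
      field_simp
      ring
    rw [e1] at hc
    convert h6 using 1
    · simp only [smul_sub, smul_add, smul_smul, inv_mul_cancel₀ hb1, one_smul, e1, hc]
      module
    · simp only [smul_sub, smul_add, smul_smul, inv_mul_cancel₀ hb1, one_smul, e1, hc]
      module

/-- A string of length at most `4` times a string is a sum of strings: the key step is that the
lowest weight vectors `∑ⱼ ηⱼ (ad E)⁽ʲ⁾x · (ad E)⁽ᵖ⁻ʲ⁾l` are nonzero multiples of `x · (ad E)⁽ᵖ⁾l`
modulo products of lower depth. -/
theorem InG.mul_dE {a b : ℕ} {x X l L : A} (hx : t.Good a x X) (ha : a ≤ 3) (hl : t.Good b l L)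
    (p : ℕ) : t.InG (2 * p - b - a) (x * t.dE p l) (X * t.flip.dE p L) := by
  have h0 := t.v_ne
  induction p using Nat.strong_induction_on with
  | _ p ih =>
  rcases lt_or_ge b p with hb | hb
  · rw [hl.dE_eq_zero hb, hl.flip_dE_eq_zero hb, mul_zero, mul_zero]; exact .zero _
  rcases lt_or_ge a p with hpa | hpa
  -- beyond the end of the string of `x`, moving all of the divided power to `x` gives zero
  · have h := InG.dE_mul_dE_congr hx (l := l) (L := L) ih p 0 (by omega)
    rw [hx.dE_eq_zero hpa, hx.flip_dE_eq_zero hpa, zero_mul, zero_mul, zero_sub, zero_sub,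
      ← neg_smul, ← neg_smul] at h
    refine InG.of_smul (neg_ne_zero.mpr ?_) h
    have := t.qFact_ne_zero p
    rw [add_zero, qFact_zero, mul_one, div_self this, mul_one]
    exact mul_ne_zero (pow_ne_zero _ (by norm_num))
      (mul_ne_zero (pow_ne_zero _ (inv_ne_zero (zpow_ne_zero _ h0))) (pow_ne_zero _ h0))
  · have hy : t.InG (2 * p - b - a) _ _ := (QTriple.InG.good (hx.combine hl ha hpa hb) 0
      (by push_cast; omega))
    rw [QTriple.dE_zero, QTriple.dE_zero] at hy
    have hs := InG.sum (Finset.range (p + 1)) fun j hj =>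
      ((InG.dE_mul_dE_congr hx (l := l) (L := L) ih j (p - j)
        (by rw [Finset.mem_range] at hj; omega)).cast (show _ = (2 * p - b - a : ℤ) by
          rw [Finset.mem_range] at hj
          rw [show j + (p - j) = p by omega])).smul (eta v (v ^ (a : ℤ)) (v ^ (b : ℤ)) p j)
    have h := hy.sub hs
    have e : ∀ (u : QTriple A v) (y m : A),
        ∑ j ∈ Finset.range (p + 1), eta v (v ^ (a : ℤ)) (v ^ (b : ℤ)) p j •
          (u.dE j y * u.dE (p - j) m) -
        ∑ j ∈ Finset.range (p + 1), eta v (v ^ (a : ℤ)) (v ^ (b : ℤ)) p j •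
          (u.dE j y * u.dE (p - j) m - ((-1) ^ j * ((v ^ (a : ℤ))⁻¹ ^ j * v ^ (j * (j - 1))) *
            (qFact v (j + (p - j)) / (qFact v j * qFact v (p - j)))) •
              (y * u.dE (j + (p - j)) m)) =
        (∑ j ∈ Finset.range (p + 1), eta v (v ^ (a : ℤ)) (v ^ (b : ℤ)) p j *
          ((-1) ^ j * ((v ^ (a : ℤ))⁻¹ ^ j * v ^ (j * (j - 1))) *
            (qFact v p / (qFact v j * qFact v (p - j))))) • (y * u.dE p m) := by
      intro u y m
      rw [← Finset.sum_sub_distrib, Finset.sum_smul]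
      refine Finset.sum_congr rfl fun j hj => ?_
      rw [Finset.mem_range] at hj
      rw [show j + (p - j) = p by omega, smul_sub, sub_sub_cancel, smul_smul]
    rw [e t x l, e t.flip X L, eta_kappa_sum (by omega) (zpow_ne_zero _ h0) (zpow_ne_zero _ h0) h0
      t.sq_sub_ne t.sq_add_ne t.quartic_ne] at h
    refine InG.of_smul (mul_ne_zero (mul_ne_zero (pow_ne_zero _ (inv_ne_zero (zpow_ne_zero _ h0)))
      (pow_ne_zero _ h0)) (Finset.prod_ne_zero_iff.mpr fun s _ => ?_)) h
    have e2 : v ^ (a : ℤ) * v ^ (b : ℤ) * v ^ (2 + s) * (v ^ (2 * p))⁻¹ =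
        v ^ ((a : ℤ) + b + 2 + s - 2 * p) := by
      rw [← zpow_natCast v (2 + s), ← zpow_natCast v (2 * p), ← zpow_neg, ← zpow_add₀ h0,
        ← zpow_add₀ h0, ← zpow_add₀ h0]
      congr 1; push_cast; ring
    rw [e2, ← zpow_neg]
    exact t.br_ne_zero (by omega)

theorem InG.good_mul {a : ℕ} {x X y Y : A} {ν : ℤ} (hx : t.Good a x X) (ha : a ≤ 3)
    (h : t.InG ν y Y) : t.InG (ν - a) (x * y) (X * Y) := by
  induction h with
  | good hl k hν => exact (InG.mul_dE hx ha hl k).cast (by omega)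
  | zero => rw [mul_zero, mul_zero]; exact .zero _
  | add _ _ h1 h2 => rw [mul_add, mul_add]; exact h1.add h2

/-- The sums of strings form a left module over the algebra generated by strings of length at most
`4`; for the vectors of a string this follows from the case of its lower end, as `ad E` acts on
products by a Leibniz rule. -/
theorem InG.dE_good_mul {a : ℕ} {x X : A} (hx : t.Good a x X) (ha : a ≤ 3) (k : ℕ) :
    ∀ {y Y : A} {ν : ℤ}, t.InG ν y Y →
      t.InG (ν + (2 * k - a)) (t.dE k x * y) (t.flip.dE k X * Y) := by
  induction k with
  | zero => intro y Y ν h; simpa [QTriple.dE_zero, sub_eq_add_neg] using h.good_mul hx ha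
  | succ k ih =>
    intro y Y ν h
    have h1 := ((ih h).adE).sub (((ih h.adE).cast (by ring)).smul (v ^ (-(a : ℤ) + 2 * k)))
    rw [t.adE_mul (hx.wt.dE k), t.flip.adE_mul (hx.flip_wt.dE k), add_sub_cancel_right,
      add_sub_cancel_right, adE_dE, adE_dE, smul_mul_assoc, smul_mul_assoc] at h1
    exact (InG.of_smul (t.br_ne_zero (by omega)) h1).cast (by push_cast; ring)

/-! ### Recovering the second component of a pair -/

theorem Good.adF_pow_dE {b : ℕ} {l L : A} (h : t.Good b l L) (k : ℕ) :
    ∃ c : ℂ, (k ≤ b → c ≠ 0) ∧ (t.adF ^ k) (t.dE k l) = c • l := by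
  induction k with
  | zero => exact ⟨1, fun _ => one_ne_zero, by simp [dE_zero]⟩
  | succ k ih =>
    obtain ⟨c, hc, h1⟩ := ih
    refine ⟨br v (b - k) * c, fun hk => mul_ne_zero (t.br_ne_zero (by omega)) (hc (by omega)), ?_⟩
    rw [pow_succ, Module.End.mul_apply, t.adF_dE h.wt h.low, map_smul, h1, smul_smul]

theorem Good.adF_pow_dE_eq_zero {b : ℕ} {l L : A} (h : t.Good b l L) {k m : ℕ} (hk : k < m) :
    (t.adF ^ m) (t.dE k l) = 0 := by
  obtain ⟨n, rfl⟩ := Nat.exists_eq_add_of_le (show k + 1 ≤ m from hk)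
  obtain ⟨c, -, h1⟩ := h.adF_pow_dE k
  rw [add_comm, pow_add, Module.End.mul_apply, pow_succ', Module.End.mul_apply, h1, map_smul, h.low,
    smul_zero, map_zero]

variable (t) in
/-- The ends `l`, `L` of the string that contributes its `k`-th vector to an element of
weight `ν`. -/
def IsTerm (ν : ℤ) (k : ℕ) (l L : A) : Prop :=
  (∃ b : ℕ, k ≤ b ∧ ν = 2 * k - b ∧ t.Good b l L) ∨ (l = 0 ∧ L = 0)

theorem IsTerm.add {ν : ℤ} {k : ℕ} {l L m M : A} (h : t.IsTerm ν k l L) (h' : t.IsTerm ν k m M) :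
    t.IsTerm ν k (l + m) (L + M) := by
  rcases h with ⟨b, hb, hν, h⟩ | ⟨rfl, rfl⟩
  · rcases h' with ⟨b', hb', hν', h'⟩ | ⟨rfl, rfl⟩
    · obtain rfl : b = b' := by omega
      exact Or.inl ⟨b, hb, hν, h.add h'⟩
    · rw [add_zero, add_zero]; exact Or.inl ⟨b, hb, hν, h⟩
  · rwa [zero_add, zero_add]

theorem IsTerm.eq_zero {ν : ℤ} {k : ℕ} {l L : A} (h : t.IsTerm ν k l L) (hl : l = 0) : L = 0 := by
  rcases h with ⟨b, hb, hν, h⟩ | ⟨-, h⟩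
  · rw [h.top, hl, map_zero]
  · exact h

theorem IsTerm.adF_pow_eq_zero {ν : ℤ} {k m : ℕ} {l L : A} (h : t.IsTerm ν k l L) (hk : k < m) :
    (t.adF ^ m) (t.dE k l) = 0 := by
  rcases h with ⟨b, hb, hν, h⟩ | ⟨rfl, -⟩
  · exact h.adF_pow_dE_eq_zero hk
  · rw [map_zero, map_zero]

theorem IsTerm.eq_zero_of_adF_pow {ν : ℤ} {k : ℕ} {l L : A} (h : t.IsTerm ν k l L)
    (h' : (t.adF ^ k) (t.dE k l) = 0) : l = 0 := by
  rcases h with ⟨b, hb, hν, h⟩ | ⟨rfl, -⟩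
  · obtain ⟨c, hc, h1⟩ := h.adF_pow_dE k
    rw [h1] at h'
    exact (smul_eq_zero.mp h').resolve_left (hc hb)
  · rfl

/-- An element of `InG` is a sum of one vector for each `k`, the `k`-th vector of a string; the
terms with the same `k` and the same weight belong to strings of the same length and can be added.
-/
theorem InG.exists_terms {ν : ℤ} {x X : A} (h : t.InG ν x X) :
    ∃ (n : ℕ) (l L : ℕ → A), (∀ k, t.IsTerm ν k (l k) (L k)) ∧ ∀ N ≥ n,
      x = ∑ k ∈ Finset.range N, t.dE k (l k) ∧ X = ∑ k ∈ Finset.range N, t.flip.dE k (L k) := by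
  induction h with
  | @good b l L h k ν hν =>
    rcases le_or_gt k b with hk | hk
    · refine ⟨k + 1, Pi.single k l, Pi.single k L, fun j => ?_, fun N hN => ⟨?_, ?_⟩⟩
      · rcases eq_or_ne j k with rfl | hj
        · simp only [Pi.single_eq_same]; exact Or.inl ⟨b, hk, hν, h⟩
        · exact Or.inr ⟨by simp [hj], by simp [hj]⟩
      · rw [Finset.sum_eq_single k, Pi.single_eq_same]
        · intro j _ hj; simp [hj]
        · intro h; rw [Finset.mem_range] at h; omega
      · rw [Finset.sum_eq_single k, Pi.single_eq_same]
        · intro j _ hj; simp [hj]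
        · intro h; rw [Finset.mem_range] at h; omega
    · refine ⟨0, 0, 0, fun j => Or.inr ⟨rfl, rfl⟩, fun N _ => ?_⟩
      rw [h.dE_eq_zero hk, h.flip_dE_eq_zero hk]
      simp
  | zero => exact ⟨0, 0, 0, fun j => Or.inr ⟨rfl, rfl⟩, fun N _ => by simp⟩
  | add _ _ h1 h2 =>
    obtain ⟨n, l, L, h1, h1'⟩ := h1
    obtain ⟨m, l', L', h2, h2'⟩ := h2
    refine ⟨max n m, l + l', L + L', fun k => (h1 k).add (h2 k), fun N hN => ?_⟩
    rw [(h1' N (by omega)).1, (h1' N (by omega)).2, (h2' N (by omega)).1, (h2' N (by omega)).2]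
    simp [Finset.sum_add_distrib]

theorem adF_pow_sum_terms {ν : ℤ} {l L : ℕ → A} (h : ∀ k, t.IsTerm ν k (l k) (L k)) (N : ℕ) :
    (t.adF ^ N) (∑ k ∈ Finset.range (N + 1), t.dE k (l k)) = (t.adF ^ N) (t.dE N (l N)) := by
  rw [Finset.sum_range_succ, map_add, map_sum, Finset.sum_eq_zero, zero_add]
  intro k hk
  exact (h k).adF_pow_eq_zero (Finset.mem_range.mp hk)

/-- The first component determines the second one: the highest power of `ad F` that does not kill
the first component isolates the lower end of its last string. -/
theorem InG.eq_zero {ν : ℤ} {x X : A} (h : t.InG ν x X) (hx : x = 0) : X = 0 := by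
  obtain ⟨n, l, L, h1, h2⟩ := h.exists_terms
  obtain ⟨hx', hX'⟩ := h2 n le_rfl
  rw [hX']
  rw [hx] at hx'
  clear h2 hX'
  induction n with
  | zero => simp
  | succ n ih =>
    have h3 : l n = 0 := by
      refine (h1 n).eq_zero_of_adF_pow ?_
      rw [← adF_pow_sum_terms h1, ← hx', map_zero]
    rw [Finset.sum_range_succ, (h1 n).eq_zero h3, map_zero, add_zero]
    refine ih ?_
    rw [hx', Finset.sum_range_succ, h3, map_zero, add_zero]

/-- A sum of strings that is a lowest weight vector is the lower end of a string. -/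
theorem InG.good_of_low {c : ℕ} {x X : A} (h : t.InG (-c) x X) (hx : t.adF x = 0) :
    t.Good c x X := by
  obtain ⟨n, l, L, h1, h2⟩ := h.exists_terms
  obtain ⟨hx', hX'⟩ := h2 (n + 1) (by omega)
  clear h2
  induction n generalizing x X with
  | zero =>
    simp only [zero_add, Finset.range_one, Finset.sum_singleton, dE_zero] at hx' hX'
    rw [hx', hX']
    rcases h1 0 with ⟨b, hb, hν, h3⟩ | ⟨e1, e2⟩
    · obtain rfl : b = c := by push_cast at hν; omega
      exact h3
    · rw [e1, e2]
      exact ⟨Wt.zero, map_zero _, map_zero _, (map_zero _).symm⟩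
  | succ n ih =>
    have h3 : l (n + 1) = 0 := by
      refine (h1 (n + 1)).eq_zero_of_adF_pow ?_
      rw [← adF_pow_sum_terms h1, ← hx', pow_succ, Module.End.mul_apply, hx, map_zero]
    rw [Finset.sum_range_succ, h3, map_zero, add_zero] at hx'
    rw [Finset.sum_range_succ, (h1 (n + 1)).eq_zero h3, map_zero, add_zero] at hX'
    exact ih h hx hx' hX'

end QTriple

/-! ### Commutators of two strings -/

namespace QTriple

variable {A : Type*} [Ring A] [Algebra ℂ A] {v : ℂ} (t : QTriple A v)

theorem K_F_pow (m : ℕ) : t.K * t.F ^ m = (v ^ (-2 * m : ℤ)) • (t.F ^ m * t.K) := by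
  induction m with
  | zero => simp
  | succ m ih =>
    rw [pow_succ, ← mul_assoc, ih, smul_mul_assoc, mul_assoc, t.KF, mul_smul_comm, smul_smul,
      ← zpow_add₀ t.v_ne, mul_assoc]
    congr 2; push_cast; ring

theorem L_F_pow (m : ℕ) : t.L * t.F ^ m = (v ^ (2 * m : ℤ)) • (t.F ^ m * t.L) := by
  have h : t.Wt (-2 * m) (t.F ^ m) := t.K_F_pow m
  rw [h.L_mul]; congr 2; ring

/-- The commutator of `E` with a power of `F`. -/
theorem E_F_pow (m : ℕ) : t.E * t.F ^ (m + 1) - t.F ^ (m + 1) * t.E =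
    (br v (m + 1 : ℕ) / (v - v⁻¹)) • (t.F ^ m * (v ^ (-m : ℤ) • t.K - v ^ (m : ℤ) • t.L)) := by
  induction m with
  | zero => simp [t.EF, t.br_one]
  | succ m ih =>
    have e : t.E * t.F ^ (m + 1 + 1) - t.F ^ (m + 1 + 1) * t.E =
        (t.E * t.F - t.F * t.E) * t.F ^ (m + 1) +
          t.F * (t.E * t.F ^ (m + 1) - t.F ^ (m + 1) * t.E) := by
      rw [pow_succ' _ (m + 1)]; noncomm_ring
    rw [e, ih, t.EF, smul_mul_assoc, sub_mul, t.K_F_pow, t.L_F_pow, mul_smul_comm, ← mul_assoc,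
      ← pow_succ', mul_sub, mul_sub, mul_smul_comm, mul_smul_comm, mul_smul_comm, mul_smul_comm]
    have h0 := t.v_ne
    have hd := t.den_ne
    have h1 := zpow_ne_zero (m : ℤ) h0
    simp only [br, Nat.cast_add, Nat.cast_one, zpow_neg, zpow_add₀ h0, mul_add,
      neg_mul, neg_add, zpow_ofNat, two_mul]
    have hd2 : v ^ 2 - 1 ≠ 0 := t.sq_sub_ne
    generalize v ^ (m : ℤ) = w at h1 ⊢
    match_scalars <;> field_simp <;> ring

section Commutator

-- `x` is the lower end of a string for the triple, `y` that of a string for the swapped triple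

variable {a : ℕ} {x y P R : A} {κ : ℂ}

theorem E_comm_swap_adE {b : ℤ} (hy : t.swap.Wt (-b) y) (hEy : t.E * y = y * t.E) (l : ℕ) :
    t.E * (t.swap.adE ^ (l + 1)) y - (t.swap.adE ^ (l + 1)) y * t.E =
      (br v (l + 1 : ℕ) * br v (b - l)) • ((t.swap.adE ^ l) y * t.K) := by
  have h1 : t.swap.adF y = 0 := by
    rw [adF_def]; change (t.E * y - y * t.E) * t.L = 0
    rw [hEy, sub_self, zero_mul]
  have h := t.swap.adF_adE_pow hy l
  rw [h1, map_zero, zero_sub, adF_def] at h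
  change (t.E * _ - _ * t.E) * t.L = _ at h
  have h2 := congrArg (· * t.K) h
  simp only [mul_assoc _ t.L t.K, t.LK, mul_one] at h2
  rw [h2, neg_mul, smul_mul_assoc, ← neg_smul, show -b + (l : ℤ) = -(b - l) by ring, br_neg]
  congr 1; ring

/-- The recursion for the commutators of the vectors of two strings. -/
theorem comm_step {b : ℤ} (hx : t.Wt (-a) x) (hy : t.swap.Wt (-b) y) (hEy : t.E * y = y * t.E)
    (k l : ℕ) :
    (t.adE ^ (k + 1)) x * (t.swap.adE ^ (l + 1)) y -
        (t.swap.adE ^ (l + 1)) y * (t.adE ^ (k + 1)) x =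
      t.E * ((t.adE ^ k) x * (t.swap.adE ^ (l + 1)) y -
        (t.swap.adE ^ (l + 1)) y * (t.adE ^ k) x) -
      v ^ (-a + 2 * k : ℤ) • (((t.adE ^ k) x * (t.swap.adE ^ (l + 1)) y -
        (t.swap.adE ^ (l + 1)) y * (t.adE ^ k) x) * t.E) -
      (v ^ (-a + 2 * k : ℤ) * (br v (l + 1 : ℕ) * br v (b - l))) •
        (((t.adE ^ k) x * (t.swap.adE ^ l) y - (t.swap.adE ^ l) y * (t.adE ^ k) x) * t.K) := by
  have hz := hx.adE_pow k
  have hK : t.K * (t.adE ^ k) x = v ^ (-a + 2 * k : ℤ) • ((t.adE ^ k) x * t.K) := hz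
  have h1 := t.E_comm_swap_adE hy hEy l
  rw [pow_succ' t.adE, Module.End.mul_apply, hz.adE_eq]
  generalize (t.adE ^ k) x = Z at *
  generalize (t.swap.adE ^ (l + 1)) y = W at *
  generalize (t.swap.adE ^ l) y = W' at *
  generalize v ^ (-a + 2 * k : ℤ) = s at *
  have e1 : (t.E * Z - s • (Z * t.E)) * W - W * (t.E * Z - s • (Z * t.E)) =
      t.E * (Z * W - W * Z) - s • ((Z * W - W * Z) * t.E) + ((t.E * W - W * t.E) * Z -
        s • (Z * (t.E * W - W * t.E))) := by
    simp only [mul_sub, sub_mul, smul_mul_assoc, mul_smul_comm, smul_sub, mul_assoc]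
    abel
  rw [e1, h1, smul_mul_assoc, mul_assoc W', hK, mul_smul_comm, mul_smul_comm, sub_mul]
  simp only [sub_mul, mul_assoc, smul_sub, smul_smul]
  module

theorem comm_step_zero (hx : t.Wt (-a) x) (hEy : t.E * y = y * t.E)
    (k : ℕ) :
    (t.adE ^ (k + 1)) x * y - y * (t.adE ^ (k + 1)) x =
      t.E * ((t.adE ^ k) x * y - y * (t.adE ^ k) x) -
      v ^ (-a + 2 * k : ℤ) • (((t.adE ^ k) x * y - y * (t.adE ^ k) x) * t.E) := by
  rw [pow_succ' t.adE, Module.End.mul_apply, (hx.adE_pow k).adE_eq]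
  generalize (t.adE ^ k) x = Z at *
  have h : ∀ w, y * (t.E * w) = t.E * (y * w) := fun w => by
    rw [← mul_assoc, ← hEy, mul_assoc]
  simp only [mul_sub, sub_mul, smul_mul_assoc, mul_smul_comm, smul_sub, mul_assoc, h, hEy]
  abel

theorem comm_base {b : ℤ} (hy : t.swap.Wt (-b) y) (hFx : t.F * x = x * t.F) (l : ℕ) :
    x * (t.swap.adE ^ (l + 1)) y - (t.swap.adE ^ (l + 1)) y * x =
      t.F * (x * (t.swap.adE ^ l) y - (t.swap.adE ^ l) y * x) -
      v ^ (-b + 2 * l : ℤ) • ((x * (t.swap.adE ^ l) y - (t.swap.adE ^ l) y * x) * t.F) := by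
  rw [pow_succ' t.swap.adE, Module.End.mul_apply, (hy.adE_pow l).adE_eq]
  generalize (t.swap.adE ^ l) y = W at *
  change x * (t.F * W - _ • (W * t.F)) - (t.F * W - _ • (W * t.F)) * x = _
  have h : ∀ w, x * (t.F * w) = t.F * (x * w) := fun w => by
    rw [← mul_assoc, ← hFx, mul_assoc]
  simp only [mul_sub, sub_mul, smul_mul_assoc, mul_smul_comm, smul_sub, mul_assoc, h, hFx]
  abel

/-- The strings of commuting vectors commute. -/
theorem comm_eq_zero {b : ℤ} (hx : t.Wt (-a) x) (hy : t.swap.Wt (-b) y)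
    (hFx : t.F * x = x * t.F) (hEy : t.E * y = y * t.E) (hxy : x * y - y * x = 0) (k : ℕ) :
    ∀ l, (t.adE ^ k) x * (t.swap.adE ^ l) y - (t.swap.adE ^ l) y * (t.adE ^ k) x = 0 := by
  induction k with
  | zero =>
    intro l
    induction l with
    | zero => simpa using hxy
    | succ l ih =>
      simp only [pow_zero, Module.End.one_apply] at ih ⊢
      rw [t.comm_base hy hFx, ih]; simp
  | succ k ih =>
    rintro (_ | l)
    · have := ih 0
      simp only [pow_zero, Module.End.one_apply] at this ⊢
      rw [t.comm_step_zero hx hEy, this]; simp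
    · rw [t.comm_step hx hy hEy, ih, ih]; simp

/-- The scalars in the commutators of the vectors of the strings of `E_r` and `F_r`. -/
def commCoeff (v κ : ℂ) (a : ℕ) (k l : ℕ) : ℂ :=
  -κ * (∏ i ∈ Finset.range l, (1 - v ^ (-2 * a + 2 * i : ℤ))) *
    ∏ i ∈ Finset.range k, (-(br v (l - i) * v ^ (l - i - 1 : ℤ) / (v - v⁻¹)))

theorem commCoeff_succ (k l : ℕ) : commCoeff v κ a (k + 1) l =
    -(commCoeff v κ a k l * (br v (l - k) * v ^ (l - k - 1 : ℤ) / (v - v⁻¹))) := by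
  rw [commCoeff, Finset.prod_range_succ, commCoeff]; ring

include t in
theorem commCoeff_rel (k l : ℕ) : commCoeff v κ a k (l + 1) * (br v (l + 1 - k) / (v - v⁻¹)) =
    v ^ (-a + k + l : ℤ) * (br v (l + 1 : ℕ) * br v (a - l)) * commCoeff v κ a k l := by
  have h0 := t.v_ne
  have hd := t.den_ne
  induction k with
  | zero =>
    have : (1 - v ^ (-2 * a + 2 * l : ℤ)) / (v - v⁻¹) = v ^ (-a + l : ℤ) * br v (a - l) := by
      rw [br, ← mul_div_assoc, mul_sub, ← zpow_add₀ h0, ← zpow_add₀ h0]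
      congr 2
      · rw [show (-a + l + (a - l) : ℤ) = 0 by ring, zpow_zero]
      · congr 1; ring
    simp only [commCoeff, Finset.prod_range_succ, Finset.range_zero, Finset.prod_empty]
    push_cast
    rw [add_zero, sub_zero]
    linear_combination (-κ * (∏ i ∈ Finset.range l, (1 - v ^ (-2 * a + 2 * i : ℤ))) *
      br v (l + 1)) * this
  | succ k ih =>
    rw [commCoeff_succ, commCoeff_succ]
    push_cast at ih ⊢
    have e1 : v ^ (-a + (k + 1) + l : ℤ) = v * v ^ (-a + k + l : ℤ) := by
      rw [← zpow_one_add₀ h0]; congr 1; ring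
    have e2 : v ^ (l + 1 - k - 1 : ℤ) = v * v ^ (l - k - 1 : ℤ) := by
      rw [← zpow_one_add₀ h0]; congr 1; ring
    rw [e1, e2, show (l + 1 - (k + 1) : ℤ) = l - k by ring]
    linear_combination (-(v * v ^ (l - k - 1 : ℤ) * br v (l - k) / (v - v⁻¹))) * ih

include t in
theorem commCoeff_self : commCoeff v κ a a a = -κ * (qFact v a ^ 2 * (-v)⁻¹ ^ a) := by
  have h0 := t.v_ne
  have hd := t.den_ne
  rw [commCoeff, mul_assoc, ← Finset.prod_mul_distrib]
  congr 1
  have e : qFact v a = ∏ i ∈ Finset.range a, br v (a - i) := by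
    have := qFact_add v 0 a
    simpa [qFact_zero] using this
  rw [e, ← Finset.prod_pow, show ((-v)⁻¹ ^ a : ℂ) = ∏ i ∈ Finset.range a, (-v)⁻¹ by simp,
    ← Finset.prod_mul_distrib]
  refine Finset.prod_congr rfl fun i _ => ?_
  have h1 := zpow_ne_zero (a - i : ℤ) h0
  rw [show (-2 * a + 2 * i : ℤ) = -(a - i) + -(a - i) by ring, zpow_add₀ h0, zpow_neg,
    zpow_sub_one₀ h0, br, zpow_neg]
  generalize v ^ (a - i : ℤ) = w at h1 ⊢
  have hd2 : v ^ 2 - 1 ≠ 0 := t.sq_sub_ne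
  field_simp

variable (hx : t.Wt (-a) x) (hy : t.swap.Wt (-a) y)
    (hFx : t.F * x = x * t.F) (hEy : t.E * y = y * t.E) (hxy : x * y - y * x = κ • (P - R))
    (hRE : R * t.E = v ^ (a : ℤ) • (t.E * R))
    (hPF : P * t.F = v ^ (a : ℤ) • (t.F * P)) (hRF : R * t.F = v ^ (-a : ℤ) • (t.F * R))
    (hPK : P * t.K = t.K * P) (hRK : R * t.K = t.K * R)

include hy hFx hxy hPF hRF in
theorem comm_zero_eq (l : ℕ) : x * (t.swap.adE ^ (l + 1)) y - (t.swap.adE ^ (l + 1)) y * x =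
    commCoeff v κ a 0 (l + 1) • (t.F ^ (l + 1) * R) := by
  have h0 := t.v_ne
  induction l with
  | zero =>
    rw [t.comm_base hy hFx, pow_zero, Module.End.one_apply, hxy, mul_smul_comm, smul_mul_assoc,
      sub_mul, hPF, hRF, mul_sub, commCoeff]
    simp only [smul_sub, smul_smul, zero_add, pow_one, Finset.prod_range_one, Finset.range_zero,
      Finset.prod_empty, mul_one]
    have e : v ^ (-a + 2 * (0 : ℕ) : ℤ) * (κ * v ^ (a : ℤ)) = κ := by
      rw [mul_comm κ, ← mul_assoc, ← zpow_add₀ h0]; simp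
    have e2 : v ^ (-a + 2 * (0 : ℕ) : ℤ) * (κ * v ^ (-a : ℤ)) =
        κ * v ^ (-2 * a + 2 * (0 : ℕ) : ℤ) := by
      rw [mul_left_comm, ← zpow_add₀ h0]; congr 2; push_cast; ring
    rw [e, e2]
    module
  | succ l ih =>
    rw [t.comm_base hy hFx, ih, mul_smul_comm, ← mul_assoc, ← pow_succ', smul_mul_assoc, mul_assoc,
      hRF, mul_smul_comm, ← mul_assoc, ← pow_succ, smul_smul, smul_smul, ← sub_smul]
    congr 1
    have e : v ^ (-a + 2 * (l + 1 : ℕ) : ℤ) * v ^ (-a : ℤ) =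
        v ^ (-2 * a + 2 * (l + 1 : ℕ) : ℤ) := by
      rw [← zpow_add₀ h0]; congr 1; ring
    simp only [commCoeff, Finset.range_zero, Finset.prod_empty, mul_one]
    rw [Finset.prod_range_succ _ (l + 1), ← e]
    ring

include hRE in
theorem L_pow_mul_E (k : ℕ) : t.L ^ k * R * t.E = v ^ (a - 2 * k : ℤ) • (t.E * (t.L ^ k * R)) := by
  induction k with
  | zero => simpa using hRE
  | succ k ih =>
    have h : t.L * t.E = v ^ (-2 : ℤ) • (t.E * t.L) := (Wt.E (t := t)).L_mul
    rw [pow_succ', mul_assoc, mul_assoc, ← mul_assoc _ R, ih, mul_smul_comm, ← mul_assoc, h,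
      smul_mul_assoc, smul_smul, ← zpow_add₀ t.v_ne, mul_assoc, mul_assoc]
    congr 2; push_cast; ring

include hx hy hFx hEy hxy hRE hPF hRF hPK hRK in
/-- The commutators of the vectors of the strings of `x` and `y`, on and above the diagonal. -/
theorem comm_eq (k : ℕ) :
    ((t.adE ^ k) x * (t.swap.adE ^ k) y - (t.swap.adE ^ k) y * (t.adE ^ k) x =
      commCoeff v κ a k k • (t.L ^ k * R - t.K ^ k * P)) ∧
    ∀ m, (t.adE ^ k) x * (t.swap.adE ^ (k + m + 1)) y -
        (t.swap.adE ^ (k + m + 1)) y * (t.adE ^ k) x =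
      commCoeff v κ a k (k + m + 1) • (t.F ^ (m + 1) * (t.L ^ k * R)) := by
  have h0 := t.v_ne
  have hd := t.den_ne
  induction k with
  | zero =>
    refine ⟨?_, fun m => ?_⟩
    · simp only [pow_zero, Module.End.one_apply, one_mul, hxy]
      simp only [commCoeff, Finset.range_zero, Finset.prod_empty]
      module
    · simp only [pow_zero, Module.End.one_apply, one_mul, zero_add]
      exact t.comm_zero_eq hy hFx hxy hPF hRF m
  | succ k ih =>
    obtain ⟨ih1, ih2⟩ := ih
    have hRKk : t.L ^ k * R * t.K = t.K * (t.L ^ k * R) := by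
      rw [mul_assoc, hRK, ← mul_assoc, ← mul_assoc]
      congr 1
      exact (((show Commute t.K t.L from t.KL.trans t.LK.symm).pow_right k).eq).symm
    have hKR : t.K * (t.L ^ (k + 1) * R) = t.L ^ k * R := by
      rw [pow_succ', ← mul_assoc, ← mul_assoc, t.KL, one_mul]
    have hPKk : t.K ^ k * P * t.K = t.K ^ (k + 1) * P := by
      rw [mul_assoc, hPK, ← mul_assoc, ← pow_succ]
    have hLR : t.L * (t.L ^ k * R) = t.L ^ (k + 1) * R := by rw [← mul_assoc, ← pow_succ']
    have hE := t.L_pow_mul_E hRE k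
    have hsv : v ^ (-a + 2 * k : ℤ) * v ^ (a - 2 * k : ℤ) = 1 := by
      rw [← zpow_add₀ h0]; convert zpow_zero v using 2; ring
    -- the contribution of `[E, F ^ (m + 1)]`
    have hc : ∀ m : ℕ, t.E * (t.F ^ (m + 1) * (t.L ^ k * R)) -
        v ^ (-a + 2 * k : ℤ) • (t.F ^ (m + 1) * (t.L ^ k * R) * t.E) =
        (br v (m + 1 : ℕ) / (v - v⁻¹)) • (t.F ^ m *
          (v ^ (-m : ℤ) • (t.K * (t.L ^ k * R)) - v ^ (m : ℤ) • (t.L ^ (k + 1) * R))) := by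
      intro m
      rw [mul_assoc (t.F ^ _), hE, mul_smul_comm, smul_smul, hsv, one_smul, ← mul_assoc,
        ← mul_assoc (t.F ^ _), ← sub_mul, t.E_F_pow, smul_mul_assoc, mul_assoc, sub_mul,
        smul_mul_assoc, smul_mul_assoc, hLR]
    have hrel : ∀ m : ℕ, commCoeff v κ a k (k + m + 1) * (br v (m + 1 : ℕ) / (v - v⁻¹)) =
        v ^ (-a + 2 * k + m : ℤ) * (br v (k + m + 1 : ℕ) * br v (a - (k + m : ℕ))) *
          commCoeff v κ a k (k + m) := by
      intro m
      have := t.commCoeff_rel (κ := κ) (a := a) k (k + m)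
      rw [show ((k + m : ℕ) : ℤ) + 1 - k = (m + 1 : ℕ) by push_cast; ring,
        show (-a + k + (k + m : ℕ) : ℤ) = -a + 2 * k + m by push_cast; ring] at this
      exact this
    refine ⟨?_, fun m => ?_⟩
    · have h3 := ih2 0
      simp only [add_zero] at h3
      rw [t.comm_step hx hy hEy, ih1, h3, mul_smul_comm, smul_mul_assoc,
        smul_comm (v ^ _), ← smul_sub, hc 0, smul_mul_assoc, sub_mul, hRKk, hPKk]
      have h1 := hrel 0
      have h2 := commCoeff_succ (κ := κ) (v := v) (a := a) k (k + 1)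
      simp only [add_zero, zero_add, Nat.cast_zero, neg_zero, zpow_zero, one_smul, pow_zero,
        one_mul] at h1 h2 ⊢
      rw [show ((k + 1 : ℕ) : ℤ) - k = 1 by push_cast; ring, sub_self, zpow_zero, mul_one] at h2
      rw [Nat.cast_one] at h1 ⊢
      rw [h2, smul_smul, smul_smul, ← h1]
      module
    · have h2 := ih2 (m + 1)
      have h3 := ih2 m
      rw [show k + 1 + m + 1 = (k + m + 1) + 1 by ring, t.comm_step hx hy hEy,
        show k + m + 1 + 1 = k + (m + 1) + 1 by ring, h2, h3, mul_smul_comm, smul_mul_assoc,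
        smul_comm (v ^ _), ← smul_sub, hc (m + 1), smul_mul_assoc, mul_assoc, hRKk]
      have h1 := hrel (m + 1)
      have h4 := commCoeff_succ (κ := κ) (v := v) (a := a) k (k + (m + 1) + 1)
      rw [show ((k + (m + 1) + 1 : ℕ) : ℤ) - k = (m + 1 + 1 : ℕ) by push_cast; ring] at h4
      have e1 : v ^ (-a + 2 * k + (m + 1 : ℕ) : ℤ) * v ^ (-(m + 1 : ℕ) : ℤ) =
          v ^ (-a + 2 * k : ℤ) := by
        rw [← zpow_add₀ h0]; congr 1; ring
      rw [h4, show ((m + 1 + 1 : ℕ) : ℤ) - 1 = (m + 1 : ℕ) by push_cast; ring, mul_sub,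
        mul_smul_comm, mul_smul_comm]
      have c1 : commCoeff v κ a k (k + (m + 1) + 1) * (br v (m + 1 + 1 : ℕ) / (v - v⁻¹) *
          v ^ (-(m + 1 : ℕ) : ℤ)) = v ^ (-a + 2 * k : ℤ) *
          (br v (k + (m + 1) + 1 : ℕ) * br v (a - (k + (m + 1) : ℕ))) *
          commCoeff v κ a k (k + (m + 1)) := by
        rw [← mul_assoc, h1, ← e1]; ring
      simp only [smul_sub, smul_smul]
      rw [c1]
      simp only [← add_assoc]
      module

include hx hy hFx hEy hxy hRE hPF hRF hPK hRK in
/-- The commutator of the upper ends of two strings. For `x = E_r`, `y = F_r`, `P = K_r`,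
`R = K_r⁻¹` it says that the braid operator respects the relation for `[E_r, F_r]`. -/
theorem comm_dE_dE : t.dE a x * t.swap.dE a y - t.swap.dE a y * t.dE a x =
    (κ * (-v)⁻¹ ^ a) • (t.K ^ a * P - t.L ^ a * R) := by
  have h := (t.comm_eq hx hy hFx hEy hxy hRE hPF hRF hPK hRK a).1
  have hf := t.qFact_ne_zero a
  rw [dE_def, dE_def, smul_mul_smul_comm, smul_mul_smul_comm, ← smul_sub, h, t.commCoeff_self,
    smul_smul, ← neg_sub, smul_neg, ← neg_smul]
  congr 1
  field_simp

end Commutator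
end QTriple

/-! ### Serre relations and strings -/

/-- The quantum Serre expression of degree `N` in `x`, at the parameter `w`. -/
def serreSum {A : Type*} [Ring A] [Algebra ℂ A] (w : ℂ) (N : ℕ) (x y : A) : A :=
  ∑ n ∈ Finset.range (N + 1), ((-1) ^ n * qBinom w N n) • (x ^ (N - n) * y * x ^ n)

theorem serreSum_smul {A : Type*} [Ring A] [Algebra ℂ A] (w : ℂ) (N : ℕ) (x y : A) (c d : ℂ) :
    serreSum w N (c • x) (d • y) = (c ^ N * d) • serreSum w N x y := by
  rw [serreSum, serreSum, Finset.smul_sum]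
  refine Finset.sum_congr rfl fun n hn => ?_
  have hn' : n ≤ N := by simpa [Nat.lt_succ_iff] using hn
  obtain ⟨k, rfl⟩ := Nat.exists_eq_add_of_le hn'
  simp only [smul_pow, smul_mul_assoc, mul_smul_comm, smul_smul, Nat.add_sub_cancel_left]
  congr 1
  rw [pow_add]; ring

/-- The case of the `q`-binomial theorem behind the Serre relations. -/
theorem sum_qBinom_eq_zero {v : ℂ} {N : ℕ} (h1 : 1 ≤ N) (h4 : N ≤ 4) (h0 : v ≠ 0)
    (hv : ∀ n : ℕ, 0 < n → v ^ n ≠ 1) :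
    ∑ n ∈ Finset.range (N + 1), (-1) ^ n * qBinom v N n * (v ^ (-(N - 1) : ℤ)) ^ n = 0 := by
  have hd : v ^ 2 - 1 ≠ 0 := sub_ne_zero.mpr (hv 2 (by norm_num))
  have hd' : v - v⁻¹ ≠ 0 := by
    intro h; apply hd; field_simp at h; linear_combination h
  have h2 : v ^ 2 + 1 ≠ 0 := fun h => hv 4 (by norm_num) (by linear_combination (v ^ 2 - 1) * h)
  have h3 : v ^ 4 + v ^ 2 + 1 ≠ 0 := fun h =>
    hv 6 (by norm_num) (by linear_combination (v ^ 2 - 1) * h)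
  have h3' : v ^ 2 * (v ^ 2 + 1) + 1 ≠ 0 := by
    intro h; apply h3; linear_combination h
  have h5 : v ^ 4 + 1 ≠ 0 := fun h => hv 8 (by norm_num) (by linear_combination (v ^ 4 - 1) * h)
  have hf1 : qFact v 1 = 1 := by simp [qFact, qInt_eq_br, br, hd']
  have hf2 : qFact v 2 = v + v⁻¹ := by
    rw [qFact_succ, hf1, one_mul]; exact br_ofNat_two h0 hd
  have hf3 : qFact v 3 = (v + v⁻¹) * (v ^ 2 + 1 + v⁻¹ ^ 2) := by
    rw [qFact_succ, hf2]; congr 1; exact br_ofNat_three h0 hd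
  have hf4 : qFact v 4 = (v + v⁻¹) * (v ^ 2 + 1 + v⁻¹ ^ 2) * ((v ^ 2 + v⁻¹ ^ 2) * (v + v⁻¹)) := by
    rw [qFact_succ, hf3]; congr 1
    rw [br, show ((3 + 1 : ℕ) : ℤ) = (4 : ℕ) by norm_num, zpow_neg, zpow_natCast]
    field_simp; ring
  have e1 : v ^ (-1 : ℤ) = v⁻¹ := by simp
  have e2 : v ^ (-2 : ℤ) = (v ^ 2)⁻¹ := by rw [zpow_neg]; norm_cast
  have e3 : v ^ (-3 : ℤ) = (v ^ 3)⁻¹ := by rw [zpow_neg]; norm_cast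
  interval_cases N
  · simp [Finset.sum_range_succ, qBinom, qFact_zero, hf1]
  · simp only [Finset.sum_range_succ, Finset.sum_range_zero, qBinom, qFact_zero, hf1, hf2]
    norm_num [qFact_zero, hf1, hf2]
    field_simp
    ring
  · simp only [Finset.sum_range_succ, Finset.sum_range_zero, qBinom, qFact_zero, hf1, hf2, hf3]
    norm_num [qFact_zero, hf1, hf2, hf3, -zpow_neg, e2]
    field_simp
    ring
  · simp only [Finset.sum_range_succ, Finset.sum_range_zero, qBinom, qFact_zero, hf1, hf2, hf3, hf4]
    norm_num [qFact_zero, hf1, hf2, hf3, hf4, -zpow_neg, e3]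
    field_simp
    ring

namespace QTriple

variable {A : Type*} [Ring A] [Algebra ℂ A] {v : ℂ} {t : QTriple A v}

/-- On a vector of weight `-b`, the Serre expression of degree `b + 1` in `E` is a power of `ad E`.
-/
theorem serreSum_E (t : QTriple A v) {b : ℕ} {x : A} (hx : t.Wt (-b) x) :
    serreSum v (b + 1) t.E x = qFact v (b + 1) • t.dE (b + 1) x := by
  rw [t.dE_eq_sum hx, ← Finset.Nat.sum_antidiagonal_swap,
    Finset.Nat.sum_antidiagonal_eq_sum_range_succ_mk, serreSum, Finset.smul_sum]
  refine Finset.sum_congr rfl fun n _ => ?_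
  have h1 := t.qFact_ne_zero n
  have h2 := t.qFact_ne_zero (b + 1 - n)
  rw [smul_smul, show (((n, b + 1 - n) : ℕ × ℕ).swap.2 : ℤ) * (-b + (b + 1 : ℕ) - 1) = 0 by
    push_cast; ring, zpow_zero, qBinom]
  congr 1
  simp only [Prod.swap_prod_mk, Prod.fst_swap, Prod.snd_swap]
  field_simp

theorem adE_pow_eq_zero_of_serre (t : QTriple A v) {b : ℕ} {x : A} (hx : t.Wt (-b) x)
    (h : serreSum v (b + 1) t.E x = 0) : (t.adE ^ (b + 1)) x = 0 := by
  rwa [adE_pow_eq, ← t.serreSum_E hx]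

theorem Good.serreSum_E {b : ℕ} {x X : A} (hx : t.Good b x X) :
    serreSum v (b + 1) t.flip.E X = 0 := by
  rw [t.flip.serreSum_E hx.flip_wt, hx.flip_dE_eq_zero (by omega), smul_zero]

theorem good_one : t.Good 0 1 1 :=
  ⟨by simpa using Wt.one, t.adF_one, by simpa using t.adE_one, by rw [dE_zero]⟩

theorem InG.of_good {b : ℕ} {x X : A} (h : t.Good b x X) : t.InG (-b) x X := by
  have := InG.good h 0 (ν := -b) (by simp)
  rwa [QTriple.dE_zero, QTriple.dE_zero] at this

theorem InG.one : t.InG 0 1 1 := by simpa using InG.of_good good_one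

theorem InG.pow_mul {b : ℕ} {x X y Y : A} {ν : ℤ} (hx : t.Good b x X) (hb : b ≤ 3)
    (h : t.InG ν y Y) (m : ℕ) : t.InG (ν - m * b) (x ^ m * y) (X ^ m * Y) := by
  induction m with
  | zero => simpa using h
  | succ m ih =>
    rw [pow_succ', pow_succ', mul_assoc, mul_assoc]
    exact (ih.good_mul hx hb).cast (by push_cast; ring)

/-- A Serre relation between two lowest weight vectors carries over to the highest weight
vectors of their strings. -/
theorem Good.serreSum {b c : ℕ} {x X y Y : A} (hx : t.Good b x X) (hy : t.Good c y Y)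
    (hb : b ≤ 3) (hc : c ≤ 3) {w : ℂ} {N : ℕ} (h : serreSum w N x y = 0) :
    serreSum w N X Y = 0 := by
  refine InG.eq_zero (t := t) (ν := -(N * b) - c) (InG.sum _ fun n hn => ?_) h
  have hn' : n ≤ N := by simpa [Nat.lt_succ_iff] using hn
  have h1 := InG.pow_mul hx hb (InG.one (t := t)) n
  have h2 := InG.pow_mul hx hb (h1.good_mul hy hc) (N - n)
  rw [mul_one, mul_one, ← mul_assoc, ← mul_assoc] at h2
  refine InG.smul (h2.cast ?_) _
  push_cast [hn']; ring

theorem E_mul_pow (t : QTriple A v) {b : ℤ} {x : A} (hx : t.Wt (-b) x) (n : ℕ) :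
    t.E * x ^ n = ∑ k ∈ Finset.range n, v ^ (-b * k) • (x ^ k * t.adE x * x ^ (n - 1 - k)) +
      v ^ (-b * n) • (x ^ n * t.E) := by
  have h : t.E * x = t.adE x + v ^ (-b) • (x * t.E) := by rw [hx.adE_eq, sub_add_cancel]
  induction n with
  | zero => simp
  | succ n ih =>
    rw [pow_succ, ← mul_assoc, ih, add_mul, Finset.sum_range_succ, Finset.sum_mul, add_assoc]
    congr 1
    · refine Finset.sum_congr rfl fun k hk => ?_
      rw [Finset.mem_range] at hk
      rw [smul_mul_assoc, mul_assoc, ← pow_succ, show n - 1 - k + 1 = n + 1 - 1 - k by omega]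
    · rw [smul_mul_assoc, mul_assoc, h, mul_add, smul_add, mul_smul_comm, smul_smul,
        ← zpow_add₀ t.v_ne, ← mul_assoc]
      simp only [Nat.add_sub_cancel, Nat.sub_self, pow_zero, mul_one]
      congr 3
      push_cast; ring

/-- The Serre expression in `x` and `E`, in terms of `x` and `ad E x` only: the coefficient of
`x ^ N * E` vanishes. -/
theorem serreSum_right (t : QTriple A v) {b : ℤ} {x : A} (hx : t.Wt (-b) x) {w : ℂ} {N : ℕ}
    (h1 : 1 ≤ N) (h4 : N ≤ 4) (h0 : w ≠ 0) (hw : ∀ n : ℕ, 0 < n → w ^ n ≠ 1)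
    (hvw : v ^ (-b) = w ^ (-(N - 1) : ℤ)) :
    serreSum w N x t.E = ∑ n ∈ Finset.range (N + 1), ((-1) ^ n * qBinom w N n) •
      ∑ k ∈ Finset.range n, v ^ (-b * k) • (x ^ (N - n + k) * (t.adE x * x ^ (n - 1 - k))) := by
  have hs := sum_qBinom_eq_zero h1 h4 h0 hw
  rw [← add_zero (∑ n ∈ Finset.range (N + 1), _), ← zero_smul ℂ (x ^ N * t.E), ← hs,
    Finset.sum_smul, ← Finset.sum_add_distrib, serreSum]
  refine Finset.sum_congr rfl fun n hn => ?_
  have hn' : n ≤ N := by simpa [Nat.lt_succ_iff] using hn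
  rw [mul_assoc, t.E_mul_pow hx, mul_add, smul_add, Finset.mul_sum]
  congr 1
  · congr 1
    refine Finset.sum_congr rfl fun k hk => ?_
    rw [mul_smul_comm, ← mul_assoc, ← mul_assoc, ← pow_add, mul_assoc]
  · rw [mul_smul_comm, smul_smul, ← mul_assoc, ← pow_add, Nat.sub_add_cancel hn', zpow_mul,
      hvw, zpow_natCast]

/-- A Serre relation between a lowest weight vector `x` and `E` carries over to the highest weight
vector of the string of `x`. -/
theorem Good.serreSum_right {b : ℕ} {x X : A} (hx : t.Good b x X) (hb : b ≤ 3) {w : ℂ} {N : ℕ}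
    (h1 : 1 ≤ N) (h4 : N ≤ 4) (h0 : w ≠ 0) (hw : ∀ n : ℕ, 0 < n → w ^ n ≠ 1)
    (hvw : v ^ (-b : ℤ) = w ^ (-(N - 1) : ℤ)) (h : QSymPair.serreSum w N x t.E = 0) :
    QSymPair.serreSum w N X t.flip.E = 0 := by
  rw [QTriple.serreSum_right _ hx.flip_wt h1 h4 h0 hw hvw]
  rw [QTriple.serreSum_right _ hx.wt h1 h4 h0 hw hvw] at h
  refine InG.eq_zero (t := t) (ν := 2 - N * b) (InG.sum _ fun n hn => InG.smul
    (InG.sum _ fun k hk => InG.smul ?_ _) _) h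
  have hn' : n ≤ N := by simpa [Nat.lt_succ_iff] using hn
  rw [Finset.mem_range] at hk
  have e1 := InG.pow_mul hx hb (InG.one (t := t)) (n - 1 - k)
  have e2 := InG.pow_mul hx hb (InG.dE_good_mul hx hb 1 e1) (N - n + k)
  rw [mul_one, mul_one, dE_one, dE_one] at e2
  refine e2.cast ?_
  obtain ⟨m, rfl⟩ := Nat.exists_eq_add_of_le hn'
  obtain ⟨j, rfl⟩ := Nat.exists_eq_add_of_le (show k + 1 ≤ n from hk)
  rw [show k + 1 + j - 1 - k = j by omega, show k + 1 + j + m - (k + 1 + j) + k = m + k by omega]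
  push_cast; ring

end QTriple

/-! ### The root lattice -/

namespace CartanDatum

variable {I : Type*} [Fintype I] [DecidableEq I] (C : CartanDatum I)

/-- `⟨n, αᵢ^∨⟩` for an element `n = ∑ⱼ n j • αⱼ` of the root lattice. -/
def cp (i : I) (n : I → ℤ) : ℤ := ∑ j, C.a i j * n j

/-- The invariant form on the root lattice. -/
def bil (m n : I → ℤ) : ℤ := ∑ i, m i * ((C.d i : ℤ) * C.cp i n)

theorem cp_add (i : I) (m n : I → ℤ) : C.cp i (m + n) = C.cp i m + C.cp i n := by
  simp [cp, mul_add, Finset.sum_add_distrib]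

theorem cp_smul (i : I) (c : ℤ) (n : I → ℤ) : C.cp i (c • n) = c * C.cp i n := by
  simp [cp, Finset.mul_sum]; exact Finset.sum_congr rfl fun _ _ => by ring

theorem cp_neg (i : I) (n : I → ℤ) : C.cp i (-n) = -C.cp i n := by
  simp [cp]

theorem cp_sub (i : I) (m n : I → ℤ) : C.cp i (m - n) = C.cp i m - C.cp i n := by
  rw [sub_eq_add_neg, cp_add, cp_neg, sub_eq_add_neg]

theorem cp_single (i j : I) (c : ℤ) : C.cp i (Pi.single j c) = C.a i j * c := by
  simp [cp, Pi.single_apply]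

theorem bil_add_left (m m' n : I → ℤ) : C.bil (m + m') n = C.bil m n + C.bil m' n := by
  simp [bil, add_mul, Finset.sum_add_distrib]

theorem bil_single_left (i : I) (c : ℤ) (n : I → ℤ) :
    C.bil (Pi.single i c) n = c * (C.d i * C.cp i n) := by
  simp [bil, Pi.single_apply]

theorem bil_comm (m n : I → ℤ) : C.bil m n = C.bil n m := by
  simp only [bil, cp, Finset.mul_sum]
  rw [Finset.sum_comm]
  refine Finset.sum_congr rfl fun i _ => Finset.sum_congr rfl fun j _ => ?_
  linear_combination m j * n i * C.symm j i

theorem bil_add_right (m n n' : I → ℤ) : C.bil m (n + n') = C.bil m n + C.bil m n' := by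
  rw [bil_comm, bil_add_left, bil_comm, C.bil_comm n']

theorem bil_smul_left (c : ℤ) (m n : I → ℤ) : C.bil (c • m) n = c * C.bil m n := by
  simp only [bil, Finset.mul_sum]
  exact Finset.sum_congr rfl fun _ _ => by simp; ring

theorem bil_self_pos {n : I → ℤ} (hn : n ≠ 0) : 0 < C.bil n n := by
  have h := C.posDef.dotProduct_mulVec_pos (x := fun i => (n i : ℝ)) (by
    intro h; apply hn; funext i; have := congrFun h i; simpa using this)
  have e : star (fun i => (n i : ℝ)) ⬝ᵥ
      ((Matrix.of fun i j => ((C.d i : ℝ) * (C.a i j : ℝ))).mulVec fun i => (n i : ℝ)) =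
      (C.bil n n : ℝ) := by
    simp only [bil, cp, dotProduct, Matrix.mulVec, Matrix.of_apply, Pi.star_apply, star_trivial,
      Int.cast_sum, Int.cast_mul, Int.cast_natCast, Finset.mul_sum]
    exact Finset.sum_congr rfl fun _ _ => Finset.sum_congr rfl fun _ _ => by ring
  rw [e] at h
  exact_mod_cast h

/-- Positive definiteness bounds the Cartan integers. -/
theorem neg_a_le {i j : I} (h : i ≠ j) : -C.a i j ≤ 3 := by
  by_contra hlt
  have hd1 : (0 : ℤ) < C.d i := by exact_mod_cast C.d_pos i
  have hd2 : (0 : ℤ) < C.d j := by exact_mod_cast C.d_pos j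
  have hs := C.symm i j
  have hji : C.a j i ≤ -1 := by
    have := C.offdiag j i h.symm
    rcases eq_or_ne (C.a j i) 0 with h0 | h0
    · rw [h0] at hs; nlinarith
    · omega
  -- evaluate the form on `-(d i * a i j) αᵢ + 2 d i αⱼ`
  have hpos := C.bil_self_pos (n := Pi.single i (-(C.d i * C.a i j)) + Pi.single j (2 * C.d i))
    (by
      intro h0
      have := congrFun h0 j
      simp [h] at this
      omega)
  rw [bil_add_left, bil_single_left, bil_single_left, cp_add, cp_add, cp_single, cp_single,
    cp_single, cp_single, C.diag, C.diag] at hpos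
  have e : -(C.d i * C.a i j) * (C.d i * (2 * -(C.d i * C.a i j) + C.a i j * (2 * C.d i))) +
      2 * C.d i * (C.d j * (C.a j i * -(C.d i * C.a i j) + 2 * (2 * C.d i))) =
      2 * (C.d i : ℤ) ^ 2 * C.d j * (4 - C.a i j * C.a j i) := by ring
  push_cast at hpos
  rw [e] at hpos
  have h2 : 0 < 2 * (C.d i : ℤ) ^ 2 * C.d j := by positivity
  have h3 : 0 < 4 - C.a i j * C.a j i := by
    by_contra h4
    have := mul_nonpos_of_nonneg_of_nonpos h2.le (not_lt.mp h4)
    omega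
  nlinarith

theorem a_eq_zero_symm {i j : I} (h : C.a i j = 0) : C.a j i = 0 := by
  have hd2 : (0 : ℤ) < C.d j := by exact_mod_cast C.d_pos j
  have hs := C.symm i j
  rw [h, mul_zero] at hs
  rcases mul_eq_zero.mp hs.symm with h1 | h1
  · omega
  · exact h1

/-! ### The triples of the generators, and weights -/

variable (q : Set.Ioo (0 : ℝ) 1)

theorem qc_pow_ne_one {n : ℕ} (hn : 0 < n) : qc q ^ n ≠ 1 := by
  have h1 : ((q : ℝ)) ^ n < 1 := pow_lt_one₀ q.2.1.le q.2.2 hn.ne'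
  rw [qc]
  intro h
  have : ((q : ℝ)) ^ n = 1 := by exact_mod_cast h
  linarith

theorem qr_zpow (i : I) (n : ℤ) : C.qr q i ^ n = qc q ^ (C.d i * n) := by
  rw [qr, ← zpow_natCast, ← zpow_mul]

/-- The quantum `sl₂`-triple `(Eᵢ, Fᵢ, Kᵢ)`. -/
def triple (i : I) : QTriple (C.U q) (C.qr q i) where
  E := C.E q i
  F := C.F q i
  K := C.K q (C.root i)
  L := C.K q (-C.root i)
  v_ne := pow_ne_zero _ qc_ne
  v_pow n hn := by rw [qr, ← pow_mul]; exact qc_pow_ne_one q (Nat.mul_pos (C.d_pos i) hn)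
  KL := by rw [← K_add, add_neg_cancel, K_zero]
  LK := by rw [← K_add, neg_add_cancel, K_zero]
  KE := by rw [K_E, qr_zpow]; congr 2; simp [form, root, C.diag]
  KF := by rw [K_F, qr_zpow]; congr 2; simp [form, root, C.diag]
  EF := C.E_F_same i

variable {q}

/-- The pairing `(ω, n)` of a weight `ω` with an element `n` of the root lattice. -/
def pair (ω : I → ℤ) (n : I → ℤ) : ℤ := ∑ i, n i * C.form ω i

/-- `x` has weight `n`, in coordinates with respect to the simple roots. -/
def HasWt (n : I → ℤ) (x : C.U q) : Prop :=
  ∀ ω, C.K q ω * x = qc q ^ C.pair ω n • (x * C.K q ω)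

theorem pair_add (ω m n : I → ℤ) : C.pair ω (m + n) = C.pair ω m + C.pair ω n := by
  simp [pair, add_mul, Finset.sum_add_distrib]

theorem pair_single (ω : I → ℤ) (i : I) (c : ℤ) : C.pair ω (Pi.single i c) = c * C.form ω i := by
  simp [pair, Pi.single_apply]

theorem pair_root (i : I) (n : I → ℤ) : C.pair (C.root i) n = C.d i * C.cp i n := by
  simp only [pair, form, root, cp, Finset.mul_sum]
  refine Finset.sum_congr rfl fun j _ => ?_
  linear_combination n j * C.symm j i

namespace HasWt

variable {C} {n m : I → ℤ} {x y : C.U q}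

theorem mul (hx : C.HasWt n x) (hy : C.HasWt m y) : C.HasWt (n + m) (x * y) := fun ω => by
  rw [← mul_assoc, hx, smul_mul_assoc, mul_assoc, hy, mul_smul_comm, smul_smul,
    ← zpow_add₀ qc_ne, pair_add, mul_assoc]

theorem add (hx : C.HasWt n x) (hy : C.HasWt n y) : C.HasWt n (x + y) := fun ω => by
  rw [mul_add, hx, hy, add_mul, smul_add]

theorem sub (hx : C.HasWt n x) (hy : C.HasWt n y) : C.HasWt n (x - y) := fun ω => by
  rw [mul_sub, hx, hy, sub_mul, smul_sub]

theorem smul (c : ℂ) (hx : C.HasWt n x) : C.HasWt n (c • x) := fun ω => by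
  rw [mul_smul_comm, hx, smul_mul_assoc, smul_comm]

theorem cast (hx : C.HasWt n x) (h : n = m) : C.HasWt m x := h ▸ hx

theorem E (i : I) : C.HasWt (Pi.single i 1) (C.E q i) := fun ω => by
  rw [K_E, pair_single, one_mul]

theorem F (i : I) : C.HasWt (-Pi.single i 1) (C.F q i) := fun ω => by
  rw [K_F, ← Pi.single_neg, pair_single, neg_one_mul]

theorem K (χ : I → ℤ) : C.HasWt 0 (C.K q χ) := fun ω => by
  rw [← K_add, ← K_add, add_comm]; simp [pair]

theorem wt (hx : C.HasWt n x) (i : I) : (C.triple q i).Wt (C.cp i n) x := by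
  have h := hx (C.root i)
  rw [pair_root, ← qr_zpow] at h
  exact h

theorem adE (hx : C.HasWt n x) (i : I) :
    C.HasWt (n + Pi.single i 1) ((C.triple q i).adE x) := by
  rw [QTriple.adE_def]
  exact (((E i).mul hx).cast (add_comm _ _)).sub
    ((((K _).mul (hx.mul (K _))).mul (E i)).cast (by simp))

theorem adF (hx : C.HasWt n x) (i : I) :
    C.HasWt (n - Pi.single i 1) ((C.triple q i).adF x) := by
  rw [QTriple.adF_def]
  exact (((((F i).mul hx).cast (add_comm _ _)).sub (hx.mul (F i))).mul (K _)).cast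
    (by rw [add_zero, sub_eq_add_neg])

theorem dE (hx : C.HasWt n x) (i : I) (k : ℕ) :
    C.HasWt (n + Pi.single i (k : ℤ)) ((C.triple q i).dE k x) := by
  induction k with
  | zero => simpa [QTriple.dE_zero] using hx
  | succ k ih =>
    rw [QTriple.dE_succ]
    refine ((ih.adE i).smul _).cast ?_
    rw [add_assoc, ← Pi.single_add]; push_cast; rfl

end HasWt

end CartanDatum

/-! ### Lusztig's formulas and the Serre relations -/

namespace CartanDatum

variable {I : Type*} [Fintype I] [DecidableEq I] (C : CartanDatum I) (q : Set.Ioo (0 : ℝ) 1)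

theorem coe_toNat_neg_a {i j : I} (h : i ≠ j) : ((-C.a i j).toNat : ℤ) = -C.a i j :=
  Int.toNat_of_nonneg (by have := C.offdiag i j h; omega)

theorem toNat_neg_a_le {i j : I} (h : i ≠ j) : (-C.a i j).toNat ≤ 3 := by
  have := C.neg_a_le h; omega

theorem serreN_eq {i j : I} (h : i ≠ j) : C.serreN i j = (-C.a i j).toNat + 1 := by
  have := C.coe_toNat_neg_a h
  rw [serreN]; omega

theorem serre_eq {A : Type*} [Ring A] [Algebra ℂ A] (r s : I) (x y : A) :
    C.serre q r s x y = serreSum (C.qr q r) (C.serreN r s) x y := rfl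

variable {q}

/-- By the Serre relation, `E_s` is the lower end of an `Eᵢ`-string. -/
theorem good_E {i s : I} (h : i ≠ s) : (C.triple q i).Good (-C.a i s).toNat (C.E q s)
    ((C.triple q i).dE (-C.a i s).toNat (C.E q s)) := by
  have hw : (C.triple q i).Wt (-((-C.a i s).toNat : ℤ)) (C.E q s) := by
    refine ((HasWt.E s).wt i).cast ?_
    rw [cp_single, C.coe_toNat_neg_a h]; ring
  refine ⟨hw, ?_, ?_, rfl⟩
  · rw [QTriple.adF_def]
    change (C.F q i * C.E q s - C.E q s * C.F q i) * _ = 0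
    rw [← neg_sub, C.E_F s i h.symm, neg_zero, zero_mul]
  · refine QTriple.adE_pow_eq_zero_of_serre _ hw ?_
    rw [← serreN_eq C h]
    exact C.serre_E i s h

/-- By the Serre relation, `F_s` is the lower end of a string for the swapped triple. -/
theorem good_F {i s : I} (h : i ≠ s) : (C.triple q i).swap.Good (-C.a i s).toNat (C.F q s)
    ((C.triple q i).swap.dE (-C.a i s).toNat (C.F q s)) := by
  have hw : (C.triple q i).swap.Wt (-((-C.a i s).toNat : ℤ)) (C.F q s) := by
    have h1 := ((HasWt.F (C := C) (q := q) s).wt i).L_mul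
    change C.K q (-C.root i) * _ = _ • (_ * C.K q (-C.root i))
    refine h1.trans ?_
    congr 2
    rw [← Pi.single_neg, cp_single, C.coe_toNat_neg_a h]; ring
  refine ⟨hw, ?_, ?_, rfl⟩
  · rw [QTriple.adF_def]
    change (C.E q i * C.F q s - C.F q s * C.E q i) * _ = 0
    rw [C.E_F i s h, zero_mul]
  · refine QTriple.adE_pow_eq_zero_of_serre _ hw ?_
    rw [← serreN_eq C h]
    exact C.serre_F i s h

/-- The braid operator `Tᵢ`, as a homomorphism from the free algebra to `U_q(𝔤)`. -/
def braidU (i : I) : Free I →ₐ[ℂ] C.U q := (C.proj q).comp (C.braid q i)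

theorem braidU_K (i : I) (ω : I → ℤ) : C.braidU (q := q) i (Free.K ω) = C.K q (C.refl i ω) := by
  simp [braidU, braid, Free.K, K]

theorem braidU_E_self (i : I) : C.braidU (q := q) i (Free.E i) = (C.triple q i).flip.E := by
  simp only [braidU, braid, Free.E, AlgHom.comp_apply, FreeAlgebra.lift_ι_apply, if_true]
  rw [map_neg, map_mul]; rfl

theorem braidU_F_self (i : I) : C.braidU (q := q) i (Free.F i) = (C.triple q i).flip.F := by
  simp only [braidU, braid, Free.F, AlgHom.comp_apply, FreeAlgebra.lift_ι_apply, if_true]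
  rw [map_neg, map_mul]; rfl

/-- Lusztig's formula for the image of `E_s` is the upper end of its `Eᵢ`-string. -/
theorem braidU_E {i s : I} (h : i ≠ s) : C.braidU (q := q) i (Free.E s) =
    (C.triple q i).dE (-C.a i s).toNat (C.E q s) := by
  rw [QTriple.dE_eq_sum _ (C.good_E h).wt, ← Finset.Nat.sum_antidiagonal_swap,
    Finset.Nat.sum_antidiagonal_eq_sum_range_succ_mk]
  simp only [braidU, braid, Free.E, AlgHom.comp_apply, FreeAlgebra.lift_ι_apply, if_neg h.symm,
    map_sum, map_smul, map_mul, map_pow]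
  refine Finset.sum_congr rfl fun m _ => ?_
  congr 1
  simp only [Prod.swap_prod_mk]
  rw [mul_comm (qFact _ m)]
  congr 1
  rw [show (m : ℤ) * (-((-C.a i s).toNat : ℤ) + (-C.a i s).toNat - 1) = -m by ring, zpow_neg,
    zpow_natCast, inv_pow, neg_pow, mul_inv, ← inv_pow]
  norm_num

theorem braidU_F {i s : I} (h : i ≠ s) : C.braidU (q := q) i (Free.F s) =
    (-C.qr q i) ^ (-C.a i s).toNat • (C.triple q i).swap.dE (-C.a i s).toNat (C.F q s) := by
  rw [QTriple.dE_eq_sum _ (C.good_F h).wt, Finset.Nat.sum_antidiagonal_eq_sum_range_succ_mk]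
  simp only [braidU, braid, Free.F, AlgHom.comp_apply, FreeAlgebra.lift_ι_apply, if_neg h.symm,
    map_sum, map_smul, map_mul, map_pow, Finset.smul_sum, smul_smul]
  refine Finset.sum_congr rfl fun m hm => ?_
  congr 1
  rw [← mul_div_assoc]
  congr 1
  have hm' : m ≤ (-C.a i s).toNat := by simpa [Nat.lt_succ_iff] using hm
  obtain ⟨k, hk⟩ := Nat.exists_eq_add_of_le hm'
  have hv : C.qr q i ≠ 0 := (C.triple q i).v_ne
  rw [hk, Nat.add_sub_cancel_left, pow_add,
    show (k : ℤ) * (-((m + k : ℕ) : ℤ) + (m + k : ℕ) - 1) = -k by ring, zpow_neg, zpow_natCast,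
    mul_assoc, neg_pow (C.qr q i) k]
  have h1 : ((-1 : ℂ) ^ k) * (-1) ^ k = 1 := by rw [← mul_pow]; norm_num
  have h2 := pow_ne_zero k hv
  field_simp
  linear_combination (-(-C.qr q i) ^ m) * h1

theorem refl_add (i : I) (ω χ : I → ℤ) : C.refl i (ω + χ) = C.refl i ω + C.refl i χ := by
  simp only [refl, Pi.add_apply, add_smul]; abel

theorem refl_neg (i : I) (ω : I → ℤ) : C.refl i (-ω) = -C.refl i ω := by
  simp only [refl, Pi.neg_apply, neg_smul]; abel

theorem refl_root (i j : I) : C.refl i (C.root j) = C.root j - C.a i j • C.root i := rfl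

theorem refl_root_self (i : I) : C.refl i (C.root i) = -C.root i := by
  rw [refl_root, C.diag]; module

theorem form_refl (i s : I) (ω : I → ℤ) :
    C.form (C.refl i ω) s = C.form ω s - C.a i s * C.form ω i := by
  simp only [form, refl, Pi.sub_apply, Pi.smul_apply, root, smul_eq_mul]
  linear_combination ω i * C.symm i s

theorem pair_refl (i s : I) (ω : I → ℤ) {b : ℤ} (hb : b = -C.a i s) :
    C.pair (C.refl i ω) (Pi.single s 1 + Pi.single i b) = C.form ω s := by
  rw [pair_add, pair_single, pair_single, form_refl, form_refl, C.diag, hb]; ring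

/-- The divided powers of the swapped triple, that is, of the other adjoint action of `Fᵢ`, lower
weights. -/
theorem hasWt_swap_dE {n : I → ℤ} {x : C.U q} (hx : C.HasWt n x) (i : I) (k : ℕ) :
    C.HasWt (n - Pi.single i (k : ℤ)) ((C.triple q i).swap.dE k x) := by
  induction k with
  | zero => simpa [QTriple.dE_zero] using hx
  | succ k ih =>
    rw [QTriple.dE_succ, QTriple.adE_def]
    change C.HasWt _ (_ • (C.F q i * _ - C.K q (-C.root i) * (_ * C.K q (C.root i)) * C.F q i))
    have e : n - Pi.single i ((k + 1 : ℕ) : ℤ) = n - Pi.single i (k : ℤ) + -Pi.single i 1 := by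
      rw [sub_eq_add_neg, sub_eq_add_neg, add_assoc, ← neg_add, ← Pi.single_add]; push_cast; rfl
    rw [e]
    exact ((((HasWt.F i).mul ih).cast (add_comm _ _)).sub
      ((((HasWt.K _).mul (ih.mul (HasWt.K _))).mul (HasWt.F i)).cast (by simp))).smul _

theorem braidU_serre_E {r s : I} (h : r ≠ s) (i : I) :
    C.serre q r s (C.braidU (q := q) i (Free.E r)) (C.braidU i (Free.E s)) = 0 := by
  rw [serre_eq]
  by_cases hr : i = r
  · subst hr
    rw [braidU_E_self, C.braidU_E h, serreN_eq C h]
    exact (C.good_E h).serreSum_E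
  by_cases hs : i = s
  · subst hs
    rw [braidU_E_self, C.braidU_E hr]
    have hN := C.serreN_eq h
    have hv : C.qr q i ^ (-((-C.a i r).toNat : ℤ)) =
        C.qr q r ^ (-((C.serreN r i : ℕ) - 1 : ℤ)) := by
      rw [qr_zpow, qr_zpow, hN, C.coe_toNat_neg_a hr]
      push_cast
      rw [C.coe_toNat_neg_a h]
      congr 1
      linear_combination C.symm i r
    refine (C.good_E hr).serreSum_right (C.toNat_neg_a_le hr) (by omega)
      (by have := C.toNat_neg_a_le h; omega) (C.triple q r).v_ne (C.triple q r).v_pow hv ?_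
    exact C.serre_E r i h
  · rw [C.braidU_E hr, C.braidU_E hs]
    exact (C.good_E hr).serreSum (C.good_E hs) (C.toNat_neg_a_le hr) (C.toNat_neg_a_le hs)
      (C.serre_E r s h)

theorem braidU_F_self' (i : I) : C.braidU (q := q) i (Free.F i) =
    (C.qr q i ^ (-2 : ℤ)) • (C.triple q i).swap.flip.E := by
  rw [braidU_F_self]
  change -(C.K q (-C.root i) * C.E q i) = _ • -(C.E q i * C.K q (-C.root i))
  have h : C.K q (-C.root i) * C.E q i = _ • (C.E q i * C.K q (-C.root i)) :=
    (QTriple.Wt.E (t := C.triple q i)).L_mul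
  rw [smul_neg, h]

theorem braidU_serre_F {r s : I} (h : r ≠ s) (i : I) :
    C.serre q r s (C.braidU (q := q) i (Free.F r)) (C.braidU i (Free.F s)) = 0 := by
  rw [serre_eq]
  by_cases hr : i = r
  · subst hr
    rw [braidU_F_self', C.braidU_F h, serreN_eq C h, serreSum_smul, (C.good_F h).serreSum_E,
      smul_zero]
  by_cases hs : i = s
  · subst hs
    rw [braidU_F_self', C.braidU_F hr, serreSum_smul]
    have hN := C.serreN_eq h
    have hv : C.qr q i ^ (-((-C.a i r).toNat : ℤ)) =
        C.qr q r ^ (-((C.serreN r i : ℕ) - 1 : ℤ)) := by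
      rw [qr_zpow, qr_zpow, hN, C.coe_toNat_neg_a hr]
      push_cast
      rw [C.coe_toNat_neg_a h]
      congr 1
      linear_combination C.symm i r
    rw [(C.good_F hr).serreSum_right (C.toNat_neg_a_le hr) (by omega)
      (by have := C.toNat_neg_a_le h; omega) (C.triple q r).v_ne (C.triple q r).v_pow hv
      (C.serre_F r i h), smul_zero]
  · rw [C.braidU_F hr, C.braidU_F hs, serreSum_smul]
    rw [(C.good_F hr).serreSum (C.good_F hs) (C.toNat_neg_a_le hr) (C.toNat_neg_a_le hs)
      (C.serre_F r s h), smul_zero]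

end CartanDatum

/-! ### The braid operators -/

namespace CartanDatum

variable {I : Type*} [Fintype I] [DecidableEq I] {C : CartanDatum I} {q : Set.Ioo (0 : ℝ) 1}

theorem K_nsmul (k : ℕ) (ω : I → ℤ) : C.K q ω ^ k = C.K q (k • ω) := by
  induction k with
  | zero => simp [K_zero]
  | succ k ih => rw [pow_succ, ih, ← K_add, succ_nsmul]

theorem refl_root_eq {i r : I} (h : i ≠ r) :
    C.refl i (C.root r) = (-C.a i r).toNat • C.root i + C.root r := by
  have e := C.coe_toNat_neg_a h
  rw [refl_root, ← natCast_zsmul, e]; module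

theorem K_mul_K (ω χ : I → ℤ) : C.K q ω * C.K q χ = C.K q χ * C.K q ω := by
  rw [← K_add, ← K_add, add_comm]

theorem braidU_E_F_self (i r : I) : C.braidU (q := q) i (Free.E r) * C.braidU i (Free.F r) -
    C.braidU i (Free.F r) * C.braidU i (Free.E r) =
    (C.qr q r - (C.qr q r)⁻¹)⁻¹ • (C.K q (C.refl i (C.root r)) - C.K q (-C.refl i (C.root r))) := by
  by_cases hr : i = r
  · subst hr
    rw [braidU_E_self, braidU_F_self, (C.triple q i).flip.EF, refl_root_self, neg_neg]
    rfl
  · have h1 : (C.triple q i).Wt (-((-C.a i r).toNat : ℤ)) (C.E q r) := (C.good_E hr).wt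
    have h2 := (C.good_F (q := q) hr).wt
    have hc := C.coe_toNat_neg_a hr
    have hq : ∀ (s : ℤ), qc q ^ (s * (C.d i * C.a i r)) =
        C.qr q i ^ (-s * ((-C.a i r).toNat : ℤ)) := by
      intro s; rw [qr_zpow, hc]; congr 1; ring
    have hf : C.form (C.root r) i = C.d i * C.a i r := rfl
    have hv := pow_ne_zero (-C.a i r).toNat (neg_ne_zero.mpr (C.triple q i).v_ne)
    rw [C.braidU_E hr, C.braidU_F hr, mul_smul_comm, smul_mul_assoc, ← smul_sub,
      (C.triple q i).comm_dE_dE (κ := (C.qr q r - (C.qr q r)⁻¹)⁻¹) (P := C.K q (C.root r))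
        (R := C.K q (-C.root r)) h1 h2
        (sub_eq_zero.mp (by rw [← neg_sub]; change -(C.E q r * C.F q i - C.F q i * C.E q r) = 0
                            rw [C.E_F r i (Ne.symm hr), neg_zero]))
        (sub_eq_zero.mp (C.E_F i r hr)) (C.E_F_same r) ?_ ?_ ?_ (K_mul_K _ _) (K_mul_K _ _),
      smul_smul]
    · change _ • (C.K q (C.root i) ^ _ * _ - C.K q (-C.root i) ^ _ * _) = _
      rw [K_nsmul, K_nsmul, ← K_add, ← K_add, refl_root_eq hr, neg_add, smul_neg]
      congr 1
      rw [inv_pow]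
      field_simp
    · change C.K q (-C.root r) * C.E q i = _
      rw [K_E, form_neg, hf, ← neg_one_mul, hq, neg_neg, one_mul]; rfl
    · change C.K q (C.root r) * C.F q i = _
      rw [K_F, hf, ← neg_one_mul, hq, neg_neg, one_mul]; rfl
    · change C.K q (-C.root r) * C.F q i = _
      rw [K_F, form_neg, hf, neg_neg, ← one_mul (_ * C.a i r), hq, neg_one_mul]; rfl

/-- The images of `E_r` and `F_s`, `r ≠ s`, commute. If one of the indices is `i`, this says that
the upper end of an `Eᵢ`-string commutes with `EᵢKᵢ⁻¹`, or the same for the swapped triple. -/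
theorem braidU_E_F {r s : I} (h : r ≠ s) (i : I) :
    C.braidU (q := q) i (Free.E r) * C.braidU i (Free.F s) -
      C.braidU i (Free.F s) * C.braidU i (Free.E r) = 0 := by
  -- for every triple, `E L` commutes with the upper end `M` of a string
  have key : ∀ (t : QTriple (C.U q) (C.qr q i)) {b : ℕ} {l M : C.U q}, t.Good b l M →
      t.E * t.L * M = M * (t.E * t.L) := by
    intro t b l M hM
    have h1 : t.adE M = 0 := by
      rw [hM.top, QTriple.adE_dE, hM.dE_eq_zero (by omega), smul_zero]
    rw [hM.wt_top.adE_eq, sub_eq_zero] at h1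
    rw [mul_assoc, hM.wt_top.L_mul, mul_smul_comm, ← mul_assoc, h1, smul_mul_assoc, smul_smul,
      ← zpow_add₀ t.v_ne, mul_assoc]
    simp
  by_cases hr : i = r
  · subst hr
    rw [braidU_E_self, C.braidU_F h]
    have h1 := key _ (C.good_F (q := q) h)
    change C.F q i * C.K q (C.root i) * _ = _ * (C.F q i * C.K q (C.root i)) at h1
    change -(C.F q i * C.K q (C.root i)) * _ - _ * -(C.F q i * C.K q (C.root i)) = 0
    rw [mul_smul_comm, smul_mul_assoc, ← smul_sub, neg_mul, mul_neg, h1, sub_self, smul_zero]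
  by_cases hs : i = s
  · subst hs
    rw [braidU_F_self', C.braidU_E hr]
    have h1 := key _ (C.good_E (q := q) hr)
    change C.E q i * C.K q (-C.root i) * _ = _ * (C.E q i * C.K q (-C.root i)) at h1
    change _ * (_ • -(C.E q i * C.K q (-C.root i))) - (_ • -(C.E q i * C.K q (-C.root i))) * _ = 0
    rw [mul_smul_comm, smul_mul_assoc, ← smul_sub, neg_mul, mul_neg, h1, sub_self, smul_zero]
  · rw [C.braidU_E hr, C.braidU_F hs, mul_smul_comm, smul_mul_assoc, ← smul_sub,
      QTriple.dE_def, QTriple.dE_def, smul_mul_smul_comm, smul_mul_smul_comm,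
      mul_comm (qFact _ (-C.a i s).toNat)⁻¹, ← smul_sub,
      (C.triple q i).comm_eq_zero (C.good_E hr).wt (C.good_F hs).wt
        (sub_eq_zero.mp (by rw [← neg_sub]; change -(C.E q r * C.F q i - C.F q i * C.E q r) = 0
                            rw [C.E_F r i (Ne.symm hr), neg_zero]))
        (sub_eq_zero.mp (C.E_F i s hs)) (C.E_F r s h), smul_zero, smul_zero]

theorem pair_neg (ω n : I → ℤ) : C.pair ω (-n) = -C.pair ω n := by simp [pair]

theorem braidU_K_E (i r : I) (ω : I → ℤ) :
    C.K q (C.refl i ω) * C.braidU (q := q) i (Free.E r) =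
      qc q ^ C.form ω r • (C.braidU i (Free.E r) * C.K q (C.refl i ω)) := by
  by_cases hr : i = r
  · subst hr
    rw [braidU_E_self]
    have h := (((HasWt.F (C := C) (q := q) i).mul (HasWt.K (C.root i))).smul (-1)) (C.refl i ω)
    rw [neg_one_smul, add_zero, pair_neg, pair_single, form_refl, C.diag] at h
    rw [show C.form ω i = -(1 * (C.form ω i - 2 * C.form ω i)) by ring]
    exact h
  · rw [C.braidU_E hr, ← C.pair_refl i r ω (C.coe_toNat_neg_a hr)]
    exact ((HasWt.E r).dE i _) _

theorem braidU_K_F (i r : I) (ω : I → ℤ) :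
    C.K q (C.refl i ω) * C.braidU (q := q) i (Free.F r) =
      qc q ^ (-C.form ω r) • (C.braidU i (Free.F r) * C.K q (C.refl i ω)) := by
  by_cases hr : i = r
  · subst hr
    rw [braidU_F_self]
    have h := (((HasWt.K (C := C) (q := q) (-C.root i)).mul (HasWt.E i)).smul (-1)) (C.refl i ω)
    rw [neg_one_smul, zero_add, pair_single, form_refl, C.diag] at h
    rw [show -C.form ω i = 1 * (C.form ω i - 2 * C.form ω i) by ring]
    exact h
  · rw [C.braidU_F hr, ← C.pair_refl i r ω (C.coe_toNat_neg_a hr), ← pair_neg, neg_add,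
      ← sub_eq_add_neg]
    exact ((C.hasWt_swap_dE (HasWt.F r) i _).smul _) _

/-- Lusztig's formulas respect the defining relations of `U_q(𝔤)`. -/
theorem braidU_rel (i : I) {x y : Free I} (h : C.Rel q x y) :
    C.braidU (q := q) i x = C.braidU i y := by
  cases h with
  | K_zero =>
    rw [braidU_K, map_one, ← K_zero (C := C)]
    congr 1; simp [refl]
  | K_add ω χ => rw [map_mul, braidU_K, braidU_K, braidU_K, refl_add, K_add]
  | K_E ω r => rw [map_mul, map_smul, map_mul, braidU_K, braidU_K_E]
  | K_F ω r => rw [map_mul, map_smul, map_mul, braidU_K, braidU_K_F]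
  | E_F_same r =>
    rw [map_sub, map_mul, map_mul, braidU_E_F_self, map_smul, map_sub, braidU_K, braidU_K, refl_neg]
  | E_F r s h => rw [map_sub, map_mul, map_mul, braidU_E_F h, map_zero]
  | serre_E r s h => rw [serre_map, braidU_serre_E C h, map_zero]
  | serre_F r s h => rw [serre_map, braidU_serre_F C h, map_zero]

variable (C q) in
/-- Lusztig's braid operator `Tᵢ` on `U_q(𝔤)`. -/
def T (i : I) : C.U q →ₐ[ℂ] C.U q :=
  RingQuot.liftAlgHom ℂ ⟨C.braidU i, fun _ _ h => braidU_rel i h⟩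

theorem T_proj (i : I) (x : Free I) : C.T q i (C.proj q x) = C.proj q (C.braid q i x) := by
  change RingQuot.liftAlgHom ℂ _ (RingQuot.mkAlgHom ℂ (C.Rel q) x) = _
  rw [RingQuot.liftAlgHom_mkAlgHom_apply]; rfl

theorem T_E_self (i : I) : C.T q i (C.E q i) = (C.triple q i).flip.E := by
  rw [E, T_proj]; exact C.braidU_E_self i

theorem T_E {i s : I} (h : i ≠ s) : C.T q i (C.E q s) =
    (C.triple q i).dE (-C.a i s).toNat (C.E q s) := by
  rw [E, T_proj]; exact C.braidU_E h

end CartanDatum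

/-! ### Coroots -/

namespace CartanDatum

variable {I : Type*} [Fintype I] [DecidableEq I] (C : CartanDatum I)

/-- `⟨αᵣ, h⟩` for an element `h = ∑ⱼ h j • αⱼ^∨` of the coroot lattice. -/
def rootPair (r : I) (h : I → ℤ) : ℤ := ∑ j, h j * C.a j r

/-- The simple reflection `sᵣ` on the coroot lattice. -/
def corefl (r : I) (h : I → ℤ) : I → ℤ := h - C.rootPair r h • (Pi.single r 1 : I → ℤ)

theorem rootPair_add (r : I) (g h : I → ℤ) :
    C.rootPair r (g + h) = C.rootPair r g + C.rootPair r h := by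
  simp [rootPair, add_mul, Finset.sum_add_distrib]

theorem rootPair_single (r s : I) (k : ℤ) : C.rootPair r (Pi.single s k) = k * C.a s r := by
  simp [rootPair, Pi.single_apply]

theorem rootPair_smul (r : I) (k : ℤ) (h : I → ℤ) : C.rootPair r (k • h) = k * C.rootPair r h := by
  simp [rootPair, Finset.mul_sum, mul_assoc]

theorem rootPair_sub (r : I) (g h : I → ℤ) :
    C.rootPair r (g - h) = C.rootPair r g - C.rootPair r h := by
  simp [rootPair, sub_mul, Finset.sum_sub_distrib]

theorem rootPair_sum {ι : Type*} (r : I) (s : Finset ι) (f : ι → I → ℤ) :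
    C.rootPair r (∑ k ∈ s, f k) = ∑ k ∈ s, C.rootPair r (f k) := by
  simp only [rootPair, Finset.sum_apply, Finset.sum_mul]
  rw [Finset.sum_comm]

theorem rootPair_corefl (r : I) (h : I → ℤ) : C.rootPair r (C.corefl r h) = -C.rootPair r h := by
  rw [corefl, rootPair_sub, rootPair_smul, rootPair_single, C.diag]; ring

theorem corefl_corefl (r : I) (h : I → ℤ) : C.corefl r (C.corefl r h) = h := by
  rw [corefl, rootPair_corefl, corefl, neg_smul, sub_neg_eq_add, sub_add_cancel]

theorem corefl_apply_ne {r j : I} (hj : j ≠ r) (h : I → ℤ) : C.corefl r h j = h j := by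
  simp [corefl, hj]

theorem bil_smul_right (c : ℤ) (m n : I → ℤ) : C.bil m (c • n) = c * C.bil m n := by
  rw [bil_comm, bil_smul_left, bil_comm]

theorem bil_sub_left (m m' n : I → ℤ) : C.bil (m - m') n = C.bil m n - C.bil m' n := by
  rw [sub_eq_add_neg, bil_add_left, ← neg_one_smul ℤ m', bil_smul_left]; ring

theorem bil_sub_right (m n n' : I → ℤ) : C.bil m (n - n') = C.bil m n - C.bil m n' := by
  rw [bil_comm, bil_sub_left, bil_comm, C.bil_comm n']

theorem bil_self_nonneg (n : I → ℤ) : 0 ≤ C.bil n n := by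
  rcases eq_or_ne n 0 with rfl | h
  · simp [bil]
  · exact (C.bil_self_pos h).le

theorem bil_single_right (i : I) (c : ℤ) (n : I → ℤ) :
    C.bil n (Pi.single i c) = c * (C.d i * C.cp i n) := by
  rw [bil_comm, bil_single_left]

/-- The norm of `n + k αᵢ`. -/
theorem bil_add_single (i : I) (k : ℤ) (n : I → ℤ) :
    C.bil (n + Pi.single i k) (n + Pi.single i k) =
      C.bil n n + 2 * C.d i * k * (C.cp i n + k) := by
  rw [bil_add_left, bil_add_right, bil_single_left, bil_single_right, cp_add, cp_single, C.diag]
  ring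

/-- A coroot `h` is proportional to a root `c`: `c i d i = d h i`, where `2 d` is the square length
of `c`. -/
structure IsRootOf (h c : I → ℤ) (d : ℕ) : Prop where
  pos : 0 < d
  eq : ∀ i, c i * C.d i = d * h i
  norm : C.bil c c = 2 * d

variable {C} {X : Finset I} {h : I → ℤ}

theorem IsRootOf.rootPair {c : I → ℤ} {d : ℕ} (hc : C.IsRootOf h c d) (r : I) :
    d * C.rootPair r h = C.d r * C.cp r c := by
  rw [CartanDatum.rootPair, cp, Finset.mul_sum, Finset.mul_sum]
  refine Finset.sum_congr rfl fun j _ => ?_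
  linear_combination (-C.a j r) * hc.eq j + c j * C.symm j r

theorem IsCoroot.corefl {r : I} (hr : r ∈ X) (hh : C.IsCoroot X h) :
    C.IsCoroot X (C.corefl r h) := IsCoroot.refl r hr h hh

theorem IsCoroot.exists_root (hh : C.IsCoroot X h) : ∃ c d, C.IsRootOf h c d := by
  induction hh with
  | simple s hs =>
    refine ⟨Pi.single s 1, C.d s, C.d_pos s, fun i => ?_, ?_⟩
    · by_cases hi : i = s
      · subst hi; simp
      · simp [hi]
    · rw [bil_single_left, cp_single, C.diag]; ring
  | refl r hr h hh ih =>
    obtain ⟨c, d, hc⟩ := ih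
    refine ⟨c + Pi.single r (-C.cp r c), d, hc.pos, fun i => ?_, ?_⟩
    · have h1 := hc.rootPair r
      change _ = (d : ℤ) * (h - C.rootPair r h • (Pi.single r 1 : I → ℤ) : I → ℤ) i
      by_cases hi : i = r
      · subst hi
        simp only [Pi.add_apply, Pi.sub_apply, Pi.smul_apply, Pi.single_eq_same, smul_eq_mul]
        linear_combination hc.eq i + h1
      · simpa [hi] using hc.eq i
    · rw [bil_add_single, hc.norm]; ring

theorem IsCoroot.support (hh : C.IsCoroot X h) {i : I} (hi : i ∉ X) : h i = 0 := by
  induction hh with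
  | simple s hs =>
    have : i ≠ s := by rintro rfl; exact hi hs
    simp [this]
  | refl r hr h hh ih =>
    have : i ≠ r := by rintro rfl; exact hi hr
    simp [this, ih]

/-- The sum of the entries of a symmetric integer matrix with even diagonal is even. -/
theorem even_sum_of_symm {ι : Type*} [Fintype ι] (f : ι → ι → ℤ) (hf : ∀ i j, f i j = f j i)
    (hd : ∀ i, Even (f i i)) : Even (∑ i, ∑ j, f i j) := by
  rw [← Finset.sum_product', ← ZMod.intCast_eq_zero_iff_even]
  push_cast
  refine Finset.sum_involution (fun p _ => p.swap) ?_ ?_ ?_ ?_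
  · intro p _
    rw [Prod.fst_swap, Prod.snd_swap, hf p.2 p.1]
    exact CharTwo.add_self_eq_zero _
  · intro p _ hp h
    apply hp
    have : p.2 = p.1 := congrArg Prod.fst h
    rw [this, ZMod.intCast_eq_zero_iff_even]
    exact hd _
  · intro p _; simp
  · intro p _; simp

/-- Norms of the vectors `c` with `d ∣ c i d i` are multiples of `2 d`. -/
theorem le_bil_of_dvd {c : I → ℤ} {d : ℕ} (hdvd : ∀ i, (d : ℤ) ∣ c i * C.d i) (hc : c ≠ 0) :
    2 * (d : ℤ) ≤ C.bil c c := by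
  choose y hy using hdvd
  have e : C.bil c c = d * ∑ i, ∑ j, y i * C.a i j * c j := by
    simp only [bil, cp, Finset.mul_sum]
    refine Finset.sum_congr rfl fun i _ => Finset.sum_congr rfl fun j _ => ?_
    linear_combination (C.a i j * c j) * hy i
  rcases Nat.eq_zero_or_pos d with rfl | hd
  · simpa using C.bil_self_nonneg c
  have hd' : (0 : ℤ) < d := by exact_mod_cast hd
  have hev : Even (∑ i, ∑ j, y i * C.a i j * c j) := by
    refine even_sum_of_symm _ (fun i j => ?_) fun i => ?_
    · refine mul_left_cancel₀ hd'.ne' ?_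
      linear_combination (-C.a i j * c j) * hy i + (C.a j i * c i) * hy j + c i * c j * C.symm i j
    · rw [C.diag]; exact ⟨y i * c i, by ring⟩
  obtain ⟨k, hk⟩ := hev
  have hpos := C.bil_self_pos hc
  rw [e, hk] at hpos
  have hk1 : 1 ≤ k := by
    by_contra h0
    have : d * (k + k) ≤ (0 : ℤ) := mul_nonpos_of_nonneg_of_nonpos hd'.le (by omega)
    omega
  rw [e, hk]
  nlinarith

/-- A coroot is positive or negative: a mixed one would have square length at least twice the length
that it has. -/
theorem IsCoroot.nonneg_or_nonpos (hh : C.IsCoroot X h) : 0 ≤ h ∨ h ≤ 0 := by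
  obtain ⟨c, d, hc⟩ := hh.exists_root
  have hd : (0 : ℤ) < d := by exact_mod_cast hc.pos
  have hdi : ∀ i, (0 : ℤ) < C.d i := fun i => by exact_mod_cast C.d_pos i
  set p : I → ℤ := fun i => max (c i) 0 with hp
  set m : I → ℤ := fun i => max (-c i) 0 with hm
  have hcpm : c = p - m := by
    funext i; simp only [hp, hm, Pi.sub_apply]; omega
  have hpm : C.bil p m ≤ 0 := by
    simp only [bil, cp, Finset.mul_sum]
    refine Finset.sum_nonpos fun i _ => Finset.sum_nonpos fun j _ => ?_
    have hp0 : 0 ≤ p i := le_max_right _ _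
    have hm0 : 0 ≤ m j := le_max_right _ _
    rcases eq_or_ne i j with rfl | hij
    · have : p i = 0 ∨ m i = 0 := by simp only [hp, hm]; omega
      rcases this with h | h <;> rw [h] <;> simp
    · have := C.offdiag i j hij
      have h1 : C.a i j * m j ≤ 0 := mul_nonpos_of_nonpos_of_nonneg this hm0
      have h2 : (C.d i : ℤ) * (C.a i j * m j) ≤ 0 :=
        mul_nonpos_of_nonneg_of_nonpos (hdi i).le h1
      exact mul_nonpos_of_nonneg_of_nonpos hp0 h2
  have hdvd : ∀ i, (d : ℤ) ∣ c i * C.d i := fun i => ⟨h i, hc.eq i⟩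
  have hdp : ∀ i, (d : ℤ) ∣ p i * C.d i := fun i => by
    simp only [hp]
    rcases le_total (c i) 0 with h | h
    · rw [max_eq_right h]; simp
    · rw [max_eq_left h]; exact hdvd i
  have hdm : ∀ i, (d : ℤ) ∣ m i * C.d i := fun i => by
    simp only [hm]
    rcases le_total (-c i) 0 with h | h
    · rw [max_eq_right h]; simp
    · rw [max_eq_left h, neg_mul, dvd_neg]; exact hdvd i
  have hnorm : C.bil c c = C.bil p p + C.bil m m - 2 * C.bil p m := by
    rw [hcpm, bil_sub_left, bil_sub_right, bil_sub_right, C.bil_comm m p]; ring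
  have hsign : ∀ i, (0 ≤ c i → 0 ≤ h i) ∧ (c i ≤ 0 → h i ≤ 0) := fun i => by
    have e := hc.eq i
    constructor
    · intro h0
      by_contra hlt
      have : (d : ℤ) * h i < 0 := mul_neg_of_pos_of_neg hd (by omega)
      have := mul_nonneg h0 (hdi i).le
      omega
    · intro h0
      by_contra hlt
      have : 0 < (d : ℤ) * h i := mul_pos hd (by omega)
      have := mul_nonpos_of_nonpos_of_nonneg h0 (hdi i).le
      omega
  by_cases hm0 : m = 0
  · left; intro i
    refine (hsign i).1 ?_
    have := congrFun hm0 i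
    simp only [hm, Pi.zero_apply] at this; omega
  · by_cases hp0 : p = 0
    · right; intro i
      refine (hsign i).2 ?_
      have := congrFun hp0 i
      simp only [hp, Pi.zero_apply] at this; omega
    · have h1 := le_bil_of_dvd hdp hp0
      have h2 := le_bil_of_dvd hdm hm0
      have := hc.norm
      omega

/-- The reflection `sᵣ` permutes the positive coroots other than `αᵣ^∨`. -/
theorem IsCoroot.corefl_nonneg {r : I} (hr : r ∈ X) (hh : C.IsCoroot X h) (h0 : 0 ≤ h)
    (hne : h ≠ Pi.single r 1) : 0 ≤ C.corefl r h := by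
  rcases (hh.corefl hr).nonneg_or_nonpos with h1 | h1
  · exact h1
  -- otherwise `h` is a multiple of `αᵣ^∨`
  exfalso
  have hz : ∀ j, j ≠ r → h j = 0 := fun j hj => by
    have h2 := h1 j
    have h3 := h0 j
    rw [C.corefl_apply_ne hj] at h2
    simp only [Pi.zero_apply] at h2 h3
    omega
  have hs : h = Pi.single r (h r) := by
    funext j
    by_cases hj : j = r
    · subst hj; simp
    · simp [hj, hz j hj]
  obtain ⟨c, d, hc⟩ := hh.exists_root
  have hdr : (0 : ℤ) < C.d r := by exact_mod_cast C.d_pos r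
  have hcs : c = Pi.single r (c r) := by
    funext j
    by_cases hj : j = r
    · subst hj; simp
    · have := hc.eq j
      rw [hz j hj, mul_zero] at this
      have hd := C.d_pos j
      simp only [hj, ne_eq, not_false_eq_true, Pi.single_eq_of_ne]
      rcases mul_eq_zero.mp this with h | h
      · exact h
      · omega
  have hn := hc.norm
  rw [hcs, bil_single_left, cp_single, C.diag] at hn
  have he := hc.eq r
  have hcr : c r ≠ 0 := by
    intro h
    have := hc.pos
    rw [h] at hn
    simp at hn
    omega
  have : c r * h r = 1 := by
    refine mul_left_cancel₀ (mul_ne_zero hcr hdr.ne') ?_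
    have h6 : c r * (C.d r * c r) = d := by linarith
    linear_combination h r * h6 - he
  have hr0 : (0 : ℤ) ≤ h r := h0 r
  have h5 : h r = 1 := by
    have h7 : IsUnit (h r) := IsUnit.of_mul_eq_one (c r) (by rw [mul_comm]; exact this)
    rcases Int.isUnit_iff.mp h7 with h8 | h8
    · exact h8
    · omega
  rw [h5] at hs
  exact hne hs

end CartanDatum

/-! ### Half the sum of the positive coroots -/

namespace CartanDatum

variable {I : Type*} [Fintype I] [DecidableEq I] {C : CartanDatum I} {X : Finset I}

/-- An element of the span of the coroots in `X` that pairs to zero with the roots in `X`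
vanishes. -/
theorem eq_zero_of_rootPair {g : I → ℤ} (hX : ∀ i, i ∉ X → g i = 0)
    (h : ∀ r ∈ X, C.rootPair r g = 0) : g = 0 := by
  classical
  set D : ℤ := ∏ k, (C.d k : ℤ) with hD
  have hd : ∀ i, (C.d i : ℤ) ≠ 0 := fun i => by exact_mod_cast (C.d_pos i).ne'
  have hD0 : D ≠ 0 := Finset.prod_ne_zero_iff.mpr fun i _ => hd i
  have hdvd : ∀ i, (C.d i : ℤ) ∣ D := fun i => Finset.dvd_prod_of_mem _ (Finset.mem_univ i)
  choose e he using hdvd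
  -- the element of the root lattice proportional to `g`
  set c : I → ℤ := fun i => g i * e i with hc
  have hcd : ∀ i, c i * C.d i = D * g i := fun i => by
    simp only [hc]; rw [he i]; ring
  have hcp : ∀ r, C.d r * C.cp r c = D * C.rootPair r g := fun r => by
    rw [rootPair, cp, Finset.mul_sum, Finset.mul_sum]
    refine Finset.sum_congr rfl fun j _ => ?_
    linear_combination (C.a j r) * hcd j + c j * C.symm r j
  have hn : C.bil c c = 0 := by
    refine Finset.sum_eq_zero fun i _ => ?_
    rw [hcp]
    by_cases hi : i ∈ X
    · rw [h i hi]; ring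
    · simp only [hc]; rw [hX i hi]; ring
  have hc0 : c = 0 := by
    by_contra h0
    exact (C.bil_self_pos h0).ne' hn
  funext i
  have := hcd i
  rw [hc0, Pi.zero_apply, zero_mul] at this
  exact (mul_eq_zero.mp this.symm).resolve_left hD0

variable (C X) in
/-- There are finitely many positive coroots, as their pairings with the simple roots are bounded.
-/
theorem finite_coroot : {h : I → ℤ | C.IsCoroot X h ∧ 0 ≤ h}.Finite := by
  have hinj : Set.InjOn (fun (h : I → ℤ) (j : I) => C.rootPair j h)
      {h : I → ℤ | C.IsCoroot X h ∧ 0 ≤ h} := by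
    intro g _ h _ hgh
    rw [← sub_eq_zero]
    refine eq_zero_of_rootPair (X := Finset.univ) (C := C) (by simp) fun r _ => ?_
    rw [rootPair_sub, sub_eq_zero]
    exact congrFun hgh r
  refine Set.Finite.of_finite_image ?_ hinj
  refine (Set.finite_Icc (fun j => -(2 * C.d j : ℤ)) (fun j => (2 * C.d j : ℤ))).subset ?_
  rintro _ ⟨h, ⟨hh, -⟩, rfl⟩
  have hb : ∀ j, |C.rootPair j h| ≤ 2 * C.d j := fun j => by
    obtain ⟨c, d, hc⟩ := hh.exists_root
    have h1 := hc.rootPair j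
    -- the Cauchy-Schwarz inequality for `c` and `αⱼ`
    have h2 := C.bil_self_nonneg ((2 : ℤ) • c + Pi.single j (-C.cp j c))
    rw [bil_add_single, cp_smul, bil_smul_left, bil_smul_right, hc.norm] at h2
    have hd : (0 : ℤ) < d := by exact_mod_cast hc.pos
    have hdj : (0 : ℤ) < C.d j := by exact_mod_cast C.d_pos j
    have h3 : C.d j * (C.cp j c * C.cp j c) ≤ 4 * d := by nlinarith
    have h4 : (d * C.rootPair j h) * (d * C.rootPair j h) ≤ 4 * d * C.d j := by
      rw [h1]; nlinarith
    have h5 : C.rootPair j h * C.rootPair j h ≤ 4 * C.d j := by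
      have h6 : d * (d * (C.rootPair j h * C.rootPair j h)) ≤ d * (4 * C.d j : ℤ) := by nlinarith
      have h7 := le_of_mul_le_mul_left h6 hd
      have h8 := mul_self_nonneg (C.rootPair j h)
      nlinarith
    refine abs_le_of_sq_le_sq ?_ (by omega)
    nlinarith
  exact ⟨fun j => (abs_le.mp (hb j)).1, fun j => (abs_le.mp (hb j)).2⟩

theorem twoRhoCheck_eq : C.twoRhoCheck X = ∑ h ∈ (C.finite_coroot X).toFinset, h :=
  finsum_mem_eq_finite_toFinset_sum _ _

theorem twoRhoCheck_support {i : I} (hi : i ∉ X) : C.twoRhoCheck X i = 0 := by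
  rw [twoRhoCheck_eq, Finset.sum_apply]
  refine Finset.sum_eq_zero fun h hh => ?_
  rw [Set.Finite.mem_toFinset] at hh
  exact hh.1.support hi

/-- The simple roots in `X` pair to `1` with `ρ_X^∨`. -/
theorem rootPair_twoRhoCheck {r : I} (hr : r ∈ X) : C.rootPair r (C.twoRhoCheck X) = 2 := by
  rw [twoRhoCheck_eq, rootPair_sum]
  have hmem : (Pi.single r 1 : I → ℤ) ∈ (C.finite_coroot X).toFinset := by
    rw [Set.Finite.mem_toFinset]
    exact ⟨IsCoroot.simple r hr, Pi.single_nonneg.mpr zero_le_one⟩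
  rw [← Finset.add_sum_erase _ _ hmem, rootPair_single, C.diag]
  have key : ∑ h ∈ (C.finite_coroot X).toFinset.erase (Pi.single r 1), C.rootPair r h =
      ∑ h ∈ (C.finite_coroot X).toFinset.erase (Pi.single r 1), -C.rootPair r h := by
    have hmaps : ∀ h ∈ (C.finite_coroot X).toFinset.erase (Pi.single r 1),
        C.corefl r h ∈ (C.finite_coroot X).toFinset.erase (Pi.single r 1) := by
      intro h hh
      rw [Finset.mem_erase, Set.Finite.mem_toFinset] at hh ⊢
      refine ⟨fun he => ?_, hh.2.1.corefl hr, hh.2.1.corefl_nonneg hr hh.2.2 hh.1⟩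
      have h1 : h = -Pi.single r 1 := by
        rw [← C.corefl_corefl r h, he, corefl, rootPair_single, C.diag]
        module
      have h2 := hh.2.2 r
      rw [h1] at h2
      simp at h2
    refine Finset.sum_nbij' (C.corefl r) (C.corefl r) hmaps hmaps
      (fun h _ => C.corefl_corefl r h) (fun h _ => C.corefl_corefl r h) fun h _ => ?_
    rw [rootPair_corefl, neg_neg]
  rw [Finset.sum_neg_distrib] at key
  omega

/-! ### Reduced words -/

variable (C) in
theorem wordAct_cons (i : I) (u : List I) (ω : I → ℤ) :
    C.wordAct (i :: u) ω = C.refl i (C.wordAct u ω) := rfl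

theorem wordAct_append (u v : List I) (ω : I → ℤ) :
    C.wordAct (u ++ v) ω = C.wordAct u (C.wordAct v ω) := by
  simp [wordAct]

theorem refl_sub (i : I) (ω χ : I → ℤ) : C.refl i (ω - χ) = C.refl i ω - C.refl i χ := by
  simp only [refl, Pi.sub_apply]; module

theorem refl_smul (i : I) (k : ℤ) (ω : I → ℤ) : C.refl i (k • ω) = k • C.refl i ω := by
  simp only [refl, Pi.smul_apply, smul_eq_mul]; module

theorem wordAct_add (u : List I) (ω χ : I → ℤ) :
    C.wordAct u (ω + χ) = C.wordAct u ω + C.wordAct u χ := by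
  induction u with
  | nil => rfl
  | cons i u ih => simp only [wordAct_cons, ih, refl_add]

theorem wordAct_sub (u : List I) (ω χ : I → ℤ) :
    C.wordAct u (ω - χ) = C.wordAct u ω - C.wordAct u χ := by
  induction u with
  | nil => rfl
  | cons i u ih => simp only [wordAct_cons, ih, refl_sub]

theorem wordAct_smul (u : List I) (k : ℤ) (ω : I → ℤ) :
    C.wordAct u (k • ω) = k • C.wordAct u ω := by
  induction u with
  | nil => rfl
  | cons i u ih => simp only [wordAct_cons, ih, refl_smul]

variable (C) in
/-- The transpose of the Weyl group element of a word, acting on the coroot lattice. -/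
def cowordAct (u : List I) (h : I → ℤ) : I → ℤ := u.foldl (fun h i => C.corefl i h) h

theorem sum_refl_mul (i : I) (ω h : I → ℤ) :
    ∑ j, C.refl i ω j * h j = ∑ j, ω j * C.corefl i h j := by
  have e1 : ∑ j, C.refl i ω j * h j = ∑ j, ω j * h j - ω i * C.rootPair i h := by
    rw [rootPair, Finset.mul_sum, ← Finset.sum_sub_distrib]
    refine Finset.sum_congr rfl fun j _ => ?_
    simp only [refl, root, Pi.sub_apply, Pi.smul_apply, smul_eq_mul]
    ring
  have e2 : ∑ j, ω j * C.corefl i h j = ∑ j, ω j * h j - ω i * C.rootPair i h := by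
    simp [corefl, mul_sub, Finset.sum_sub_distrib, Pi.single_apply]
  rw [e1, e2]

theorem sum_wordAct_mul (u : List I) (ω h : I → ℤ) :
    ∑ j, C.wordAct u ω j * h j = ∑ j, ω j * C.cowordAct u h j := by
  induction u generalizing h with
  | nil => rfl
  | cons i u ih =>
    rw [wordAct_cons, sum_refl_mul, ih]
    rfl

theorem wordAct_apply (u : List I) (ω : I → ℤ) (k : I) :
    C.wordAct u ω k = ∑ j, ω j * C.cowordAct u (Pi.single k 1) j := by
  rw [← sum_wordAct_mul]; simp [Pi.single_apply]

theorem cowordAct_support {h : I → ℤ} (hh : ∀ i, i ∉ X → h i = 0) {u : List I}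
    (hu : ∀ r ∈ u, r ∈ X) {i : I} (hi : i ∉ X) : C.cowordAct u h i = 0 := by
  induction u generalizing h with
  | nil => exact hh i hi
  | cons r u ih =>
    refine ih (fun j hj => ?_) fun r hr => hu r (by simp [hr])
    rw [show (fun h i => C.corefl i h) h r j = C.corefl r h j from rfl, corefl_apply_ne]
    · exact hh j hj
    · rintro rfl; exact hj (hu j (by simp))

/-- When a word makes a positive coroot negative, the sign changes at a letter whose simple coroot
has been reached. -/
theorem IsCoroot.exists_simple {h : I → ℤ} (hh : C.IsCoroot X h) (h0 : 0 ≤ h) {u : List I}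
    (hu : ∀ r ∈ u, r ∈ X) (hneg : ¬ 0 ≤ C.cowordAct u h) :
    ∃ u₁ i u₂, u = u₁ ++ i :: u₂ ∧ C.cowordAct u₁ h = Pi.single i 1 := by
  induction u generalizing h with
  | nil => exact absurd h0 hneg
  | cons i u ih =>
    have hi : i ∈ X := hu i (by simp)
    by_cases he : h = Pi.single i 1
    · exact ⟨[], i, u, rfl, he⟩
    · obtain ⟨u₁, j, u₂, h1, h2⟩ := ih (hh.corefl hi) (hh.corefl_nonneg hi h0 he)
        (fun r hr => hu r (by simp [hr])) hneg
      exact ⟨i :: u₁, j, u₂, by rw [h1]; rfl, h2⟩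

variable (C) in
/-- The element `∑ⱼ n j • αⱼ` of the weight lattice. -/
def ofRoot (n : I → ℤ) : I → ℤ := fun i => C.cp i n

variable (C) in
/-- The simple reflection on the root lattice, in coordinates with respect to the simple roots. -/
def rrefl (i : I) (n : I → ℤ) : I → ℤ := n + Pi.single i (-C.cp i n)

theorem ofRoot_rrefl (i : I) (n : I → ℤ) : C.ofRoot (C.rrefl i n) = C.refl i (C.ofRoot n) := by
  funext j
  simp only [ofRoot, rrefl, refl, cp_add, cp_single, root, Pi.sub_apply, Pi.smul_apply, smul_eq_mul]
  ring

theorem ofRoot_single (i : I) : C.ofRoot (Pi.single i 1) = C.root i := by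
  funext j; simp [ofRoot, cp_single, root]

theorem bil_rrefl (i : I) (m n : I → ℤ) : C.bil (C.rrefl i m) (C.rrefl i n) = C.bil m n := by
  simp only [rrefl, bil_add_left, bil_add_right, bil_single_left, bil_single_right, cp_add,
    cp_single, C.diag]
  ring

theorem rrefl_rrefl (i : I) (n : I → ℤ) : C.rrefl i (C.rrefl i n) = n := by
  simp only [rrefl, cp_add, cp_single, C.diag]
  rw [add_assoc, ← Pi.single_add]
  ring_nf
  simp

variable (C) in
/-- The Weyl group element of a word, acting on the root lattice. -/
def rwordAct (u : List I) (n : I → ℤ) : I → ℤ := u.foldr C.rrefl n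

variable (C) in
theorem rwordAct_cons (i : I) (u : List I) (n : I → ℤ) :
    C.rwordAct (i :: u) n = C.rrefl i (C.rwordAct u n) := rfl

theorem ofRoot_rwordAct (u : List I) (n : I → ℤ) :
    C.ofRoot (C.rwordAct u n) = C.wordAct u (C.ofRoot n) := by
  induction u with
  | nil => rfl
  | cons i u ih => rw [rwordAct_cons, ofRoot_rrefl, ih, wordAct_cons]

theorem bil_rwordAct (u : List I) (m n : I → ℤ) :
    C.bil (C.rwordAct u m) (C.rwordAct u n) = C.bil m n := by
  induction u with
  | nil => rfl
  | cons i u ih => rw [rwordAct_cons, rwordAct_cons, bil_rrefl, ih]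

variable (C) in
theorem rwordAct_surjective (u : List I) : Function.Surjective (C.rwordAct u) := by
  induction u with
  | nil => exact fun n => ⟨n, rfl⟩
  | cons i u ih =>
    intro n
    obtain ⟨m, hm⟩ := ih (C.rrefl i n)
    exact ⟨m, by rw [rwordAct_cons, hm, rrefl_rrefl]⟩

theorem rwordAct_apply_of_notMem {u : List I} (hu : ∀ r ∈ u, r ∈ X) (n : I → ℤ) {i : I}
    (hi : i ∉ X) : C.rwordAct u n i = n i := by
  induction u with
  | nil => rfl
  | cons r u ih =>
    have hir : i ≠ r := by rintro rfl; exact hi (hu i (by simp))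
    rw [rwordAct_cons, rrefl, Pi.add_apply, Pi.single_eq_of_ne hir, add_zero]
    exact ih fun k hk => hu k (by simp [hk])

/-- If a Weyl group element is dual to a map of coroots that sends `αₖ^∨` to `αᵢ^∨`, it sends
`αᵢ` to `αₖ`. -/
theorem wordAct_root_of_cowordAct {u : List I} {i k : I}
    (h : C.cowordAct u (Pi.single k 1) = Pi.single i 1) : C.wordAct u (C.root i) = C.root k := by
  set f := C.rwordAct u
  have hk : ∀ ω, C.wordAct u ω k = ω i := fun ω => by
    rw [wordAct_apply, h]; simp [Pi.single_apply]
  have hcp : ∀ n, C.cp k (f n) = C.cp i n := fun n => by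
    have := congrFun (ofRoot_rwordAct (C := C) u n) k
    rw [hk] at this
    exact this
  have horth : ∀ n, C.bil (f n) ((C.d i : ℤ) • Pi.single k 1 - (C.d k : ℤ) • f (Pi.single i 1)) =
      0 := fun n => by
    rw [bil_sub_right, bil_smul_right, bil_smul_right, bil_rwordAct, bil_single_right,
      bil_single_right, hcp]
    ring
  have hz : (C.d i : ℤ) • Pi.single k 1 - (C.d k : ℤ) • f (Pi.single i 1) = 0 := by
    by_contra h0
    obtain ⟨n, hn⟩ := C.rwordAct_surjective u
      ((C.d i : ℤ) • Pi.single k 1 - (C.d k : ℤ) • f (Pi.single i 1))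
    have := horth n
    rw [show f n = _ from hn] at this
    exact (C.bil_self_pos h0).ne' this
  rw [sub_eq_zero] at hz
  have hdi : (0 : ℤ) < C.d i := by exact_mod_cast C.d_pos i
  have hdk : (0 : ℤ) < C.d k := by exact_mod_cast C.d_pos k
  have hn : C.bil ((C.d i : ℤ) • Pi.single k 1) ((C.d i : ℤ) • Pi.single k 1) =
      C.bil ((C.d k : ℤ) • f (Pi.single i 1)) ((C.d k : ℤ) • f (Pi.single i 1)) := by rw [hz]
  simp only [bil_smul_left, bil_smul_right, show ∀ m n, C.bil (f m) (f n) = C.bil m n from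
    bil_rwordAct u, bil_single_left, cp_single, C.diag] at hn
  have hd : (C.d i : ℤ) = C.d k := by
    have hne : (2 * C.d i * C.d k : ℤ) ≠ 0 := by positivity
    refine mul_left_cancel₀ hne ?_
    linarith
  rw [hd] at hz
  have hf : f (Pi.single i 1) = Pi.single k 1 := (smul_right_injective _ hdk.ne' hz).symm
  rw [← ofRoot_single, ← ofRoot_rwordAct, show C.rwordAct u _ = _ from hf, ofRoot_single]

theorem IsReducedWord.tail {k : I} {u : List I} (h : C.IsReducedWord (k :: u)) :
    C.IsReducedWord u := fun l' hl' => by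
  have : C.wordAct (k :: l') = C.wordAct (k :: u) := by
    funext ω
    rw [wordAct_cons, wordAct_cons, hl']
  simpa using h _ this

/-- The exchange property: the transpose of a reduced word keeps the simple coroot of a letter that
can be put in front of it positive. -/
theorem IsReducedWord.cowordAct_nonneg {k : I} {u : List I} (h : C.IsReducedWord (k :: u))
    (hk : k ∈ X) (hu : ∀ r ∈ u, r ∈ X) : 0 ≤ C.cowordAct u (Pi.single k 1) := by
  by_contra hneg
  obtain ⟨u₁, i, u₂, rfl, h2⟩ := (IsCoroot.simple k hk).exists_simple
    (Pi.single_nonneg.mpr zero_le_one) hu hneg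
  have h3 := wordAct_root_of_cowordAct h2
  have h4 : C.wordAct (u₁ ++ u₂) = C.wordAct (k :: (u₁ ++ i :: u₂)) := by
    funext ω
    rw [wordAct_cons, wordAct_append, wordAct_append, wordAct_cons]
    set χ := C.wordAct u₂ ω
    have h5 : C.wordAct u₁ (C.refl i χ) k = C.refl i χ i := by
      rw [wordAct_apply, h2]; simp [Pi.single_apply]
    have h6 : C.refl i χ i = -χ i := by
      simp [refl, root, C.diag]; ring
    rw [refl, h5, h6, refl, wordAct_sub, wordAct_smul, h3]
    module
  have := h _ h4
  simp at this

/-- Along a reduced word in `X`, the images of a simple root outside `X` pair nonpositively with the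
next letter. -/
theorem IsReducedWord.wordAct_root_nonpos {k t : I} {u : List I} (h : C.IsReducedWord (k :: u))
    (hk : k ∈ X) (hu : ∀ r ∈ u, r ∈ X) (ht : t ∉ X) : C.wordAct u (C.root t) k ≤ 0 := by
  have h0 := h.cowordAct_nonneg hk hu
  have hs : ∀ i, i ∉ X → (Pi.single k 1 : I → ℤ) i = 0 := fun i hi => by
    have : i ≠ k := by rintro rfl; exact hi hk
    simp [this]
  rw [wordAct_apply]
  refine Finset.sum_nonpos fun j _ => ?_
  by_cases hj : j = t
  · subst hj
    rw [cowordAct_support hs hu ht, mul_zero]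
  · exact mul_nonpos_of_nonpos_of_nonneg (C.offdiag j t hj) (h0 j)

variable (C) in
/-- The sum of the numbers `-⟨u ω, αᵣ^∨⟩`, over the suffixes `r :: u` of a word. -/
def lowering (ω : I → ℤ) : List I → ℤ
  | [] => 0
  | k :: u => -C.wordAct u ω k + lowering ω u

theorem sum_wordAct_mul_twoRhoCheck {u : List I} (hu : ∀ r ∈ u, r ∈ X) (ω : I → ℤ) :
    ∑ j, C.wordAct u ω j * C.twoRhoCheck X j =
      ∑ j, ω j * C.twoRhoCheck X j + 2 * C.lowering ω u := by
  induction u with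
  | nil => simp [lowering, wordAct]
  | cons k u ih =>
    rw [wordAct_cons, sum_refl_mul, lowering, corefl,
      rootPair_twoRhoCheck (hu k (by simp))]
    simp only [Pi.sub_apply, mul_sub, Finset.sum_sub_distrib]
    rw [ih fun r hr => hu r (by simp [hr])]
    simp [Pi.single_apply]
    ring

end CartanDatum

namespace AdmissiblePair

variable {I : Type*} [Fintype I] [DecidableEq I] {C : CartanDatum I} (S : AdmissiblePair C)
variable {w : List I}

/-- `w_X` maps `ρ_X^∨` to its negative. -/
theorem cowordAct_twoRhoCheck (hw : C.IsLongestWord S.X w) :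
    C.cowordAct w (C.twoRhoCheck S.X) = -C.twoRhoCheck S.X := by
  rw [← sub_eq_zero, sub_neg_eq_add]
  refine CartanDatum.eq_zero_of_rootPair (C := C) (X := S.X) (fun i hi => ?_) fun r hr => ?_
  · rw [Pi.add_apply, CartanDatum.twoRhoCheck_support hi, CartanDatum.cowordAct_support
      (fun j hj => CartanDatum.twoRhoCheck_support hj) hw.1 hi, add_zero]
  · have h1 : C.rootPair r (C.cowordAct w (C.twoRhoCheck S.X)) =
        ∑ j, C.root r j * C.cowordAct w (C.twoRhoCheck S.X) j :=
      Finset.sum_congr rfl fun _ _ => mul_comm _ _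
    have h2 := CartanDatum.rootPair_twoRhoCheck (C := C) (S.τ_X r hr)
    rw [CartanDatum.rootPair_add, h1, ← CartanDatum.sum_wordAct_mul, S.τ_longest w hw r hr,
      CartanDatum.rootPair_twoRhoCheck hr]
    have h3 : ∑ j, (-C.root (S.τ r)) j * C.twoRhoCheck S.X j =
        -C.rootPair (S.τ r) (C.twoRhoCheck S.X) := by
      simp [CartanDatum.rootPair, CartanDatum.root, mul_comm]
    rw [h3, h2]; norm_num

/-- The height by which `w_X` raises `αₜ` is `-2 ⟨αₜ, ρ_X^∨⟩`. -/
theorem lowering_root (hw : C.IsLongestWord S.X w) (t : I) :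
    C.lowering (C.root t) w = -C.twoRhoPairing S.X t := by
  have h1 := CartanDatum.sum_wordAct_mul_twoRhoCheck (C := C) hw.1 (C.root t)
  rw [CartanDatum.sum_wordAct_mul, S.cowordAct_twoRhoCheck hw] at h1
  have h2 : ∑ j, C.root t j * C.twoRhoCheck S.X j = C.twoRhoPairing S.X t := rfl
  simp only [Pi.neg_apply, mul_neg, Finset.sum_neg_distrib] at h1
  rw [h2] at h1
  omega

end AdmissiblePair

/-! ### Extremal vectors -/

namespace QTriple

variable {A : Type*} [Ring A] [Algebra ℂ A] {v : ℂ} {t : QTriple A v}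

theorem InG.exists_adE_pow_eq_zero {ν : ℤ} {x X : A} (h : t.InG ν x X) :
    ∃ N, (t.adE ^ N) x = 0 := by
  induction h with
  | @good b l L h k ν hν =>
    refine ⟨b + 1, ?_⟩
    rw [dE_def, map_smul, ← Module.End.mul_apply, ← pow_add, add_comm, pow_add,
      Module.End.mul_apply, h.nil, map_zero, smul_zero]
  | zero ν => exact ⟨0, map_zero _⟩
  | add _ _ ih ih' =>
    obtain ⟨N, hN⟩ := ih
    obtain ⟨M, hM⟩ := ih'
    refine ⟨N + M, ?_⟩
    have h1 : ∀ z, (t.adE ^ (N + M)) z = (t.adE ^ M) ((t.adE ^ N) z) := fun z => by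
      rw [add_comm, pow_add, Module.End.mul_apply]
    rw [map_add, h1, hN, map_zero, zero_add, pow_add, Module.End.mul_apply, hM, map_zero]

variable (t) in
/-- Multiplication by `(z, Z)` preserves the pairs `InG` and raises weights by `ν`. -/
def Mult (ν : ℤ) (z Z : A) : Prop := ∀ ⦃μ x X⦄, t.InG μ x X → t.InG (ν + μ) (z * x) (Z * X)

namespace Mult

variable {ν μ : ℤ} {y Y z Z : A}

theorem inG (h : t.Mult ν z Z) : t.InG ν z Z := by
  have := h InG.one
  rw [mul_one, mul_one] at this
  exact this.cast (by ring)

theorem cast (h : t.Mult ν z Z) (e : ν = μ) : t.Mult μ z Z := e ▸ h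

theorem zero (ν : ℤ) : t.Mult ν 0 0 := fun μ x X _ => by
  rw [zero_mul, zero_mul]; exact .zero _

theorem add (h : t.Mult ν y Y) (h' : t.Mult ν z Z) : t.Mult ν (y + z) (Y + Z) :=
  fun μ x X hx => by
    rw [add_mul, add_mul]; exact (h hx).add (h' hx)

theorem smul (h : t.Mult ν z Z) (c : ℂ) : t.Mult ν (c • z) (c • Z) := fun μ x X hx => by
  rw [smul_mul_assoc, smul_mul_assoc]; exact (h hx).smul c

theorem sub (h : t.Mult ν y Y) (h' : t.Mult ν z Z) : t.Mult ν (y - z) (Y - Z) :=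
  fun μ x X hx => by
    rw [sub_mul, sub_mul]; exact (h hx).sub (h' hx)

theorem mul (h : t.Mult ν y Y) (h' : t.Mult μ z Z) : t.Mult (ν + μ) (y * z) (Y * Z) :=
  fun κ x X hx => by
    rw [mul_assoc, mul_assoc]; exact (h (h' hx)).cast (by ring)

theorem adE (h : t.Mult ν z Z) : t.Mult (ν + 2) (t.adE z) (t.flip.adE Z) := fun μ x X hx => by
  have e1 := t.adE_mul h.inG.wt x
  have e2 := t.flip.adE_mul h.inG.flip_wt X
  rw [eq_sub_of_add_eq e1.symm, eq_sub_of_add_eq e2.symm]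
  exact ((h hx).adE.cast (by ring)).sub (((h hx.adE).cast (by ring)).smul _)

theorem of_good {a : ℕ} (h : t.Good a z Z) (ha : a ≤ 3) : t.Mult (-a) z Z := fun μ x X hx =>
  (hx.good_mul h ha).cast (by ring)

end Mult

end QTriple

namespace CartanDatum

variable {I : Type*} [Fintype I] [DecidableEq I] {C : CartanDatum I} {q : Set.Ioo (0 : ℝ) 1}
variable {X : Finset I} {s : I}

theorem adF_adE_comm {i j : I} (h : i ≠ j) {n : I → ℤ} {x : C.U q} (hx : C.HasWt n x) :
    (C.triple q i).adF ((C.triple q j).adE x) = (C.triple q j).adE ((C.triple q i).adF x) := by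
  have hEF : C.E q j * C.F q i = C.F q i * C.E q j := sub_eq_zero.mp (C.E_F j i h.symm)
  have hy := hx.adF i
  rw [((hx.wt j)).adE_eq, (hy.wt j).adE_eq, QTriple.adF_def, QTriple.adF_def]
  have hc : C.qr q j ^ C.cp j (n - Pi.single i 1) * qc q ^ C.form (C.root i) j =
      C.qr q j ^ C.cp j n := by
    rw [qr_zpow, qr_zpow, ← zpow_add₀ qc_ne, cp_sub, cp_single, form, root]
    congr 1; ring
  change (C.F q i * (C.E q j * x - C.qr q j ^ C.cp j n • (x * C.E q j)) -
      (C.E q j * x - C.qr q j ^ C.cp j n • (x * C.E q j)) * C.F q i) * C.K q (C.root i) =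
    C.E q j * ((C.F q i * x - x * C.F q i) * C.K q (C.root i)) -
      C.qr q j ^ C.cp j (n - Pi.single i 1) •
        ((C.F q i * x - x * C.F q i) * C.K q (C.root i) * C.E q j)
  rw [mul_assoc _ (C.K q (C.root i)), K_E, mul_smul_comm, smul_smul, hc]
  simp only [mul_sub, sub_mul, mul_smul_comm, smul_mul_assoc, smul_sub, ← mul_assoc, ← hEF]
  rw [mul_assoc x (C.E q j), hEF, ← mul_assoc]
  abel

theorem E_mul_E {i j : I} (h : i ≠ j) (ha : C.a i j = 0) :
    C.E q i * C.E q j = C.E q j * C.E q i := by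
  have h1 := C.serre_E (q := q) i j h
  have hN : C.serreN i j = 1 := by simp [serreN, ha]
  have hne : qInt (C.qr q i) 1 ≠ 0 := by
    rw [qInt_eq_br]; exact (C.triple q i).br_ne_zero one_ne_zero
  have hb0 : qBinom (C.qr q i) 1 0 = 1 := by
    simp [qBinom, qFact, hne]
  have hb1 : qBinom (C.qr q i) 1 1 = 1 := by
    simp [qBinom, qFact, hne]
  rw [serre, hN, Finset.sum_range_succ, Finset.sum_range_one, hb0, hb1] at h1
  simp only [pow_zero, pow_one, one_mul, mul_one, one_smul, Nat.sub_zero, Nat.sub_self] at h1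
  rw [neg_one_smul, ← sub_eq_add_neg] at h1
  exact sub_eq_zero.mp h1

theorem adE_adE_comm {i j : I} (h : i ≠ j) (ha : C.a i j = 0) {n : I → ℤ} {x : C.U q}
    (hx : C.HasWt n x) :
    (C.triple q i).adE ((C.triple q j).adE x) = (C.triple q j).adE ((C.triple q i).adE x) := by
  have hE := C.E_mul_E (q := q) h ha
  rw [((hx.adE j).wt i).adE_eq, ((hx.adE i).wt j).adE_eq, (hx.wt j).adE_eq, (hx.wt i).adE_eq,
    cp_add, cp_add, cp_single, cp_single, ha, C.a_eq_zero_symm ha]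
  change C.E q i * (C.E q j * x - C.qr q j ^ C.cp j n • (x * C.E q j)) -
      C.qr q i ^ (C.cp i n + 0 * 1) • ((C.E q j * x - C.qr q j ^ C.cp j n • (x * C.E q j)) *
        C.E q i) =
    C.E q j * (C.E q i * x - C.qr q i ^ C.cp i n • (x * C.E q i)) -
      C.qr q j ^ (C.cp j n + 0 * 1) • ((C.E q i * x - C.qr q i ^ C.cp i n • (x * C.E q i)) *
        C.E q j)
  simp only [mul_sub, sub_mul, mul_smul_comm, smul_mul_assoc, smul_sub, ← mul_assoc, zero_mul,
    add_zero, hE]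
  rw [mul_assoc x (C.E q j), ← hE, ← mul_assoc,
    smul_comm (C.qr q i ^ C.cp i n) (C.qr q j ^ C.cp j n)]
  abel

theorem dE_dE_comm {i j : I} (h : i ≠ j) (ha : C.a i j = 0) {n : I → ℤ} {x : C.U q}
    (hx : C.HasWt n x) (k m : ℕ) :
    (C.triple q i).dE k ((C.triple q j).dE m x) = (C.triple q j).dE m ((C.triple q i).dE k x) := by
  have h1 : ∀ (m : ℕ) {n : I → ℤ} {x : C.U q}, C.HasWt n x →
      (C.triple q i).adE ((C.triple q j).dE m x) = (C.triple q j).dE m ((C.triple q i).adE x) := by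
    intro m
    induction m with
    | zero => intro n x hx; simp [QTriple.dE_zero]
    | succ m ih =>
      intro n x hx
      rw [QTriple.dE_succ, map_smul, adE_adE_comm h ha (hx.dE j m), ih hx, ← QTriple.dE_succ]
  induction k with
  | zero => simp [QTriple.dE_zero]
  | succ k ih =>
    rw [QTriple.dE_succ, ih, h1 m (hx.dE i k), ← map_smul, ← QTriple.dE_succ]

variable (C q X s) in
/-- The weight vectors of the module generated by `Eₛ` under the adjoint action of the `Eᵢ`,
`i ∈ X`. -/
inductive Lad : (I → ℤ) → C.U q → Prop
  | base : Lad (Pi.single s 1) (C.E q s)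
  | adE {i : I} (hi : i ∈ X) {n : I → ℤ} {y : C.U q} (hy : Lad n y) :
      Lad (n + Pi.single i 1) ((C.triple q i).adE y)
  | zero (n : I → ℤ) : Lad n 0
  | add {n : I → ℤ} {x y : C.U q} (hx : Lad n x) (hy : Lad n y) : Lad n (x + y)
  | smul {n : I → ℤ} (c : ℂ) {x : C.U q} (hx : Lad n x) : Lad n (c • x)

namespace Lad

variable {n m : I → ℤ} {x y : C.U q}

theorem cast (h : C.Lad q X s n x) (e : n = m) : C.Lad q X s m x := e ▸ h

theorem hasWt (h : C.Lad q X s n x) : C.HasWt n x := by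
  induction h with
  | base => exact .E s
  | adE hi _ ih => exact ih.adE _
  | zero n => intro ω; simp
  | add _ _ ih ih' => exact ih.add ih'
  | smul c _ ih => exact ih.smul c

theorem sub (hx : C.Lad q X s n x) (hy : C.Lad q X s n y) : C.Lad q X s n (x - y) := by
  rw [sub_eq_add_neg, ← neg_one_smul ℂ y]; exact hx.add (hy.smul _)

theorem dE {i : I} (hi : i ∈ X) (h : C.Lad q X s n x) (k : ℕ) :
    C.Lad q X s (n + Pi.single i (k : ℤ)) ((C.triple q i).dE k x) := by
  induction k with
  | zero => simpa [QTriple.dE_zero] using h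
  | succ k ih =>
    rw [QTriple.dE_succ]
    refine ((ih.adE hi).smul _).cast ?_
    rw [add_assoc, ← Pi.single_add]; push_cast; rfl

theorem adF {i : I} (hi : i ∈ X) (hs : s ∉ X) (h : C.Lad q X s n x) :
    C.Lad q X s (n - Pi.single i 1) ((C.triple q i).adF x) := by
  induction h with
  | base =>
    have his : i ≠ s := by rintro rfl; exact hs hi
    rw [(C.good_E his).low]; exact .zero _
  | @adE j hj n y hy ih =>
    by_cases hij : i = j
    · subst hij
      rw [QTriple.adF_adE _ (hy.hasWt.wt i), add_sub_cancel_right]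
      exact ((ih.adE hi).cast (by rw [sub_add_cancel])).sub (hy.smul _)
    · rw [adF_adE_comm hij hy.hasWt]
      exact (ih.adE hj).cast (by abel)
  | zero n => rw [map_zero]; exact .zero _
  | add _ _ ih ih' => rw [map_add]; exact ih.add ih'
  | smul c _ ih => rw [map_smul]; exact ih.smul c

theorem adF_pow {i : I} (hi : i ∈ X) (hs : s ∉ X) (h : C.Lad q X s n x) (k : ℕ) :
    C.Lad q X s (n - Pi.single i (k : ℤ)) (((C.triple q i).adF ^ k) x) := by
  induction k with
  | zero => simpa using h
  | succ k ih =>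
    rw [pow_succ', Module.End.mul_apply]
    refine (ih.adF hi hs).cast ?_
    push_cast
    rw [Pi.single_add]; abel

/-- The pairs of an element of the module and its image under `Tᵢ` act on `InG` by multiplication.
-/
theorem mult {i : I} (hi : i ∈ X) (hs : s ∉ X) (h : C.Lad q X s n x) :
    (C.triple q i).Mult (C.cp i n) x (C.T q i x) := by
  have hgood : ∀ {j}, i ≠ j → (C.triple q i).Mult (C.cp i (Pi.single j 1)) (C.E q j)
      (C.T q i (C.E q j)) := fun {j} hij => by
    rw [T_E hij]
    refine (QTriple.Mult.of_good (C.good_E hij) (C.toNat_neg_a_le hij)).cast ?_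
    rw [cp_single, C.coe_toNat_neg_a hij]; ring
  induction h with
  | base => exact hgood (by rintro rfl; exact hs hi)
  | @adE j hj n y hy ih =>
    by_cases hij : i = j
    · subst hij
      have e : C.T q i ((C.triple q i).adE y) = (C.triple q i).flip.adE (C.T q i y) := by
        rw [(hy.hasWt.wt i).adE_eq, ih.inG.flip_wt.adE_eq, map_sub, map_smul, map_mul, map_mul]
        change C.T q i (C.E q i) * _ - _ • (_ * C.T q i (C.E q i)) = _
        rw [T_E_self]
      rw [e]
      refine ih.adE.cast ?_
      rw [cp_add, cp_single, C.diag]; ring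
    · rw [(hy.hasWt.wt j).adE_eq, map_sub, map_smul, map_mul, map_mul]
      refine QTriple.Mult.sub (((hgood hij).mul ih).cast ?_) (((ih.mul (hgood hij)).cast ?_).smul _)
      · rw [cp_add, add_comm]
      · rw [cp_add]
  | zero n => rw [map_zero]; exact .zero _
  | add _ _ ih ih' => rw [map_add]; exact ih.add ih'
  | smul c _ ih => rw [map_smul]; exact ih.smul c

theorem coeff (hs : s ∉ X) (h : C.Lad q X s n x) (h0 : x ≠ 0) :
    n s = 1 ∧ (∀ j, 0 ≤ n j) ∧ ∀ j, j ∉ X → j ≠ s → n j = 0 := by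
  induction h with
  | base =>
    refine ⟨by simp, fun j => ?_, fun j _ hj => by simp [hj]⟩
    exact (Pi.single_nonneg.mpr zero_le_one : (0 : I → ℤ) ≤ Pi.single s 1) j
  | @adE i hi n y hy ih =>
    obtain ⟨h1, h2, h3⟩ := ih (by rintro rfl; exact h0 (map_zero _))
    have h4 : ∀ j, 0 ≤ (Pi.single i 1 : I → ℤ) j :=
      (Pi.single_nonneg.mpr zero_le_one : (0 : I → ℤ) ≤ Pi.single i 1)
    have h5 : ∀ j, j ∉ X → (Pi.single i 1 : I → ℤ) j = 0 := fun j hj => by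
      have : j ≠ i := by rintro rfl; exact hj hi
      simp [this]
    refine ⟨?_, fun j => add_nonneg (h2 j) (h4 j), fun j hj hjs => ?_⟩
    · rw [Pi.add_apply, h5 s hs, h1, add_zero]
    · rw [Pi.add_apply, h5 j hj, h3 j hj hjs, add_zero]
  | zero n => exact absurd rfl h0
  | @add n x y _ _ ih ih' =>
    by_cases hx : x = 0
    · exact ih' (by rintro rfl; exact h0 (by rw [hx, add_zero]))
    · exact ih hx
  | smul c _ ih => exact ih (by rintro rfl; exact h0 (smul_zero _))

/-- The weights of the module are not longer than `αₛ`: a weight vector can be moved by the `Fᵢ` to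
an antidominant weight without changing the length of its weight. -/
theorem bil_le (hs : s ∉ X) (h : C.Lad q X s n x) (h0 : x ≠ 0) :
    C.bil n n ≤ C.bil (Pi.single s 1) (Pi.single s 1) := by
  obtain ⟨N, hN⟩ : ∃ N : ℕ, ∑ j, n j ≤ N := ⟨(∑ j, n j).toNat, Int.self_le_toNat _⟩
  induction N generalizing n x with
  | zero =>
    obtain ⟨h1, h2, -⟩ := h.coeff hs h0
    have := Finset.single_le_sum (f := n) (fun j _ => h2 j) (Finset.mem_univ s)
    rw [h1] at this
    simp at hN
    omega
  | succ N ih =>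
    by_cases hex : ∃ i ∈ X, 0 < C.cp i n
    · obtain ⟨i, hi, hp⟩ := hex
      obtain ⟨p, hpe⟩ := Int.eq_ofNat_of_zero_le hp.le
      obtain ⟨M, hM⟩ := (h.mult hi hs).inG.exists_adE_pow_eq_zero
      have h1 : ((C.triple q i).adF ^ p) x ≠ 0 := fun he =>
        h0 ((C.triple q i).eq_zero_of_adF_pow ((h.hasWt.wt i).cast hpe) hM he)
      have h2 := ih (h.adF_pow hi hs p) h1 (by
        have hsum : ∑ j, (n - Pi.single i (p : ℤ) : I → ℤ) j = ∑ j, n j - p := by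
          simp [Finset.sum_sub_distrib, Pi.single_apply]
        rw [hsum]; push_cast at hN; omega)
      rw [sub_eq_add_neg, ← Pi.single_neg, bil_add_single, hpe] at h2
      linarith
    · push Not at hex
      obtain ⟨h1, h2, h3⟩ := h.coeff hs h0
      have hd : ∀ i, (0 : ℤ) ≤ C.d i := fun i => Int.natCast_nonneg _
      have e1 : C.bil n n ≤ C.bil (Pi.single s 1) n := by
        refine Finset.sum_le_sum fun i _ => ?_
        by_cases his : i = s
        · subst his; simp [h1]
        · rw [Pi.single_eq_of_ne his, zero_mul]
          by_cases hi : i ∈ X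
          · exact mul_nonpos_of_nonneg_of_nonpos (h2 i)
              (mul_nonpos_of_nonneg_of_nonpos (hd i) (hex i hi))
          · rw [h3 i hi his, zero_mul]
      have e2 : C.bil (Pi.single s 1) n ≤ C.bil (Pi.single s 1) (Pi.single s 1) := by
        rw [bil_single_left, bil_single_left, one_mul, one_mul]
        refine mul_le_mul_of_nonneg_left ?_ (hd s)
        refine Finset.sum_le_sum fun j _ => ?_
        by_cases hjs : j = s
        · subst hjs; simp [h1]
        · rw [Pi.single_eq_of_ne hjs, mul_zero]
          exact mul_nonpos_of_nonpos_of_nonneg (C.offdiag s j (Ne.symm hjs)) (h2 j)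
      exact e1.trans e2

end Lad

variable (C q X s) in
/-- The extremal weight vectors of the module generated by `Eₛ`: those obtained from `Eₛ` by moving
along entire `Eᵢ`-strings, `i ∈ X`. -/
inductive Reach : (I → ℤ) → C.U q → Prop
  | base : Reach (Pi.single s 1) (C.E q s)
  | step {i : I} (hi : i ∈ X) {n : I → ℤ} {y : C.U q} (m : ℕ) (hm : C.cp i n = -m)
      (hy : Reach n y) : Reach (n + Pi.single i (m : ℤ)) ((C.triple q i).dE m y)

namespace Reach

variable {n : I → ℤ} {y : C.U q}

theorem cast {m : I → ℤ} (h : C.Reach q X s n y) (e : n = m) : C.Reach q X s m y := e ▸ h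

theorem lad (h : C.Reach q X s n y) : C.Lad q X s n y := by
  induction h with
  | base => exact .base
  | step hi m _ _ ih => exact ih.dE hi m

theorem bil_eq (h : C.Reach q X s n y) : C.bil n n = 2 * C.d s := by
  induction h with
  | base => rw [bil_single_left, cp_single, C.diag]; ring
  | step hi m hm _ ih => rw [bil_add_single, ih, hm]; ring

/-- The pairings of an extremal weight with the simple roots are multiples of half the square length
of `αₛ`, as for `αₛ` itself. -/
theorem dvd (h : C.Reach q X s n y) (j : I) : (C.d s : ℤ) ∣ C.d j * C.cp j n := by
  induction h generalizing j with
  | base =>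
    rw [cp_single, mul_one, C.symm]; exact dvd_mul_right _ _
  | @step i hi n y m hm _ ih =>
    rw [cp_add, cp_single, mul_add]
    refine dvd_add (ih j) ?_
    have e : C.d j * (C.a j i * m) = -((C.d i * C.cp i n) * C.a i j) := by
      rw [hm]; linear_combination (m : ℤ) * C.symm j i
    rw [e, dvd_neg]
    exact (ih i).mul_right _

theorem coeff_self (hs : s ∉ X) (h : C.Reach q X s n y) : n s = 1 := by
  induction h with
  | base => simp
  | @step i hi n y m hm _ ih =>
    have : s ≠ i := by rintro rfl; exact hs hi
    simp [this, ih]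

theorem coeff_nonneg (h : C.Reach q X s n y) (j : I) : 0 ≤ n j := by
  induction h with
  | base => exact (Pi.single_nonneg.mpr zero_le_one : (0 : I → ℤ) ≤ Pi.single s 1) j
  | @step i hi n y m hm _ ih =>
    exact add_nonneg ih
      ((Pi.single_nonneg.mpr (Int.natCast_nonneg m) : (0 : I → ℤ) ≤ Pi.single i (m : ℤ)) j)

/-- An extremal vector is the lower end of its `Eᵢ`-string if its weight is not positive there:
below it, weights would be longer than `αₛ`. -/
theorem adF_eq_zero (hs : s ∉ X) (h : C.Reach q X s n y) {i : I} (hi : i ∈ X)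
    (hc : C.cp i n ≤ 0) : (C.triple q i).adF y = 0 := by
  by_contra h0
  have h1 := (h.lad.adF hi hs).bil_le hs h0
  have hd : (0 : ℤ) < C.d i := by exact_mod_cast C.d_pos i
  rw [sub_eq_add_neg, ← Pi.single_neg, bil_add_single, h.bil_eq, bil_single_left, cp_single,
    C.diag] at h1
  nlinarith

/-- The braid operators move extremal vectors along strings. -/
theorem T_eq (hs : s ∉ X) (h : C.Reach q X s n y) {i : I} (hi : i ∈ X) {m : ℕ}
    (hm : C.cp i n = -m) : C.T q i y = (C.triple q i).dE m y :=
  (((h.lad.mult hi hs).inG.cast hm).good_of_low (h.adF_eq_zero hs hi (by omega))).top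

/-- If `αᵢ`, `αⱼ` pair positively with an extremal weight `n`, they are orthogonal: otherwise
`n - αᵢ - αⱼ` would be a nonzero vector of nonpositive square length. -/
theorem a_eq_zero (hs : s ∉ X) (h : C.Reach q X s n y) {i j : I} (hi : i ∈ X) (hj : j ∈ X)
    (hij : i ≠ j) (hci : 0 < C.cp i n) (hcj : 0 < C.cp j n) : C.a i j = 0 := by
  by_contra ha
  have ha' : C.a i j < 0 := lt_of_le_of_ne (C.offdiag i j hij) ha
  have hb' : C.a j i < 0 :=
    lt_of_le_of_ne (C.offdiag j i hij.symm) fun h => ha (C.a_eq_zero_symm h)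
  have hdi : (0 : ℤ) < C.d i := by exact_mod_cast C.d_pos i
  have hdj : (0 : ℤ) < C.d j := by exact_mod_cast C.d_pos j
  have h1 : (C.d s : ℤ) ≤ C.d i * C.cp i n := Int.le_of_dvd (by positivity) (h.dvd i)
  have h2 : (C.d s : ℤ) ≤ C.d j * C.cp j n := Int.le_of_dvd (by positivity) (h.dvd j)
  have h3 : (C.d i : ℤ) ≤ C.d i * C.cp i n := by nlinarith
  have h4 : (C.d j : ℤ) ≤ C.d j * C.cp j n := by nlinarith
  have h5 := C.symm i j
  have h6 : C.d i * C.a i j ≤ -(C.d i : ℤ) := by nlinarith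
  have h7 : C.d i * C.a i j ≤ -(C.d j : ℤ) := by rw [h5]; nlinarith
  have hne : n + Pi.single i (-1) + Pi.single j (-1) ≠ 0 := fun he => by
    have h8 := congrFun he s
    have h9 : s ≠ i := by rintro rfl; exact hs hi
    have h10 : s ≠ j := by rintro rfl; exact hs hj
    simp [h9, h10, h.coeff_self hs] at h8
  have h11 := C.bil_self_pos hne
  rw [bil_add_single, bil_add_single, cp_add, cp_single, h.bil_eq] at h11
  rcases le_total (C.d i) (C.d j) with h12 | h12 <;> nlinarith

/-- An extremal vector at the top of an `Eᵢ`-string comes from an extremal vector at its bottom. -/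
theorem exists_eq_dE (hs : s ∉ X) (h : C.Reach q X s n y) {i : I} (hi : i ∈ X) {m : ℕ}
    (hm : C.cp i n = m) :
    ∃ y', C.Reach q X s (n - Pi.single i (m : ℤ)) y' ∧ y = (C.triple q i).dE m y' := by
  rcases Nat.eq_zero_or_pos m with rfl | hm0
  · exact ⟨y, h.cast (by simp), by rw [QTriple.dE_zero]⟩
  induction h with
  | base =>
    have his : i ≠ s := by rintro rfl; exact hs hi
    have := C.offdiag i s his
    rw [cp_single] at hm
    omega
  | @step j hj n y k hk hy ih =>
    by_cases hij : i = j
    · subst hij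
      have hkm : k = m := by
        rw [cp_add, cp_single, hk, C.diag] at hm; omega
      subst hkm
      exact ⟨y, hy.cast (by abel), rfl⟩
    rcases Nat.eq_zero_or_pos k with rfl | hk0
    · obtain ⟨y', h1, h2⟩ := ih (by simpa using hm)
      exact ⟨y', h1.cast (by simp), by rw [QTriple.dE_zero, h2]⟩
    have ha : C.a i j = 0 := (Reach.step hj k hk hy).a_eq_zero hs hi hj hij (by omega) (by
      rw [cp_add, cp_single, hk, C.diag]; omega)
    obtain ⟨y', h1, h2⟩ := ih (by rw [cp_add, cp_single, ha] at hm; omega)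
    have h3 : C.cp j (n - Pi.single i (m : ℤ)) = -k := by
      rw [cp_sub, cp_single, C.a_eq_zero_symm ha, hk]; ring
    refine ⟨_, (Reach.step hj k h3 h1).cast (by abel), ?_⟩
    rw [h2, dE_dE_comm hij ha h1.lad.hasWt]

theorem dF_reach (hs : s ∉ X) (h : C.Reach q X s n y) {i : I} (hi : i ∈ X) {m : ℕ}
    (hm : C.cp i n = m) : C.Reach q X s (n - Pi.single i (m : ℤ)) ((C.triple q i).dF m y) := by
  obtain ⟨y', h1, rfl⟩ := h.exists_eq_dE hs hi hm
  have hc : C.cp i (n - Pi.single i (m : ℤ)) = -m := by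
    rw [cp_sub, cp_single, hm, C.diag]; ring
  rw [QTriple.dF_dE_self _ ((h1.lad.hasWt.wt i).cast hc) (h1.adF_eq_zero hs hi (by omega))]
  exact h1

theorem eq_E (h : C.Reach q X s n y) (hs : s ∉ X) (hn : n = Pi.single s 1) : y = C.E q s := by
  induction h with
  | base => rfl
  | @step i hi n y m hm hy ih =>
    have his : i ≠ s := by rintro rfl; exact hs hi
    have h1 := congrFun hn i
    have h2 := hy.coeff_nonneg i
    simp only [Pi.add_apply, Pi.single_eq_same, Pi.single_eq_of_ne his] at h1
    have hm0 : m = 0 := by omega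
    subst hm0
    rw [QTriple.dE_zero]
    exact ih (by simpa using hn)

end Reach

end CartanDatum

/-! ### The Weyl group on the root lattice -/

namespace CartanDatum

variable {I : Type*} [Fintype I] [DecidableEq I] {C : CartanDatum I} {q : Set.Ioo (0 : ℝ) 1}

/-- An element of the span of `X` in the root lattice that pairs to zero with the coroots in `X`
vanishes. -/
theorem eq_zero_of_cp {X : Finset I} {n : I → ℤ} (hX : ∀ i, i ∉ X → n i = 0)
    (h : ∀ k ∈ X, C.cp k n = 0) : n = 0 := by
  by_contra h0
  refine (C.bil_self_pos h0).ne' (Finset.sum_eq_zero fun i _ => ?_)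
  by_cases hi : i ∈ X
  · rw [h i hi, mul_zero, mul_zero]
  · rw [hX i hi, zero_mul]

theorem ofRoot_injective : Function.Injective C.ofRoot := fun m n h => by
  rw [← sub_eq_zero]
  refine eq_zero_of_cp (C := C) (X := Finset.univ) (by simp) fun k _ => ?_
  rw [cp_sub, sub_eq_zero]
  exact congrFun h k

theorem cp_rwordAct (u : List I) (n : I → ℤ) (k : I) :
    C.cp k (C.rwordAct u n) = C.wordAct u (C.ofRoot n) k :=
  congrFun (ofRoot_rwordAct (C := C) u n) k

theorem wordAct_eq_self {u : List I} {ω : I → ℤ} (h : ∀ r ∈ u, ω r = 0) : C.wordAct u ω = ω := by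
  induction u with
  | nil => rfl
  | cons r u ih =>
    rw [wordAct_cons, ih fun k hk => h k (by simp [hk]), refl, h r (by simp), zero_smul, sub_zero]

/-! ### The torus action -/

theorem adTorus_rel {z : I → ℂ} (hz : ∀ r, z r ≠ 0) {x y : Free I} (h : C.Rel q x y) :
    (C.proj q).comp (adTorus z) x = (C.proj q).comp (adTorus z) y := by
  change C.proj q (adTorus z x) = C.proj q (adTorus z y)
  have hE : ∀ r, C.proj q (adTorus z (Free.E r)) = z r • C.E q r := fun r => by
    simp [adTorus, Free.E, E]
  have hF : ∀ r, C.proj q (adTorus z (Free.F r)) = (z r)⁻¹ • C.F q r := fun r => by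
    simp [adTorus, Free.F, F]
  have hK : ∀ ω, C.proj q (adTorus z (Free.K ω)) = C.K q ω := fun ω => by
    simp [adTorus, Free.K, K]
  cases h with
  | K_zero => rw [hK, K_zero, map_one, map_one]
  | K_add ω χ => simp only [map_mul, hK, K_add]
  | K_E ω r =>
    simp only [map_mul, map_smul, hK, hE, mul_smul_comm, smul_mul_assoc, K_E]
    rw [smul_comm]
  | K_F ω r =>
    simp only [map_mul, map_smul, hK, hF, mul_smul_comm, smul_mul_assoc, K_F]
    rw [smul_comm]
  | E_F_same r =>
    simp only [map_mul, map_smul, map_sub, hK, hF, hE, mul_smul_comm, smul_mul_assoc, smul_smul,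
      mul_inv_cancel₀ (hz r), inv_mul_cancel₀ (hz r), one_smul, E_F_same]
  | E_F r s h =>
    simp only [map_mul, map_sub, map_zero, hF, hE, mul_smul_comm, smul_mul_assoc, smul_smul]
    rw [mul_comm (z r), ← smul_sub, C.E_F r s h, smul_zero]
  | serre_E r s h =>
    rw [serre_map, serre_map, hE, hE, map_zero, map_zero, serre_eq, serreSum_smul, ← serre_eq,
      C.serre_E r s h, smul_zero]
  | serre_F r s h =>
    rw [serre_map, serre_map, hF, hF, map_zero, map_zero, serre_eq, serreSum_smul, ← serre_eq,
      C.serre_F r s h, smul_zero]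

variable (C q) in
/-- The automorphism `Ad z` of `U_q(𝔤)`. -/
def torusAut {z : I → ℂ} (hz : ∀ r, z r ≠ 0) : C.U q →ₐ[ℂ] C.U q :=
  RingQuot.liftAlgHom ℂ ⟨(C.proj q).comp (adTorus z), fun _ _ h => adTorus_rel hz h⟩

theorem torusAut_proj {z : I → ℂ} (hz : ∀ r, z r ≠ 0) (x : Free I) :
    C.torusAut q hz (C.proj q x) = C.proj q (adTorus z x) := by
  change RingQuot.liftAlgHom ℂ _ (RingQuot.mkAlgHom ℂ (C.Rel q) x) = _
  rw [RingQuot.liftAlgHom_mkAlgHom_apply]; rfl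

theorem Lad.torusAut {z : I → ℂ} (hz : ∀ r, z r ≠ 0) {X : Finset I} (hX : ∀ r ∈ X, z r = 1)
    {s : I} {n : I → ℤ} {y : C.U q} (h : C.Lad q X s n y) : C.torusAut q hz y = z s • y := by
  have hE : ∀ r, C.torusAut q hz (C.E q r) = z r • C.E q r := fun r => by
    rw [E, torusAut_proj]; simp [adTorus, Free.E]
  induction h with
  | base => exact hE s
  | @adE i hi n y hy ih =>
    have hEi : C.torusAut q hz (C.triple q i).E = (C.triple q i).E := by
      change C.torusAut q hz (C.E q i) = C.E q i
      rw [hE, hX i hi, one_smul]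
    rw [(hy.hasWt.wt i).adE_eq, map_sub, map_smul, map_mul, map_mul, ih, hEi, smul_sub,
      mul_smul_comm, smul_mul_assoc, smul_comm (z s)]
  | zero n => rw [map_zero, smul_zero]
  | add _ _ ih ih' => rw [map_add, ih, ih', smul_add]
  | smul c _ ih => rw [map_smul, ih, smul_comm]

/-! ### Lusztig's operators for words -/

variable (C q) in
/-- The composition `T_{r₁} ⋯ T_{r_M}` of braid operators on `U_q(𝔤)`. -/
def TWord (u : List I) : C.U q →ₐ[ℂ] C.U q :=
  u.foldr (fun r f => (C.T q r).comp f) (AlgHom.id ℂ (C.U q))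

theorem TWord_cons (k : I) (u : List I) (x : C.U q) :
    C.TWord q (k :: u) x = C.T q k (C.TWord q u x) := rfl

theorem TWord_proj (u : List I) (x : Free I) :
    C.TWord q u (C.proj q x) = C.proj q (C.braidWord q u x) := by
  induction u with
  | nil => rfl
  | cons k u ih => rw [TWord_cons, ih, T_proj]; rfl

/-- The exponent `-⟨u αₜ, αₖ^∨⟩` of the divided power that takes the extremal vector of weight
`u αₜ` to the one of weight `sₖ u αₜ`. It is truncated to a natural number, but nothing is lost if
the word `k :: u` is reduced. -/
def height (C : CartanDatum I) (t k : I) (u : List I) : ℕ := (-C.wordAct u (C.root t) k).toNat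

theorem coe_height {X : Finset I} {t k : I} {u : List I} (h : C.IsReducedWord (k :: u))
    (hu : ∀ r ∈ k :: u, r ∈ X) (ht : t ∉ X) : (C.height t k u : ℤ) = -C.wordAct u (C.root t) k :=
  Int.toNat_of_nonneg (by
    have := h.wordAct_root_nonpos (hu k (by simp)) (fun r hr => hu r (by simp [hr])) ht
    omega)

variable (C q) in
/-- The composition `(ad F_{r₁})⁽ᵐ¹⁾ ⋯ (ad F_{r_M})⁽ᵐᴹ⁾` for a word `r₁ ⋯ r_M`, with the exponents
for which `T_{r₁} ⋯ T_{r_M} Eₜ = (ad E_{r₁})⁽ᵐ¹⁾ ⋯ (ad E_{r_M})⁽ᵐᴹ⁾ Eₜ` if the word is reduced. -/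
def lower (t : I) : List I → C.U q →ₗ[ℂ] C.U q
  | [] => LinearMap.id
  | k :: u => ((C.triple q k).dF (C.height t k u)).comp (lower t u)

theorem lower_cons (t k : I) (u : List I) (x : C.U q) :
    C.lower q t (k :: u) x = (C.triple q k).dF (C.height t k u) (C.lower q t u x) := rfl

variable {X : Finset I} {t : I} {u : List I}

theorem TWord_cons_E (h : C.IsReducedWord (k :: u)) (hu : ∀ r ∈ k :: u, r ∈ X) (ht : t ∉ X)
    (hy : C.Reach q X t (C.rwordAct u (Pi.single t 1)) (C.TWord q u (C.E q t))) :
    C.TWord q (k :: u) (C.E q t) =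
      (C.triple q k).dE (C.height t k u) (C.TWord q u (C.E q t)) := by
  rw [TWord_cons]
  refine hy.T_eq ht (hu k (by simp)) ?_
  rw [cp_rwordAct, ofRoot_single, coe_height h hu ht, neg_neg]

/-- The braid operators of a reduced word map `Eₜ` to an extremal vector. -/
theorem reach_TWord (h : C.IsReducedWord u) (hu : ∀ r ∈ u, r ∈ X) (ht : t ∉ X) :
    C.Reach q X t (C.rwordAct u (Pi.single t 1)) (C.TWord q u (C.E q t)) := by
  induction u with
  | nil => exact .base
  | cons k u ih =>
    have hy := ih h.tail fun r hr => hu r (by simp [hr])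
    rw [TWord_cons_E h hu ht hy]
    have e : C.cp k (C.rwordAct u (Pi.single t 1)) = -(C.height t k u : ℤ) := by
      rw [cp_rwordAct, ofRoot_single, coe_height h hu ht, neg_neg]
    refine (Reach.step (hu k (by simp)) _ e hy).cast ?_
    rw [rwordAct_cons, rrefl, e, neg_neg]

/-- The adjoint exchanges `ad Eᵢ` and `-ad Fᵢ`. -/
theorem star_adE (i : I) (x : C.U q) :
    star ((C.triple q i).adE x) = -(C.triple q i).adF (star x) := by
  rw [QTriple.adE_def, QTriple.adF_def]
  change star (C.E q i * x - C.K q (C.root i) * (x * C.K q (-C.root i)) * C.E q i) =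
    -((C.F q i * star x - star x * C.F q i) * C.K q (C.root i))
  rw [star_sub, star_mul, star_mul, star_mul, star_mul, star_E, star_K, star_K, sub_mul, neg_sub]
  have h : C.F q i * C.K q (C.root i) * (C.K q (-C.root i) * star x * C.K q (C.root i)) =
      C.F q i * star x * C.K q (C.root i) := by
    rw [← mul_assoc, ← mul_assoc, mul_assoc (C.F q i), ← K_add]
    simp [K_zero]
  rw [h]
  simp only [mul_assoc]

theorem star_dE (i : I) (m : ℕ) (x : C.U q) :
    star ((C.triple q i).dE m x) = (-1 : ℂ) ^ m • (C.triple q i).dF m (star x) := by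
  have h : star (((C.triple q i).adE ^ m) x) =
      (-1 : ℂ) ^ m • ((C.triple q i).adF ^ m) (star x) := by
    induction m with
    | zero => simp
    | succ m ih =>
      rw [pow_succ', Module.End.mul_apply, star_adE, ih, map_smul, pow_succ' (_ : ℂ),
        pow_succ' (C.triple q i).adF, Module.End.mul_apply]
      module
  rw [QTriple.dE_def, QTriple.dF_def, star_smul, h, smul_comm]
  congr 2
  change (starRingEnd ℂ) _ = _
  rw [map_inv₀, conj_qFact (C.conj_qr i)]

/-- Up to a sign, `lower` applied to `Fₜ Kₜ = Eₜ^*` is the adjoint of the image of `Eₜ` under the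
braid operators. -/
theorem lower_F_mul_K (h : C.IsReducedWord u) (hu : ∀ r ∈ u, r ∈ X) (ht : t ∉ X) :
    C.lower q t u (C.F q t * C.K q (C.root t)) =
      (-1 : ℂ) ^ C.lowering (C.root t) u • star (C.TWord q u (C.E q t)) := by
  induction u with
  | nil => simp [lower, lowering, TWord, star_E]
  | cons k u ih =>
    have hu' : ∀ r ∈ u, r ∈ X := fun r hr => hu r (by simp [hr])
    rw [TWord_cons_E h hu ht (reach_TWord h.tail hu' ht), star_dE, lower_cons, ih h.tail hu',
      map_smul, lowering, ← coe_height h hu ht, zpow_add₀ (by norm_num), zpow_natCast, smul_smul]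
    congr 1
    rw [mul_right_comm, ← mul_pow]
    norm_num

end CartanDatum

/-! ### Admissible pairs and the longest element -/

namespace AdmissiblePair

open CartanDatum

variable {I : Type*} [Fintype I] [DecidableEq I] {C : CartanDatum I} {q : Set.Ioo (0 : ℝ) 1}
variable (S : AdmissiblePair C) {w : List I}

/-- Short roots have square length `2` in every simple summand, so that a diagram automorphism
cannot scale lengths. The proof compares the ratio of the two lengths along a path to a short root.
-/
theorem d_le_d_τ (i : I) : C.d i ≤ C.d (S.τ i) := by
  obtain ⟨j, hij, hj⟩ := C.short i
  have h : (C.d (S.τ i) * C.d j : ℤ) = C.d (S.τ j) * C.d i := by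
    clear hj
    induction hij with
    | refl => rfl
    | @tail k l _ hkl ih =>
      have hkl' : C.a l k ≠ 0 := fun h => hkl (C.a_eq_zero_symm h)
      have hdk : (C.d k : ℤ) ≠ 0 := by exact_mod_cast (C.d_pos k).ne'
      have h1 := C.symm k l
      have h2 := C.symm (S.τ k) (S.τ l)
      rw [S.τ_cartan, S.τ_cartan] at h2
      refine mul_left_cancel₀ (mul_ne_zero hdk hkl') ?_
      linear_combination (C.a l k * C.d l) * ih + (C.d (S.τ k) * C.d i) * (-h1) +
        (C.d k * C.d i) * h2
  rw [hj, Nat.cast_one, mul_one] at h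
  have h1 : 1 ≤ C.d (S.τ j) := C.d_pos _
  have h2 : C.d (S.τ i) = C.d (S.τ j) * C.d i := by exact_mod_cast h
  rw [h2]
  exact Nat.le_mul_of_pos_left _ h1

theorem d_τ (i : I) : C.d (S.τ i) = C.d i := by
  refine le_antisymm ?_ (S.d_le_d_τ i)
  have := S.d_le_d_τ (S.τ i)
  rwa [S.τ_invol] at this

theorem a_τ_left (r s : I) : C.a (S.τ r) s = C.a r (S.τ s) := by
  rw [← S.τ_cartan, S.τ_invol]

theorem rwordAct_single (hw : C.IsLongestWord S.X w) {k : I} (hk : k ∈ S.X) :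
    C.rwordAct w (Pi.single k 1) = -Pi.single (S.τ k) 1 := by
  apply ofRoot_injective (C := C)
  rw [ofRoot_rwordAct, ofRoot_single, S.τ_longest w hw k hk, ← ofRoot_single]
  funext j; simp [ofRoot, cp_neg]

/-- On `X`, the action of `w_X` on weights is the negative of that of `τ`. -/
theorem cp_rwordAct_longest (hw : C.IsLongestWord S.X w) {k : I} (hk : k ∈ S.X) (n : I → ℤ) :
    C.cp k (C.rwordAct w n) = -C.cp (S.τ k) n := by
  have h1 := C.bil_rwordAct w n (Pi.single (S.τ k) 1)
  have hd : (C.d k : ℤ) ≠ 0 := by exact_mod_cast (C.d_pos k).ne'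
  rw [S.rwordAct_single hw (S.τ_X k hk), S.τ_invol, ← Pi.single_neg, bil_single_right,
    bil_single_right, S.d_τ] at h1
  refine mul_left_cancel₀ hd ?_
  linarith

theorem rwordAct_rwordAct (hw : C.IsLongestWord S.X w) (n : I → ℤ) :
    C.rwordAct w (C.rwordAct w n) = n := by
  rw [← sub_eq_zero]
  refine eq_zero_of_cp (C := C) (X := S.X) (fun i hi => ?_) fun k hk => ?_
  · rw [Pi.sub_apply, rwordAct_apply_of_notMem hw.1 _ hi, rwordAct_apply_of_notMem hw.1 _ hi,
      sub_self]
  · rw [cp_sub, S.cp_rwordAct_longest hw hk, S.cp_rwordAct_longest hw (S.τ_X k hk), S.τ_invol]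
    ring

theorem rwordAct_sub_τ (hw : C.IsLongestWord S.X w) (r : I) :
    C.rwordAct w (Pi.single (S.τ r) 1 - Pi.single r 1) =
      Pi.single (S.τ r) 1 - Pi.single r 1 := by
  rw [← sub_eq_zero]
  refine eq_zero_of_cp (C := C) (X := S.X) (fun i hi => ?_) fun k hk => ?_
  · rw [Pi.sub_apply, rwordAct_apply_of_notMem hw.1 _ hi, sub_self]
  · rw [cp_sub, S.cp_rwordAct_longest hw hk, cp_sub, cp_sub, cp_single, cp_single, cp_single,
      cp_single, S.a_τ_left, S.a_τ_left, S.τ_invol]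
    ring

theorem root_comp_τ (r : I) : (fun i => C.root r (S.τ.symm i)) = C.root (S.τ r) := by
  funext i
  have h : S.τ.symm i = S.τ i := by
    rw [Equiv.symm_apply_eq, S.τ_invol]
  rw [h, root, root, S.a_τ_left]

theorem Theta_root (r : I) : S.Theta w (C.root r) = -C.wordAct w (C.root (S.τ r)) := by
  rw [Theta, root_comp_τ]

theorem Theta_sub (hw : C.IsLongestWord S.X w) (r : I) :
    S.Theta w (C.root (S.τ r) - C.root r) = C.root (S.τ r) - C.root r := by
  have h1 : (fun i => (C.root (S.τ r) - C.root r) (S.τ.symm i)) = C.root r - C.root (S.τ r) := by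
    have h2 := S.root_comp_τ (S.τ r)
    have h3 := S.root_comp_τ r
    rw [S.τ_invol] at h2
    change (fun i => C.root (S.τ r) (S.τ.symm i)) - (fun i => C.root r (S.τ.symm i)) = _
    rw [h2, h3]
  have h2 := congrArg C.ofRoot (S.rwordAct_sub_τ hw r)
  have h3 : C.ofRoot (Pi.single (S.τ r) 1 - Pi.single r 1) = C.root (S.τ r) - C.root r := by
    rw [← ofRoot_single, ← ofRoot_single]; funext k; simp only [ofRoot, cp_sub, Pi.sub_apply]
  rw [ofRoot_rwordAct, h3] at h2
  rw [Theta, h1, show C.root r - C.root (S.τ r) = (-1 : ℤ) • (C.root (S.τ r) - C.root r) by module,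
    wordAct_smul, h2]
  module

/-- The operator `lower` for `t` undoes the braid operators on `E_{τ(t)}`, because
`w_X α_{τ(t)} + αₜ` is orthogonal to `X`: the pairings that give the exponents for `αₜ` are opposite
to those met on the way down from `w_X α_{τ(t)}`. -/
theorem lower_TWord (hw : C.IsLongestWord S.X w) {t : I} (ht : t ∉ S.X) :
    C.lower q t w (C.TWord q w (C.E q (S.τ t))) = C.E q (S.τ t) := by
  have hr : S.τ t ∉ S.X := fun h => ht (by simpa [S.τ_invol] using S.τ_X _ h)
  have hreach := reach_TWord (q := q) hw.2.1 hw.1 hr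
  set n₀ := C.rwordAct w (Pi.single (S.τ t) 1) with hn₀
  set y := C.TWord q w (C.E q (S.τ t)) with hy
  have horth : ∀ k ∈ S.X, (C.ofRoot n₀ + C.root t) k = 0 := fun k hk => by
    rw [Pi.add_apply, ofRoot, S.cp_rwordAct_longest hw hk, cp_single, S.τ_cartan, root]
    ring
  have key : ∀ u : List I, C.IsReducedWord u → (∀ r ∈ u, r ∈ S.X) →
      C.Reach q S.X (S.τ t) (C.rwordAct u n₀) (C.lower q t u y) := by
    intro u
    induction u with
    | nil => exact fun _ _ => hreach
    | cons k u ih =>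
      intro hred hu
      have hu' : ∀ r ∈ u, r ∈ S.X := fun r hr => hu r (by simp [hr])
      have hk : k ∈ S.X := hu k (by simp)
      have e : C.cp k (C.rwordAct u n₀) = (C.height t k u : ℤ) := by
        have h1 := wordAct_eq_self (C := C) (u := u) fun r hr => horth r (hu' r hr)
        have h2 := congrFun h1 k
        rw [horth k hk, wordAct_add, Pi.add_apply] at h2
        rw [cp_rwordAct, coe_height hred hu ht]
        omega
      rw [lower_cons]
      refine ((ih hred.tail hu').dF_reach hr hk e).cast ?_
      rw [rwordAct_cons, rrefl, e, Pi.single_neg, sub_eq_add_neg]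
  refine (key w hw.2.1 hw.1).eq_E hr ?_
  rw [hn₀, S.rwordAct_rwordAct hw]

/-- If `αₜ` is orthogonal to `X`, all exponents in `lower` vanish. -/
theorem lower_of_mem_Ins {t : I} (ht : t ∈ S.Ins) {u : List I} (hu : ∀ r ∈ u, r ∈ S.X) (x : C.U q) :
    C.lower q t u x = x := by
  have h0 : ∀ k ∈ S.X, C.root t k = 0 := fun k hk => by
    have := ht.2.2 k hk
    have hd : (C.d k : ℤ) ≠ 0 := by exact_mod_cast (C.d_pos k).ne'
    exact (mul_eq_zero.mp this).resolve_left hd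
  induction u with
  | nil => rfl
  | cons k u ih =>
    have hu' : ∀ r ∈ u, r ∈ S.X := fun r hr => hu r (by simp [hr])
    rw [lower_cons, ih hu', height, wordAct_eq_self fun r hr => h0 r (hu' r hr),
      h0 k (hu k (by simp)), neg_zero, Int.toNat_zero, QTriple.dF_zero]

/-! ### The coideal subalgebra -/

/-- The image of `FᵣKᵣ` under `θ_q`: the factor `K` introduced by `ψ` cancels. -/
theorem thetaQ_F_mul_K (z : I → ℂ) (hz : ∀ r, z r ≠ 0) (hzX : ∀ r ∈ S.X, z r = 1)
    (hw : C.IsLongestWord S.X w) {r : I} (hr : S.τ r ∉ S.X) :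
    C.proj q (S.thetaQ q w z (Free.F r * Free.K (C.root r))) =
      -(z (S.τ r) • C.TWord q w (C.E q (S.τ r))) := by
  have e : C.proj q ((C.psi.comp ((diagramAut S.τ).comp chevalley))
      (Free.F r * Free.K (C.root r))) = -C.E q (S.τ r) := by
    have h1 : (fun i => (-C.root r) (S.τ.symm i)) = -C.root (S.τ r) := by
      rw [← S.root_comp_τ r]; rfl
    have h2 : (C.psi.comp ((diagramAut S.τ).comp chevalley)) (Free.F r * Free.K (C.root r)) =
        -(Free.E (S.τ r) * Free.K (C.root (S.τ r)) * Free.K (-C.root (S.τ r))) := by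
      rw [← h1]
      simp [psi, diagramAut, chevalley, Free.E, Free.F, Free.K]
    rw [h2, map_neg, map_mul, map_mul]
    change -(C.E q _ * C.K q _ * C.K q _) = _
    rw [mul_assoc, ← K_add, add_neg_cancel, K_zero, mul_one]
  have h3 := (reach_TWord (q := q) hw.2.1 hw.1 hr).lad.torusAut hz hzX
  rw [thetaQ, AlgHom.comp_apply, AlgHom.comp_apply, ← torusAut_proj hz, ← TWord_proj, e, map_neg,
    map_neg, h3]

section Membership

variable {z c s : I → ℂ}

theorem E_mem {r : I} (hr : r ∈ S.X) : C.E q r ∈ S.coideal q w z c s :=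
  Algebra.subset_adjoin (Or.inl (Or.inl ⟨r, hr, Or.inl rfl⟩))

theorem F_mem {r : I} (hr : r ∈ S.X) : C.F q r ∈ S.coideal q w z c s :=
  Algebra.subset_adjoin (Or.inl (Or.inl ⟨r, hr, Or.inr (Or.inl rfl)⟩))

theorem K_root_mem {r : I} (hr : r ∈ S.X) : C.K q (C.root r) ∈ S.coideal q w z c s :=
  Algebra.subset_adjoin (Or.inl (Or.inl ⟨r, hr, Or.inr (Or.inr (Or.inl rfl))⟩))

theorem K_neg_root_mem {r : I} (hr : r ∈ S.X) : C.K q (-C.root r) ∈ S.coideal q w z c s :=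
  Algebra.subset_adjoin (Or.inl (Or.inl ⟨r, hr, Or.inr (Or.inr (Or.inr rfl))⟩))

theorem K_mem {ω : I → ℤ} (h : S.Theta w ω = ω) : C.K q ω ∈ S.coideal q w z c s :=
  Algebra.subset_adjoin (Or.inl (Or.inr ⟨ω, h, rfl⟩))

theorem B_mem {r : I} (hr : r ∉ S.X) : S.B q w z c s r ∈ S.coideal q w z c s :=
  Algebra.subset_adjoin (Or.inr ⟨r, hr, rfl⟩)

/-- The elements `x` for which `x K_ω` lies in the coideal subalgebra are stable under the adjoint
action of the `Fⱼ`, `j ∈ X`. -/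
theorem adF_mul_K_mem {j : I} (hj : j ∈ S.X) {ω : I → ℤ} {x : C.U q}
    (h : x * C.K q ω ∈ S.coideal q w z c s) :
    (C.triple q j).adF x * C.K q ω ∈ S.coideal q w z c s := by
  have e : (C.triple q j).adF x * C.K q ω = C.F q j * (x * C.K q ω) * C.K q (C.root j) -
      qc q ^ C.form ω j • (x * C.K q ω * C.F q j * C.K q (C.root j)) := by
    rw [QTriple.adF_def]
    change (C.F q j * x - x * C.F q j) * C.K q (C.root j) * C.K q ω = _
    rw [mul_assoc _ (C.K q (C.root j)), K_mul_K, ← mul_assoc, sub_mul, sub_mul, mul_assoc x,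
      F_K, mul_smul_comm, smul_mul_assoc]
    simp only [mul_assoc]
  rw [e]
  exact sub_mem (mul_mem (mul_mem (S.F_mem hj) h) (S.K_root_mem hj))
    (Subalgebra.smul_mem _ (mul_mem (mul_mem h (S.F_mem hj)) (S.K_root_mem hj)) _)

theorem lower_mul_K_mem (t : I) {u : List I} (hu : ∀ r ∈ u, r ∈ S.X) {ω : I → ℤ} {x : C.U q}
    (h : x * C.K q ω ∈ S.coideal q w z c s) :
    C.lower q t u x * C.K q ω ∈ S.coideal q w z c s := by
  induction u with
  | nil => exact h
  | cons k u ih =>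
    have h1 := ih fun r hr => hu r (by simp [hr])
    rw [lower_cons, QTriple.dF_def, smul_mul_assoc]
    refine Subalgebra.smul_mem _ ?_ _
    generalize C.height t k u = m
    induction m with
    | zero => exact h1
    | succ m ihm =>
      rw [pow_succ', Module.End.mul_apply]
      exact S.adF_mul_K_mem (hu k (by simp)) ihm

end Membership

end AdmissiblePair

/-! ### The adjoints of the elements `Bᵣ` -/

namespace AdmissiblePair

open CartanDatum

variable {I : Type*} [Fintype I] [DecidableEq I] {C : CartanDatum I} {q : Set.Ioo (0 : ℝ) 1}
variable (S : AdmissiblePair C) {w : List I} {z c s : I → ℂ}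

theorem τ_notMem {r : I} (hr : r ∉ S.X) : S.τ r ∉ S.X := fun h =>
  hr (by simpa [S.τ_invol] using S.τ_X _ h)

theorem B_eq (hz : ∀ r, z r ≠ 0) (hzX : ∀ r ∈ S.X, z r = 1) (hw : C.IsLongestWord S.X w) {r : I}
    (hr : r ∉ S.X) :
    S.B q w z c s r = (C.F q r * C.K q (C.root r) -
      (c r * z (S.τ r)) • C.TWord q w (C.E q (S.τ r)) + s r • 1) * C.K q (-C.root r) := by
  rw [B, S.thetaQ_F_mul_K z hz hzX hw (S.τ_notMem hr), add_mul, sub_mul, mul_assoc (C.F q r),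
    ← K_add, add_neg_cancel, K_zero, mul_one, neg_mul, smul_neg, smul_mul_assoc, smul_mul_assoc,
    smul_mul_assoc, smul_smul, one_mul, ← sub_eq_add_neg]

/-- The adjoint of a weight vector is a weight vector of the opposite weight. -/
theorem star_mul_K {n : I → ℤ} {y : C.U q} (hy : C.HasWt n y) (ω : I → ℤ) :
    star y * C.K q ω = qc q ^ C.pair ω n • (C.K q ω * star y) := by
  have h := congrArg star (hy ω)
  rw [star_mul, star_smul, star_mul, star_K] at h
  rw [h]
  congr 1
  change (starRingEnd ℂ) _ = _
  rw [map_zpow₀, conj_qc]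

/-- The main computation: up to the two scalar identities assumed here, the adjoint of `Bᵣ` is
obtained from `B_{τ(r)}` by the operator `lower`. -/
theorem star_B_mem (hz : ∀ r, z r ≠ 0) (hzX : ∀ r ∈ S.X, z r = 1) (hw : C.IsLongestWord S.X w)
    {r : I} (hr : r ∉ S.X) (hc : c (S.τ r) ≠ 0) (hsI : s (S.τ r) ≠ 0 → S.τ r ∈ S.Ins)
    (h1 : (-1 : ℂ) ^ C.twoRhoPairing S.X (S.τ r) =
      (starRingEnd ℂ) (c r * z (S.τ r)) * (c (S.τ r) * z r) *
        qc q ^ (2 * C.d r + C.d r * C.wordAct w (C.root (S.τ r)) r : ℤ))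
    (h2 : -s (S.τ r) = (starRingEnd ℂ) (s r) * (c (S.τ r) * z r * qc q ^ (2 * C.d r : ℤ))) :
    star (S.B q w z c s r) ∈ S.coideal q w z c s := by
  have ht := S.τ_notMem hr
  set t := S.τ r with htr
  have hτt : S.τ t = r := S.τ_invol r
  set Y := C.TWord q w (C.E q t) with hY
  set p : ℤ := C.d r * C.wordAct w (C.root t) r with hp
  have hwt := (reach_TWord (q := q) hw.2.1 hw.1 ht).lad.hasWt
  -- the element of the coideal subalgebra obtained from `B_{τ(r)}`
  have m1 : (C.F q t * C.K q (C.root t) - (c t * z r) • C.TWord q w (C.E q r) + s t • 1) *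
      C.K q (-C.root t) ∈ S.coideal q w z c s := by
    have := S.B_mem (q := q) (w := w) (z := z) (c := c) (s := s) ht
    rwa [S.B_eq hz hzX hw ht, hτt] at this
  have m2 := S.lower_mul_K_mem t hw.1 m1
  have hlE : C.lower q t w (C.TWord q w (C.E q r)) = C.E q r := by
    have := S.lower_TWord (q := q) hw ht
    rwa [hτt] at this
  have hl1 : s t • C.lower q t w 1 = s t • (1 : C.U q) := by
    by_cases h0 : s t = 0
    · rw [h0, zero_smul, zero_smul]
    · rw [S.lower_of_mem_Ins (hsI h0) hw.1]
  rw [map_add, map_sub, map_smul, map_smul, hl1, hlE, lower_F_mul_K hw.2.1 hw.1 ht,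
    S.lowering_root hw] at m2
  have m3 := mul_mem m2 (S.K_mem (q := q) (z := z) (c := c) (s := s) (S.Theta_sub hw r))
  rw [mul_assoc, ← K_add, neg_add_eq_sub, sub_sub_cancel_left] at m3
  have e1 : star Y * C.K q (-C.root r) = qc q ^ (-p) • (C.K q (-C.root r) * star Y) := by
    rw [star_mul_K hwt]
    congr 2
    have h3 : C.pair (-C.root r) (C.rwordAct w (Pi.single t 1)) =
        -C.pair (C.root r) (C.rwordAct w (Pi.single t 1)) := by
      simp [pair, form]
    rw [h3, pair_root, cp_rwordAct, ofRoot_single]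
  have e2 : C.E q r * C.K q (-C.root r) =
      qc q ^ (2 * C.d r : ℤ) • (C.K q (-C.root r) * C.E q r) := by
    rw [E_K, form_neg, neg_neg, form, root, C.diag, mul_comm]
  have e3 : star (S.B q w z c s r) = C.K q (-C.root r) * C.E q r -
      (starRingEnd ℂ) (c r * z t) • (C.K q (-C.root r) * star Y) +
        (starRingEnd ℂ) (s r) • C.K q (-C.root r) := by
    rw [S.B_eq hz hzX hw hr, star_mul, star_K, star_add, star_sub, star_smul, star_smul, star_mul,
      star_F, star_K, star_one, mul_add, mul_sub, mul_smul_comm, mul_smul_comm, mul_one,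
      ← mul_assoc (C.K q (C.root r)), ← K_add, add_neg_cancel, K_zero, one_mul]
    rfl
  set κ : ℂ := c t * z r * qc q ^ (2 * C.d r : ℤ) with hκ
  have hκ0 : κ ≠ 0 := mul_ne_zero (mul_ne_zero hc (hz r)) (zpow_ne_zero _ qc_ne)
  have e4 : star (S.B q w z c s r) = (-κ⁻¹) • (((-1 : ℂ) ^ (-C.twoRhoPairing S.X t) • star Y -
      (c t * z r) • C.E q r + s t • 1) * C.K q (-C.root r)) := by
    rw [e3, add_mul, sub_mul, smul_mul_assoc, smul_mul_assoc, smul_mul_assoc, one_mul, e1, e2,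
      smul_add, smul_sub, smul_smul, smul_smul, smul_smul, smul_smul, smul_smul]
    have hp0 : qc q ^ p ≠ 0 := zpow_ne_zero _ qc_ne
    have s1 : (starRingEnd ℂ) (s r) = -κ⁻¹ * s t := by
      field_simp
      linear_combination -h2
    have s2 : -κ⁻¹ * (-1 : ℂ) ^ (-C.twoRhoPairing S.X t) * qc q ^ (-p) =
        -(starRingEnd ℂ) (c r * z t) := by
      have hsign : (-1 : ℂ) ^ (-C.twoRhoPairing S.X t) = (-1 : ℂ) ^ C.twoRhoPairing S.X t := by
        rw [zpow_neg, ← inv_zpow]; norm_num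
      rw [hsign, zpow_neg, h1, zpow_add₀ qc_ne]
      field_simp
      rw [hκ]; ring
    have s3 : -κ⁻¹ * (c t * z r) * qc q ^ (2 * C.d r : ℤ) = -1 := by
      rw [mul_assoc, ← hκ]; field_simp
    rw [s1, s2, s3]
    module
  rw [e4]
  exact Subalgebra.smul_mem _ m3 _

/-- The two sides of the scalar identity for `c`: all pairings are determined by
`w_X (αₜ - αᵣ) = αₜ - αᵣ`, where `t = τ(r)`. -/
theorem form_Theta_sub (hw : C.IsLongestWord S.X w) (r : I) :
    C.form (S.Theta w (C.root r) - C.root r) (S.τ r) =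
      -(2 * C.d r + C.d r * C.wordAct w (C.root (S.τ r)) r) := by
  set t := S.τ r with ht
  have h1 := C.bil_rwordAct w (Pi.single t 1 - Pi.single r 1) (Pi.single t 1)
  rw [ht, S.rwordAct_sub_τ hw, ← ht, bil_sub_left, bil_sub_left, bil_single_left, bil_single_left,
    bil_single_left, bil_single_left, cp_rwordAct, cp_rwordAct, ofRoot_single, cp_single, cp_single,
    C.diag] at h1
  rw [S.Theta_root, ← ht, form, Pi.sub_apply, Pi.neg_apply, show C.root r t = C.a t r from rfl]
  have h2 := C.symm r t
  have h3 : (C.d t : ℤ) = C.d r := by rw [ht, S.d_τ]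
  linear_combination -h1 + h2 - 2 * h3

/-- The parameters `c r` are real: at most one of `r`, `τ(r)` lacks a sign condition, and
`c r * c (τ r)` is a power of `q`. -/
theorem conj_c {J : Set I} (hc : S.IsCParam w c) (hJ : S.IsOrbitReps J)
    (hpos : ∀ r, r ∉ S.X → (S.τ r = r ∨ r ∈ S.IC w ∨ r ∉ J) → 0 < (c r).re ∧ (c r).im = 0)
    (hc_eq : ∀ r, r ∉ S.X → c (S.τ r) * c r =
      qc q ^ C.form (S.Theta w (C.root r) - C.root r) (S.τ r)) {r : I} (hr : r ∉ S.X) :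
    (starRingEnd ℂ) (c r) = c r := by
  by_cases h : S.τ r = r ∨ r ∉ J
  · rw [Complex.conj_eq_iff_im]
    exact (hpos r hr (h.imp_right Or.inr)).2
  · push Not at h
    have ht := S.τ_notMem hr
    have htJ : S.τ r ∉ J := fun hmem => by
      obtain ⟨x, -, hx⟩ := hJ.2 r hr
      exact h.1 ((hx _ ⟨hmem, Or.inr rfl⟩).trans (hx r ⟨h.2, Or.inl rfl⟩).symm)
    have h1 : (starRingEnd ℂ) (c (S.τ r)) = c (S.τ r) := by
      rw [Complex.conj_eq_iff_im]
      exact (hpos _ ht (Or.inr (Or.inr htJ))).2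
    have h2 := congrArg (starRingEnd ℂ) (hc_eq r hr)
    rw [map_mul, h1, map_zpow₀, conj_qc, ← hc_eq r hr] at h2
    exact mul_left_cancel₀ (hc.1 _ ht) h2

theorem zpow_twoRhoPairing_τ (hz : S.IsTorusChoice z) (r : I) :
    (-1 : ℂ) ^ C.twoRhoPairing S.X (S.τ r) = (-1 : ℂ) ^ C.twoRhoPairing S.X r := by
  have h1 := congrArg (starRingEnd ℂ) (hz.mul_conj r)
  rw [map_mul, Complex.conj_conj, map_zpow₀, map_neg, map_one] at h1
  have h2 := hz.mul_conj (S.τ r)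
  rw [S.τ_invol, mul_comm] at h2
  rw [← h1, ← h2]

/-- For `r ∈ I_ns`, where `s r` may be nonzero, the equation for `c r` has the positive solution
`q ^ (-2 d r)`. -/
theorem c_eq_of_mem_Ins (hw : C.IsLongestWord S.X w) {r : I} (hr : r ∈ S.Ins)
    (hpos : 0 < (c r).re ∧ (c r).im = 0)
    (hc_eq : c r * c r = qc q ^ C.form (S.Theta w (C.root r) - C.root r) r) :
    c r * qc q ^ (2 * C.d r : ℤ) = 1 := by
  have h0 : ∀ k ∈ w, C.root r k = 0 := fun k hk => by
    have := hr.2.2 k (hw.1 k hk)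
    have hd : (C.d k : ℤ) ≠ 0 := by exact_mod_cast (C.d_pos k).ne'
    exact (mul_eq_zero.mp this).resolve_left hd
  have h1 := S.form_Theta_sub hw r
  rw [hr.2.1, wordAct_eq_self h0, show C.root r r = C.a r r from rfl, C.diag] at h1
  rw [h1] at hc_eq
  obtain ⟨x, hx⟩ : ∃ x : ℝ, c r = x := ⟨(c r).re, Complex.ext rfl hpos.2⟩
  rw [hx, Complex.ofReal_re] at hpos
  have hq : (0 : ℝ) < q := q.2.1
  have h2 : (c r * qc q ^ (2 * C.d r : ℤ)) * (c r * qc q ^ (2 * C.d r : ℤ)) = 1 := by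
    rw [mul_mul_mul_comm, hc_eq, ← zpow_add₀ qc_ne, ← zpow_add₀ qc_ne]
    ring_nf
    simp
  rw [hx, qc] at h2 ⊢
  norm_cast at h2 ⊢
  have h3 : 0 < x * (q : ℝ) ^ (2 * C.d r : ℕ) := mul_pos hpos.1 (pow_pos hq _)
  nlinarith

end AdmissiblePair

end QSymPair

end

open QSymPair in
theorem mainTheorem8 {I : Type*} [Fintype I] [DecidableEq I] (C : CartanDatum I)
    (q : Set.Ioo (0 : ℝ) 1) (S : AdmissiblePair C)
    (w : List I) (hw : C.IsLongestWord S.X w)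
    (z : I → ℂ) (hz : S.IsTorusChoice z)
    (c s : I → ℂ) (hc : S.IsCParam w c) (hs : S.IsSParam s)
    (J : Set I) (hJ : S.IsOrbitReps J)
    (hpos : ∀ r, r ∉ S.X → (S.τ r = r ∨ r ∈ S.IC w ∨ r ∉ J) → 0 < (c r).re ∧ (c r).im = 0)
    (hs_imag : ∀ r, r ∉ S.X → (s r).re = 0)
    (hc_eq : ∀ r, r ∉ S.X →
      c (S.τ r) * c r =
        ((q : ℝ) : ℂ) ^ C.form (S.Theta w (C.root r) - C.root r) (S.τ r)) :
    ∀ x ∈ S.coideal q w z c s, star x ∈ S.coideal q w z c s := by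
  have hz0 : ∀ r, z r ≠ 0 := fun r h => by
    have := hz.norm_eq_one r
    rw [h, norm_zero] at this
    exact zero_ne_one this
  have hreal : ∀ r, r ∉ S.X → (starRingEnd ℂ) (c r) = c r := fun r hr =>
    S.conj_c hc hJ hpos hc_eq hr
  have hB : ∀ r, r ∉ S.X → star (S.B q w z c s r) ∈ S.coideal q w z c s := fun r hr => by
    have ht := S.τ_notMem hr
    -- `s` vanishes outside `I_𝒮`, so that only fixed points of `τ` matter for it
    have hsS : ∀ r, r ∉ S.X → s r ≠ 0 → r ∈ S.Ins := fun r hr h => by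
      by_contra hn
      exact h (hs r hr fun h' => hn h'.1)
    refine S.star_B_mem hz0 hz.eq_one_of_mem hw hr (hc.1 _ ht) (hsS _ ht) ?_ ?_
    · have h1 : c (S.τ r) * c r = CartanDatum.qc q ^ C.form (S.Theta w (C.root r) - C.root r)
          (S.τ r) := hc_eq r hr
      rw [S.form_Theta_sub hw r, zpow_neg] at h1
      have h2 : CartanDatum.qc q ^ (2 * C.d r + C.d r * C.wordAct w (C.root (S.τ r)) r : ℤ) ≠ 0 :=
        zpow_ne_zero _ CartanDatum.qc_ne
      rw [S.zpow_twoRhoPairing_τ hz, ← hz.mul_conj r, map_mul, hreal r hr]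
      replace h1 := (congrArg (· * _) h1).trans (inv_mul_cancel₀ h2)
      linear_combination (-(z r * (starRingEnd ℂ) (z (S.τ r)))) * h1
    · by_cases hfix : S.τ r = r
      · rw [hfix]
        by_cases h0 : s r = 0
        · rw [h0]; simp
        · have hI := hsS r hr h0
          have h1 : c r * c r = CartanDatum.qc q ^ C.form (S.Theta w (C.root r) - C.root r) r := by
            have := hc_eq r hr
            rw [hfix] at this
            exact this
          have h2 := S.c_eq_of_mem_Ins hw hI (hpos r hr (Or.inl hfix)) h1
          have h3 : (starRingEnd ℂ) (s r) = -s r :=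
            Complex.ext (by simp [hs_imag r hr]) (by simp)
          rw [hz.eq_one_of_fixed r hfix, mul_one, h2, h3, mul_one]
      · have h0 : s r = 0 := by
          by_contra h
          exact hfix (hsS r hr h).2.1
        have h1 : s (S.τ r) = 0 := by
          by_contra h
          have := (hsS _ ht h).2.1
          rw [S.τ_invol] at this
          exact hfix this.symm
        rw [h0, h1]; simp
  intro x hx
  induction hx using Algebra.adjoin_induction with
  | mem x hx =>
    rcases hx with (⟨r, hr, rfl | rfl | rfl | rfl⟩ | ⟨ω, hω, rfl⟩) | ⟨r, hr, rfl⟩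
    · rw [CartanDatum.star_E]; exact mul_mem (S.F_mem hr) (S.K_root_mem hr)
    · rw [CartanDatum.star_F]; exact mul_mem (S.K_neg_root_mem hr) (S.E_mem hr)
    · rw [CartanDatum.star_K]; exact S.K_root_mem hr
    · rw [CartanDatum.star_K]; exact S.K_neg_root_mem hr
    · rw [CartanDatum.star_K]; exact S.K_mem hω
    · exact hB r hr
  | algebraMap k =>
    rw [Algebra.algebraMap_eq_smul_one, star_smul, star_one]
    exact Subalgebra.smul_mem _ (one_mem _) _
  | add x y _ _ hx hy => rw [star_add]; exact add_mem hx hy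
  | mul x y _ _ hx hy => rw [star_mul]; exact mul_mem hy hx
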